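/- **Setting.** Let $D\in\mathbb N$, $\Lambda\subset\mathbb Z^D$ any subset, and write $x\sim y$ if $\sum_i|x_i-y_i|=1$. Let $\mathcal M_\Lambda$ be the set of $\vec m:\Lambda\to\{0,1,2,\dots\}$ with $N_\Lambda(\vec m)=\sum_x\vec m(x)<\infty$, and let $\mathcal H_\Lambda=\ell^2(\Lambda)\otimes\mathcal F_\Lambda$, where $\mathcal F_\Lambda$ is the bosonic Fock space over $\ell^2(\Lambda)$, with annihilation operators $b_x$ and occupation basis $|\vec m\rangle$, $\vec m\in\mathcal M_\Lambda$. For $\gamma\ge0$, $\omega>0$, $\alpha\in\mathbb C$, $V_+\ge 0$ and a potential $v:\Lambda\to[0,V_+]$ (any realization of the disorder) consider the disordered Holstein Hamiltonian $$H_\Lambda=\gamma\Delta_\Lambda-(\alpha b_{\mathbf X}^\dagger+\alpha^*b_{\mathbf X})+\omega\sum_{x\in\Lambda}b_x^\dagger b_x+\frac{|\alpha|^2}{\omega}+V_\Lambda ,\qquad (V_\Lambda\psi)(x)=v_x\psi(x),\quad (b_{\mathbf X}\psi)(x)=b_x\psi(x),$$ on its natural domain, where $\Delta_\Lambda$ is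 the discrete Laplacian on $\Lambda$: off-diagonal part $-\sum_{y\sim x,\,y\in\Lambda}\psi(y)$, and diagonal either $\#\{y\in\Lambda:y\sim x\}$ or $2D$ (the statement holds for both). Let $\beta=\alpha/\omega$, and let $|x,\vec m\rangle=|x\rangle\otimes e^{\beta b_x^\dagger-\beta^*b_x}|\vec m\rangle$. The set $\mathcal E_\Lambda=\{|x,\vec m\rangle\}$ is the displaced basis, and $\mathcal E^{(k)}_\Lambda=\{|x,\vec m\rangle: N_\Lambda(\vec m)=k\}$. For $\mathcal S\subset\mathcal E_\Lambda$ let $P_{\mathcal S}$ be the orthogonal projection onto the closed span of $\mathcal S$, and let $H_{\mathcal S}=P_{\mathcal S}H_\Lambda P_{\mathcal S}$, regarded as an operator in $\operatorname{ran}P_{\mathcal S}$. Put $\mathbf I_k=[\omega k,\ \omega k+V_++4D\gamma]$, $k=0,1,2,\dots$, and $$d_\Lambda(x,\vec m;y,\vec\xi)=L_\Lambda(x,\vec m;y,\vec\xi)+r_\Lambda(\vec m,\vec\xi),\qquad r_\Lambda(\vec m,\vec\xi)=\sum_{u\in\Lambda}\bigl|\sqrt{\vec m(u)}-\sqrt{\vec\xi(u)}\bigr|,$$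 where $L_\Lambda$ is the minimal length of a nearest neighbour walk in $\Lambda$ from $x$ to $y$ visiting every site $u$ with $\vec m(u)\ne\vec\xi(u)$ ($+\infty$ if there is none). Let $d_\Lambda(\mathcal S_1,\mathcal S_2)$ be the infimum of $d_\Lambda$ over $\mathcal S_1\times\mathcal S_2$, with $\inf\emptyset=+\infty$ and $e^{-\infty}=0$. **Theorem.** For every $D$ and $\beta\in\mathbb C$ there are constants $C_\mu>0$ ($\mu>0$), depending only on $\mu,\beta,D$, such that the following holds for all $k$ and all $\gamma,\omega,V_+,\alpha$ as above with $\alpha/\omega=\beta$ and $\delta=\omega-V_+-4D\gamma>0$. 1. If $\mathcal S\subset\mathcal E_\Lambda$ and $\mathcal S\cap\mathcal E_\Lambda^{(k)}=\emptyset$, then $\sigma(H_{\mathcal S})\cap\mathbf I_k=\emptyset$. 2. There is $\nu_{k;\gamma}>0$, which does not depend on $\Lambda$, $v$, $\mathcal S$, such that for every $\Lambda$, every $v:\Lambda\to[0,V_+]$, every $\mathcal S\subset\mathcal E_\Lambda$ with $\mathcal S\cap\mathcal E_\Lambda^{(k)}=\emptyset$, all $\mathcal S_1,\mathcal S_2\subset\mathcal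 S$ and all $z=E+\mathrm i\epsilon$ with $E\in\mathbf I_k$, $\epsilon\in\mathbb R$, the resolvent $(H_{\mathcal S}-z)^{-1}$ exists and $$\Bigl\|P_{\mathcal S_1}\frac1{H_{\mathcal S}-z}P_{\mathcal S_2}\Bigr\|\le\frac2\delta\,e^{-\nu_{k;\gamma}\,d_\Lambda(\mathcal S_1,\mathcal S_2)} .$$ Moreover, if $\gamma>0$, this one $\nu_{k;\gamma}$ satisfies, for every $\mu>0$, $$\nu_{k;\gamma}\ \ge\ \min\Bigl(\mu,\ C_\mu\,\frac{\delta}{\gamma}\,\frac1{k+1}\Bigr).$$ If $\gamma=0$ (where $\delta/\gamma=+\infty$), the bound holds with every $\nu>0$ in place of $\nu_{k;\gamma}$. 3. (General bound.) Without any assumption on $\delta$ or $\mathcal S$: there is $c_D>0$ depending only on $D$ such that, for every $\beta\in\mathbb C$ and $\mu>0$, $$S_\mu:=c_D\,e^{-2\mu}\frac{\mu^3}{(1+\mu)^2}\ \frac1{\sup_n\sum_m|\langle n|D(\beta)|m\rangle|^2e^{4\mu|\sqrt n-\sqrt m|}}>0,\qquad D(\beta)=e^{\beta b^\dagger-\beta^*b},$$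 and for all $\gamma\ge0$, $\omega>0$, $V_+\ge0$, $\alpha$ with $\alpha/\omega=\beta$, all $\Lambda$, all $v:\Lambda\to[0,V_+]$, $\mathcal S\subset\mathcal E_\Lambda$, $z\in\mathbb C\setminus\sigma(H_{\mathcal S})$, $\mathcal S_1,\mathcal S_2\subset\mathcal S$, writing $\rho_z=\bigl\|\frac{H_{\mathcal S}}{H_{\mathcal S}-z}\bigr\|+4\omega\bigl\|\frac1{H_{\mathcal S}-z}\bigr\|$, $$\Bigl\|P_{\mathcal S_1}\frac1{H_{\mathcal S}-z}P_{\mathcal S_2}\Bigr\|\le\frac{\bigl\|\frac1{H_{\mathcal S}-z}\bigr\|}{1-\nu\frac{\gamma}{S_\mu\omega}\rho_z}\;e^{-\nu d_\Lambda(\mathcal S_1,\mathcal S_2)}\qquad\text{whenever}\quad0\le\nu<\min\Bigl\{\mu,\ \frac{S_\mu\omega}{\gamma},\ \frac{S_\mu\omega}{\gamma\,\rho_z}\Bigr\}$$ (quotients by $0$ in the minimum are $+\infty$; $e^{-\nu\cdot\infty}=0$ also for $\nu=0$). -/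

import Mathlib

namespace Holstein

open scoped ENNReal ComplexConjugate

/-! ### The lattice region, oscillator configurations and the Hilbert space -/

/-- The nearest neighbour graph on a region `Λ ⊆ ℤ^D`: two sites are adjacent when their
`ℓ¹` distance is `1`. -/
def latticeGraph {D : ℕ} (Λ : Set (Fin D → ℤ)) : SimpleGraph Λ where
  Adj x y := ∑ i, |x.1 i - y.1 i| = 1
  symm := ⟨fun x y h => by
    rw [← h]
    exact Finset.sum_congr rfl fun i _ => abs_sub_comm _ _⟩
  loopless := ⟨fun x h => by simp at h⟩

theorem neighborSet_finite {D : ℕ} (Λ : Set (Fin D → ℤ)) (x : Λ) :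
    ((latticeGraph Λ).neighborSet x).Finite := by
  have h : (Set.Icc (fun i => x.1 i - 1) (fun i => x.1 i + 1) : Set (Fin D → ℤ)).Finite :=
    Set.finite_Icc _ _
  refine (h.preimage (f := (Subtype.val : Λ → (Fin D → ℤ)))
    Subtype.val_injective.injOn).subset ?_
  intro y hy
  have hy' : ∑ i, |x.1 i - y.1 i| = 1 := hy
  have hi : ∀ i, |x.1 i - y.1 i| ≤ 1 := fun i => by
    rw [← hy']
    exact Finset.single_le_sum (f := fun i => |x.1 i - y.1 i|)
      (fun j _ => abs_nonneg _) (Finset.mem_univ i)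
  constructor <;> intro i <;> have := abs_le.mp (hi i) <;> dsimp only <;> omega

noncomputable instance {D : ℕ} (Λ : Set (Fin D → ℤ)) : (latticeGraph Λ).LocallyFinite :=
  fun x => (neighborSet_finite Λ x).fintype

/-- Finitely supported oscillator configurations `m : Λ → ℕ`. -/
abbrev Config {D : ℕ} (Λ : Set (Fin D → ℤ)) : Type := Λ →₀ ℕ

/-- Labels `(x, m)`: a particle position and an oscillator configuration. -/
abbrev Label {D : ℕ} (Λ : Set (Fin D → ℤ)) : Type := Λ × Config Λ

/-- Total excitation number `N(m) = ∑ₓ m(x)`. -/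
def excitation {D : ℕ} {Λ : Set (Fin D → ℤ)} (m : Config Λ) : ℕ := m.sum fun _ n => n

/-- The labels in the `k`-th band, `N(m) = k`. -/
def band {D : ℕ} (Λ : Set (Fin D → ℤ)) (k : ℕ) : Set (Label Λ) :=
  {a | excitation a.2 = k}

/-- The Hilbert space `ℓ²(Λ) ⊗ 𝓕(Λ)` with the bosonic Fock space `𝓕(Λ)` over `ℓ²(Λ)` in the
occupation number representation: `ψ (x, m)` is the amplitude of the undisplaced product state
with the particle at `x` and `m u` quanta of `b_u† b_u` at each site `u`. -/
abbrev Hilb {D : ℕ} (Λ : Set (Fin D → ℤ)) : Type := lp (fun _ : Label Λ => ℂ) 2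

/-! ### The Holstein Hamiltonian -/

/-- The annihilation operator at the particle position,
`(b_X ψ)(x, m) = √(m(x) + 1) ψ(x, m + eₓ)`. -/
noncomputable def annihilate {D : ℕ} {Λ : Set (Fin D → ℤ)} (ψ : Label Λ → ℂ) : Label Λ → ℂ :=
  fun a => (Real.sqrt (a.2 a.1 + 1) : ℂ) * ψ (a.1, a.2 + Finsupp.single a.1 1)

/-- The creation operator at the particle position,
`(b_X† ψ)(x, m) = √(m(x)) ψ(x, m - eₓ)`, which is `0` when `m(x) = 0`. -/
noncomputable def create {D : ℕ} {Λ : Set (Fin D → ℤ)} (ψ : Label Λ → ℂ) : Label Λ → ℂ :=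
  fun a => (Real.sqrt (a.2 a.1) : ℂ) * ψ (a.1, a.2 - Finsupp.single a.1 1)

/-- The two usual choices for the diagonal of the discrete Laplacian of a region `Λ ⊆ ℤ^D`:
the number of neighbours inside `Λ` (so that `Δψ(x) = ∑_{y ∼ x, y ∈ Λ} (ψ(x) - ψ(y))`),
or the constant `2D` (the restriction to `Λ` of the Laplacian of `ℤ^D`).
They agree for `Λ = ℤ^D`. -/
inductive LaplacianKind
  | graph
  | restricted

/-- The diagonal entry at `x` of the discrete Laplacian. -/
noncomputable def laplacianDiag {D : ℕ} (bc : LaplacianKind) {Λ : Set (Fin D → ℤ)} (x : Λ) : ℕ :=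
  match bc with
  | .graph => (latticeGraph Λ).degree x
  | .restricted => 2 * D

/-- The discrete Laplacian, acting on the particle position. -/
noncomputable def laplacian {D : ℕ} (bc : LaplacianKind) {Λ : Set (Fin D → ℤ)}
    (ψ : Label Λ → ℂ) : Label Λ → ℂ :=
  fun a => (laplacianDiag bc a.1 : ℂ) * ψ a - ∑ y ∈ (latticeGraph Λ).neighborFinset a.1, ψ (y, a.2)

/-- The action of
`γ Δ - (α b_X† + α* b_X) + ω ∑ᵤ b_u† b_u + |α|²/ω + V`
on an arbitrary wave function; every value is a finite expression. -/
noncomputable def formalHamiltonian {D : ℕ} (bc : LaplacianKind) {Λ : Set (Fin D → ℤ)}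
    (γ ω : ℝ) (α : ℂ) (v : Λ → ℝ) : (Label Λ → ℂ) →ₗ[ℂ] (Label Λ → ℂ) where
  toFun ψ := fun a => (γ : ℂ) * laplacian bc ψ a - (α * create ψ a + conj α * annihilate ψ a)
    + (ω : ℂ) * ((excitation a.2 : ℂ) * ψ a) + ((‖α‖ ^ 2 / ω : ℝ) : ℂ) * ψ a + (v a.1 : ℂ) * ψ a
  map_add' ψ φ := by
    funext a
    simp only [laplacian, create, annihilate, Pi.add_apply, Finset.sum_add_distrib]
    ring
  map_smul' c ψ := by
    funext a
    simp only [laplacian, create, annihilate, Pi.smul_apply, smul_eq_mul, ← Finset.mul_sum,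
      RingHom.id_apply]
    ring

/-- The disordered Holstein Hamiltonian `H_Λ(γ)` with potential `v`, as an unbounded operator on
its natural (maximal) domain, the square-summable `ψ` with square-summable image. -/
noncomputable def hamiltonian {D : ℕ} (bc : LaplacianKind) {Λ : Set (Fin D → ℤ)}
    (γ ω : ℝ) (α : ℂ) (v : Λ → ℝ) : Hilb Λ →ₗ.[ℂ] Hilb Λ where
  domain :=
    { carrier := {ψ | Memℓp (formalHamiltonian bc γ ω α v ψ) 2}
      add_mem' := fun {ψ φ} hψ hφ => by
        have h := Memℓp.add hψ hφ
        rw [← map_add] at h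
        exact h
      zero_mem' := by
        have h : formalHamiltonian bc γ ω α v ((0 : Hilb Λ) : Label Λ → ℂ) = 0 := by
          rw [lp.coeFn_zero, map_zero]
        rw [Set.mem_ofPred_eq, h]
        exact zero_memℓp
      smul_mem' := fun c ψ hψ => by
        have h := Memℓp.const_smul hψ c
        rw [← map_smul] at h
        exact h }
  toFun :=
    { toFun := fun ψ => ⟨formalHamiltonian bc γ ω α v ψ.1, ψ.2⟩
      map_add' := fun ψ φ => Subtype.ext (map_add (formalHamiltonian bc γ ω α v) _ _)
      map_smul' := fun c ψ => Subtype.ext (map_smul (formalHamiltonian bc γ ω α v) c _) }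

/-! ### Displaced oscillator states -/

/-- The matrix element `⟨j| e^{c b} |n⟩ = ∑ₚ (cᵖ / p!) ⟨j| bᵖ |n⟩` of one oscillator,
with `bᵖ |n⟩ = √(n! / (n - p)!) |n - p⟩`. -/
noncomputable def expLower (c : ℂ) (j n : ℕ) : ℂ :=
  if j ≤ n then
    c ^ (n - j) / ((n - j).factorial : ℂ) *
      (Real.sqrt ((n.factorial : ℝ) / (j.factorial : ℝ)) : ℂ)
  else 0

/-- The matrix element `⟨m| e^{c b†} |j⟩` of one oscillator. -/
noncomputable def expRaise (c : ℂ) (m j : ℕ) : ℂ := expLower c j m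

/-- The matrix element `⟨m| D(β) |n⟩` of the displacement operator
`D(β) = e^{β b† - β* b} = e^{-|β|²/2} e^{β b†} e^{-β* b}`. -/
noncomputable def displacement (β : ℂ) (m n : ℕ) : ℂ :=
  (Real.exp (-(‖β‖ ^ 2) / 2) : ℂ) *
    ∑ j ∈ Finset.range (n + 1), expRaise β m j * expLower (-conj β) j n

theorem expRaise_sq_summable (c : ℂ) (j : ℕ) :
    Summable fun m => ‖expRaise c m j‖ ^ (2 : ℝ) := by
  rw [← summable_nat_add_iff j]
  have hs := (Real.summable_pow_div_factorial (2 * ‖c‖ ^ 2)).mul_left ((2 : ℝ) ^ j)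
  refine Summable.of_nonneg_of_le (fun l => by positivity) (fun l => ?_) hs
  have hle : j ≤ l + j := Nat.le_add_left _ _
  simp only [expRaise, expLower, if_pos hle, Nat.add_sub_cancel]
  rw [Real.rpow_two, norm_mul, norm_div, norm_pow, Complex.norm_natCast, Complex.norm_real,
    Real.norm_of_nonneg (Real.sqrt_nonneg _), mul_pow, Real.sq_sqrt (by positivity)]
  have hc : ((l + j).factorial : ℝ) ≤ 2 ^ (l + j) * (l.factorial * j.factorial) := by
    have h1 : (l + j).choose j * j.factorial * l.factorial = (l + j).factorial := by
      simpa using Nat.choose_mul_factorial_mul_factorial hle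
    have h2 : (l + j).choose j ≤ 2 ^ (l + j) := Nat.choose_le_two_pow _ _
    have h3 : (l + j).factorial ≤ 2 ^ (l + j) * (l.factorial * j.factorial) := by
      rw [← h1, mul_assoc, mul_comm j.factorial]
      exact Nat.mul_le_mul_right _ h2
    exact_mod_cast h3
  have hl : (0 : ℝ) < l.factorial := by exact_mod_cast l.factorial_pos
  have hj : (0 : ℝ) < j.factorial := by exact_mod_cast j.factorial_pos
  calc (‖c‖ ^ l / (l.factorial : ℝ)) ^ 2 * (((l + j).factorial : ℝ) / j.factorial)
      ≤ (‖c‖ ^ l / (l.factorial : ℝ)) ^ 2 *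
          ((2 ^ (l + j) * (l.factorial * j.factorial)) / j.factorial) := by gcongr
    _ = 2 ^ j * ((2 * ‖c‖ ^ 2) ^ l / l.factorial) := by
        field_simp
        ring

theorem displacement_memℓp (β : ℂ) (n : ℕ) :
    Memℓp (fun m => displacement β m n : ℕ → ℂ) 2 := by
  have h : ∀ j, Memℓp (fun m => expRaise β m j * expLower (-conj β) j n : ℕ → ℂ) 2 := fun j => by
    have h1 : Memℓp (fun m => expRaise β m j : ℕ → ℂ) 2 :=
      memℓp_gen (by simpa using expRaise_sq_summable β j)
    have h2 := h1.const_mul (expLower (-conj β) j n)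
    simpa [mul_comm] using h2
  have h3 := (Memℓp.finsetSum (Finset.range (n + 1)) fun j _ => h j).const_mul
    (Real.exp (-(‖β‖ ^ 2) / 2) : ℂ)
  exact h3

open Classical in
/-- Amplitudes of `|x⟩ ⊗ D_x(β)|m⟩` in the occupation number basis. -/
noncomputable def ketFun {D : ℕ} {Λ : Set (Fin D → ℤ)} (β : ℂ) (a : Label Λ) : Label Λ → ℂ :=
  fun c => if c.1 = a.1 ∧ ∀ u, u ≠ a.1 → c.2 u = a.2 u then
    displacement β (c.2 a.1) (a.2 a.1) else 0

theorem ketFun_memℓp {D : ℕ} {Λ : Set (Fin D → ℤ)} (β : ℂ) (a : Label Λ) :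
    Memℓp (ketFun β a) 2 := by
  classical
  refine memℓp_gen ?_
  have hinj : Function.Injective fun j : ℕ => ((a.1, a.2.update a.1 j) : Label Λ) := by
    intro i j hij
    have h := congrArg (fun c : Label Λ => c.2 a.1) hij
    simpa using h
  rw [← hinj.summable_iff]
  · have h := (displacement_memℓp β (a.2 a.1)).summable (by norm_num)
    refine h.congr fun j => ?_
    have hc : ∀ u, u ≠ a.1 → (a.2.update a.1 j) u = a.2 u := fun u hu => by
      simp [Finsupp.update, hu]
    simp only [Function.comp_apply, ketFun]
    rw [if_pos ⟨trivial, hc⟩]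
    simp
  · intro c hc
    have hn : ¬ (c.1 = a.1 ∧ ∀ u, u ≠ a.1 → c.2 u = a.2 u) := by
      rintro ⟨h1, h2⟩
      refine hc ⟨c.2 a.1, Prod.ext h1.symm (Finsupp.ext fun u => ?_)⟩
      by_cases hu : u = a.1
      · subst hu
        simp
      · simp [Finsupp.update, hu, h2 u hu]
    have hz : ketFun β a c = 0 := if_neg hn
    simp [hz]

/-- The displaced basis state `|x, m⟩ = |x⟩ ⊗ D_x(β)|m⟩`. -/
noncomputable def ket {D : ℕ} {Λ : Set (Fin D → ℤ)} (β : ℂ) (a : Label Λ) : Hilb Λ :=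
  ⟨ketFun β a, ketFun_memℓp β a⟩

/-- The closed subspace spanned by the displaced basis states with labels in `S`. -/
noncomputable def spanKets {D : ℕ} {Λ : Set (Fin D → ℤ)} (β : ℂ) (S : Set (Label Λ)) :
    Submodule ℂ (Hilb Λ) :=
  (Submodule.span ℂ (ket β '' S)).topologicalClosure

instance {D : ℕ} {Λ : Set (Fin D → ℤ)} (β : ℂ) (S : Set (Label Λ)) :
    CompleteSpace (spanKets β S) :=
  Submodule.topologicalClosure.completeSpace _

/-- The orthogonal projection `P_S` onto the states in `S`. -/
noncomputable def projKets {D : ℕ} {Λ : Set (Fin D → ℤ)} (β : ℂ) (S : Set (Label Λ)) :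
    Hilb Λ →L[ℂ] Hilb Λ :=
  (spanKets β S).starProjection

/-! ### Compression, resolvent and spectrum of unbounded operators -/

/-- The compression `P_K T P_K`, as an operator in the Hilbert space `K`, with domain
`K ∩ dom T`. -/
noncomputable def compress {E : Type*} [NormedAddCommGroup E] [InnerProductSpace ℂ E]
    (T : E →ₗ.[ℂ] E) (K : Submodule ℂ E) [K.HasOrthogonalProjection] : K →ₗ.[ℂ] K where
  domain := T.domain.comap K.subtype
  toFun :=
    { toFun := fun ψ => K.orthogonalProjectionOnto (T ⟨ψ.1.1, ψ.2⟩)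
      map_add' := fun ψ φ => by
        rw [← map_add, ← LinearPMap.map_add]
        rfl
      map_smul' := fun c ψ => by
        rw [RingHom.id_apply, ← map_smul, ← LinearPMap.map_smul]
        rfl }

/-- `R` is the resolvent `(T - z)⁻¹`: a bounded, everywhere defined two-sided inverse of
`T - z`. -/
def IsResolvent {E : Type*} [NormedAddCommGroup E] [NormedSpace ℂ E]
    (T : E →ₗ.[ℂ] E) (z : ℂ) (R : E →L[ℂ] E) : Prop :=
  (∀ f : E, ∃ h : R f ∈ T.domain, T ⟨R f, h⟩ - z • R f = f) ∧
    ∀ ψ : T.domain, R (T ψ - z • (ψ : E)) = ψ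

/-- The spectrum of an unbounded operator. -/
def spectrumOf {E : Type*} [NormedAddCommGroup E] [NormedSpace ℂ E] (T : E →ₗ.[ℂ] E) : Set ℂ :=
  {z | ¬ ∃ R : E →L[ℂ] E, IsResolvent T z R}

/-- `H_S = P_S H_Λ P_S`, as an operator in the range of `P_S`; here `β = α / ω`. -/
noncomputable def restrictedHamiltonian {D : ℕ} (bc : LaplacianKind) {Λ : Set (Fin D → ℤ)}
    (γ ω : ℝ) (α : ℂ) (v : Λ → ℝ) (S : Set (Label Λ)) :
    spanKets (α / ω) S →ₗ.[ℂ] spanKets (α / ω) S :=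
  compress (hamiltonian bc γ ω α v) (spanKets (α / ω) S)

/-- `P_{S₁} R P_{S₂}` on the whole Hilbert space, for an operator `R` in the range of `P_S`. -/
noncomputable def sandwich {D : ℕ} {Λ : Set (Fin D → ℤ)} (β : ℂ) (S S₁ S₂ : Set (Label Λ))
    (R : spanKets β S →L[ℂ] spanKets β S) : Hilb Λ →L[ℂ] Hilb Λ :=
  projKets β S₁ ∘L (spanKets β S).subtypeL ∘L R ∘L
    (spanKets β S).orthogonalProjectionOnto ∘L projKets β S₂

/-! ### The metric -/

/-- Minimal length of a nearest neighbour walk in `Λ` from `x` to `y` that visits all sites where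
the two configurations differ; `∞` if there is none. -/
noncomputable def walkDist {D : ℕ} {Λ : Set (Fin D → ℤ)} (a b : Label Λ) : ℕ∞ :=
  ⨅ (p : (latticeGraph Λ).Walk a.1 b.1) (_ : ∀ w, a.2 w ≠ b.2 w → w ∈ p.support), (p.length : ℕ∞)

/-- `r(m, ξ) = ∑ₓ |√(m(x)) - √(ξ(x))|`. -/
noncomputable def oscDist {D : ℕ} {Λ : Set (Fin D → ℤ)} (m ξ : Config Λ) : ℝ :=
  ∑ x ∈ m.support ∪ ξ.support, |Real.sqrt (m x) - Real.sqrt (ξ x)|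

/-- `d_Λ = L_Λ + r_Λ`. -/
noncomputable def labelDist {D : ℕ} {Λ : Set (Fin D → ℤ)} (a b : Label Λ) : ℝ≥0∞ :=
  (walkDist a b : ℝ≥0∞) + ENNReal.ofReal (oscDist a.2 b.2)

/-- The distance between two sets of labels (`∞` if one of them is empty). -/
noncomputable def setDist {D : ℕ} {Λ : Set (Fin D → ℤ)} (S₁ S₂ : Set (Label Λ)) : ℝ≥0∞ :=
  ⨅ a ∈ S₁, ⨅ b ∈ S₂, labelDist a b

/-- `e^{-ν d}` for a possibly infinite distance `d`, with `e^{-∞} = 0`. -/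
noncomputable def expDecay (ν : ℝ) (d : ℝ≥0∞) : ℝ :=
  if d = ∞ then 0 else Real.exp (-ν * d.toReal)

/-- The interval `I_k = [ω k, ω k + V₊ + 4 D γ]`. -/
def bandInterval (D : ℕ) (γ ω Vplus : ℝ) (k : ℕ) : Set ℝ :=
  Set.Icc (ω * k) (ω * k + Vplus + 4 * D * γ)

/-- The Combes–Thomas bound with rate `ν` at all `z = E + iε` with `E ∈ I_k`: for every region
`Λ`, every potential with values in `[0, V₊]` and every `S` that avoids the `k`-th band, the
resolvent of `H_S` at `z` exists and satisfies
`‖P_{S₁} (H_S - z)⁻¹ P_{S₂}‖ ≤ (2/δ) e^{-ν d(S₁, S₂)}`, `δ = ω - V₊ - 4 D γ`. -/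
def CombesThomasBound (D : ℕ) (γ ω Vplus : ℝ) (α : ℂ) (k : ℕ) (ν : ℝ) : Prop :=
  ∀ (bc : LaplacianKind) (Λ : Set (Fin D → ℤ)) (v : Λ → ℝ), (∀ x, v x ∈ Set.Icc 0 Vplus) →
    ∀ S : Set (Label Λ), Disjoint S (band Λ k) →
      ∀ E ∈ bandInterval D γ ω Vplus k, ∀ ε : ℝ,
        ∃ R : spanKets (α / ω) S →L[ℂ] spanKets (α / ω) S,
          IsResolvent (restrictedHamiltonian bc γ ω α v S) (E + ε * Complex.I) R ∧
          ∀ S₁ ⊆ S, ∀ S₂ ⊆ S,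
            ‖sandwich (α / ω) S S₁ S₂ R‖ ≤
              2 / (ω - Vplus - 4 * D * γ) * expDecay ν (setDist S₁ S₂)

/-- `supₙ ∑ₘ |⟨n| D(β) |m⟩|² e^{4 μ |√n - √m|}`, a priori in `[0, ∞]`. -/
noncomputable def displacementSum (β : ℂ) (μ : ℝ) : ℝ≥0∞ :=
  ⨆ n : ℕ, ∑' m : ℕ, ENNReal.ofReal
    (‖displacement β n m‖ ^ 2 * Real.exp (4 * μ * |Real.sqrt n - Real.sqrt m|))

/-- `S_μ = c e^{-2μ} μ³ / (1 + μ)² / supₙ ∑ₘ |⟨n| D(β) |m⟩|² e^{4 μ |√n - √m|}`. It is `0` when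
the supremum is infinite, so that `0 < S_μ` says that it is finite. -/
noncomputable def decayConst (c : ℝ) (β : ℂ) (μ : ℝ) : ℝ :=
  c * Real.exp (-2 * μ) * (μ ^ 3 / (1 + μ) ^ 2) * (1 / (displacementSum β μ).toReal)

/-- The quantity `‖H (H - z)⁻¹‖ + 4 ω ‖(H - z)⁻¹‖` for a resolvent `R = (H - z)⁻¹`, using
`H (H - z)⁻¹ = 1 + z (H - z)⁻¹`. -/
noncomputable def resolventSize {E : Type*} [NormedAddCommGroup E] [NormedSpace ℂ E]
    (ω : ℝ) (z : ℂ) (R : E →L[ℂ] E) : ℝ :=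
  ‖ContinuousLinearMap.id ℂ E + z • R‖ + 4 * ω * ‖R‖

/-- The general Combes–Thomas bound with parameter `μ` and constant `s` in the role of `S_μ`: for
every resolvent `R = (H_S - z)⁻¹` and every
`0 ≤ ν < min {μ, s ω / γ, (s ω / γ) / (‖H_S R‖ + 4 ω ‖R‖)}` (written without division, so that
the last two conditions are void for `γ = 0`),
`‖P_{S₁} R P_{S₂}‖ ≤ ‖R‖ / (1 - ν γ / (s ω) (‖H_S R‖ + 4 ω ‖R‖)) e^{-ν d(S₁, S₂)}`. -/
def GeneralCombesThomas (D : ℕ) (γ ω Vplus : ℝ) (α : ℂ) (μ s : ℝ) : Prop :=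
  ∀ (bc : LaplacianKind) (Λ : Set (Fin D → ℤ)) (v : Λ → ℝ), (∀ x, v x ∈ Set.Icc 0 Vplus) →
    ∀ (S : Set (Label Λ)) (z : ℂ) (R : spanKets (α / ω) S →L[ℂ] spanKets (α / ω) S),
      IsResolvent (restrictedHamiltonian bc γ ω α v S) z R →
      ∀ ν : ℝ, 0 ≤ ν → ν < μ → ν * γ < s * ω → ν * γ * resolventSize ω z R < s * ω →
        ∀ S₁ ⊆ S, ∀ S₂ ⊆ S,
          ‖sandwich (α / ω) S S₁ S₂ R‖ ≤
            ‖R‖ / (1 - ν * (γ / (s * ω)) * resolventSize ω z R) * expDecay ν (setDist S₁ S₂)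

end Holstein

namespace Holstein
open scoped ENNReal ComplexConjugate

/-! ### One oscillator: algebra of the matrix elements -/

/-! In the displaced basis the Hamiltonian is ωN plus a bounded operator. For a particle at x,
completing the square gives ωb†b - (αb† + α*b) + |α|²/ω = ω(b† - β*)(b - β), and D(β)|n⟩ is an
eigenvector of this with eigenvalue ωn. Hence on ran P_S the operator is H_S = ωN + B, with N
diagonal and B = P_S(γΔ + V)P_S bounded (`restrictedHamiltonian_isDiagonalPlusBounded`). Only
orthonormality of the displaced states is needed, because ran P_S is their closed span by
definition.

Put W = V₊ + 4Dγ. Then ‖B - W/2‖ ≤ W/2 (`exists_laplacian_add_potential`). If S avoids band k and E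
∈ I_k, then E - W/2 lies at distance at least ω - W/2 from the values of ωN, so a Neumann series
gives the resolvent and ‖R‖ ≤ 1/(ω - W) = 1/δ.

For the decay, let g = e^{ν d(·, S₂)} with d cut off at some M, let f be supported in S₂, ψ = Rf and
φ = gψ. The diagonal part commutes with g, so (H_S - z)φ = f + q, where q has the coordinates ∑_b
B_ab (1 - g_a/g_b) φ_b. A hop joins adjacent sites x, y and changes only the oscillators at x and y;
its matrix element is γ times a product of two matrix elements of D(β) (`inner_ket_apply_ket`). The
metric is made so that one hop changes it by at most 1 + |√n - √n'| + |√m - √m'|, and this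
exponential growth is absorbed by the decay of ⟨n|D(β)|n'⟩.

The kernel of q is nevertheless unbounded: its row sums grow like √(N+1). A Schur test with weight
√(N+1) (`tsum_sq_tsum_mul_le`, `tsum_hopKernel_mul_inv_le`, `tsum_hopKernel_le`) bounds ‖q‖ by ⟨φ,
(N+1)φ⟩^{1/2}. Since B ≥ 0, this is controlled by ‖H_Sφ‖ and ‖φ‖
(`IsDiagonalPlusBounded.energy_le`), thus by ρ_z‖(H_S - z)φ‖. For small ν the term q is absorbed
(`IsDiagonalPlusBounded.weighted_resolvent`), and g ≥ e^{ν d(S₁, S₂)} on S₁, up to the cutoff, gives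
the decay.

The constant S_μ is positive because the weighted sums of |⟨n|D(β)|m⟩|² are bounded uniformly in n
(`displacementSum_ne_top`). This follows from an exact formula for the moments ∑_m |⟨m|D(β)|n⟩|²
q^{2(m-n)} with log q of order n^{-1/2}. -/

theorem sqrt_factorial_succ (n : ℕ) :
    (Real.sqrt ((n + 1).factorial : ℝ) : ℂ) = Real.sqrt (n + 1) * Real.sqrt (n.factorial : ℝ) := by
  rw [Nat.factorial_succ, Nat.cast_mul, Real.sqrt_mul (by positivity)]
  push_cast
  rfl

theorem sqrt_factorial_ne_zero (n : ℕ) : (Real.sqrt (n.factorial : ℝ) : ℂ) ≠ 0 := by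
  have : (0 : ℝ) < n.factorial := by exact_mod_cast n.factorial_pos
  exact_mod_cast (Real.sqrt_pos.mpr this).ne'

theorem sqrt_succ_ne_zero (n : ℕ) : (Real.sqrt ((n : ℝ) + 1) : ℂ) ≠ 0 := by
  have : (0 : ℝ) < (n : ℝ) + 1 := by positivity
  exact_mod_cast (Real.sqrt_pos.mpr this).ne'

theorem ofReal_sqrt_mul_self (n : ℕ) :
    (Real.sqrt ((n : ℝ) + 1) : ℂ) * (Real.sqrt ((n : ℝ) + 1) : ℂ) = n + 1 := by
  rw [← Complex.ofReal_mul, Real.mul_self_sqrt (by positivity)]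
  push_cast
  rfl

theorem expLower_add (c : ℂ) (j p : ℕ) :
    expLower c j (j + p) = c ^ p / (p.factorial : ℂ) *
      (Real.sqrt ((j + p).factorial : ℝ) / Real.sqrt (j.factorial : ℝ)) := by
  rw [expLower, if_pos (Nat.le_add_right _ _), Nat.add_sub_cancel_left,
    Real.sqrt_div (by positivity)]
  push_cast
  rfl

theorem expLower_of_lt (c : ℂ) {j n : ℕ} (h : n < j) : expLower c j n = 0 :=
  if_neg (by omega)

/-- This is the matrix form of b e^{cb} = e^{cb} b. -/
theorem sqrt_mul_expLower_succ_succ (c : ℂ) (j n : ℕ) :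
    (Real.sqrt (j + 1) : ℂ) * expLower c (j + 1) (n + 1) =
      Real.sqrt (n + 1) * expLower c j n := by
  rcases lt_or_ge n j with h | h
  · rw [expLower_of_lt c h, expLower_of_lt c (by omega : n + 1 < j + 1)]
    simp
  · obtain ⟨p, rfl⟩ := Nat.exists_eq_add_of_le h
    have e : j + p + 1 = j + 1 + p := by ring
    have h1 := expLower_add c (j + 1) p
    rw [← e] at h1
    rw [h1, expLower_add, sqrt_factorial_succ, sqrt_factorial_succ]
    have := sqrt_factorial_ne_zero j
    have := sqrt_succ_ne_zero j
    field_simp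

theorem sqrt_mul_expLower_zero_succ (c : ℂ) (n : ℕ) :
    (Real.sqrt (n + 1) : ℂ) * expLower c 0 (n + 1) = c * expLower c 0 n := by
  have h1 := expLower_add c 0 (n + 1)
  have h2 := expLower_add c 0 n
  rw [zero_add] at h1 h2
  rw [h1, h2, sqrt_factorial_succ, Nat.factorial_succ]
  have h3 := ofReal_sqrt_mul_self n
  have : (n.factorial : ℂ) ≠ 0 := by exact_mod_cast n.factorial_ne_zero
  have : (n : ℂ) + 1 ≠ 0 := by exact_mod_cast n.succ_ne_zero
  push_cast
  have := sqrt_factorial_ne_zero 0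
  field_simp
  linear_combination c ^ (n + 1) * Real.sqrt (n.factorial : ℝ) * h3

/-- This is the matrix form of e^{cb} b† = (b† + c) e^{cb}; the case of row 0, where the b† term
vanishes, is `sqrt_mul_expLower_zero_succ`. -/
theorem sqrt_mul_expLower_succ (c : ℂ) (j n : ℕ) :
    (Real.sqrt (n + 1) : ℂ) * expLower c (j + 1) (n + 1) =
      Real.sqrt (j + 1) * expLower c j n + c * expLower c (j + 1) n := by
  rcases lt_trichotomy n j with h | h | h
  · rw [expLower_of_lt c h, expLower_of_lt c (by omega : n + 1 < j + 1),
      expLower_of_lt c (by omega : n < j + 1)]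
    simp
  · subst h
    rw [expLower_of_lt c (by omega : n < n + 1)]
    have h1 := expLower_add c n 0
    have h2 := expLower_add c (n + 1) 0
    simp only [add_zero] at h1 h2
    rw [h1, h2]
    have := sqrt_factorial_ne_zero n
    have := sqrt_factorial_ne_zero (n + 1)
    field_simp
    simp
  · obtain ⟨p, rfl⟩ := Nat.exists_eq_add_of_le (show j + 1 ≤ n by omega)
    have h1 := expLower_add c (j + 1) (p + 1)
    have h2 := expLower_add c j (p + 1)
    rw [show j + 1 + (p + 1) = j + 1 + p + 1 by ring] at h1
    rw [show j + (p + 1) = j + 1 + p by ring] at h2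
    rw [h1, h2, expLower_add, sqrt_factorial_succ, sqrt_factorial_succ, Nat.factorial_succ]
    have h3 := ofReal_sqrt_mul_self (j + 1 + p)
    have h4 := ofReal_sqrt_mul_self j
    have : (p.factorial : ℂ) ≠ 0 := by exact_mod_cast p.factorial_ne_zero
    have : (p : ℂ) + 1 ≠ 0 := by exact_mod_cast p.succ_ne_zero
    have := sqrt_factorial_ne_zero j
    have := sqrt_succ_ne_zero j
    push_cast at h3 h4 ⊢
    field_simp
    rw [sq, sq, h3, h4]
    ring

theorem expLower_smul (q c : ℂ) (j n : ℕ) :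
    expLower (q * c) j n = q ^ (n - j) * expLower c j n := by
  simp only [expLower]
  split_ifs
  · rw [mul_pow]; ring
  · simp

theorem expLower_neg (c : ℂ) (j n : ℕ) :
    expLower (-c) j n = (-1) ^ (n - j) * expLower c j n := by
  rw [← expLower_smul]; simp

theorem conj_expLower (c : ℂ) (j n : ℕ) : conj (expLower c j n) = expLower (conj c) j n := by
  simp only [expLower]
  split_ifs <;> simp

/-- The group law e^{ab} e^{a'b} = e^{(a+a')b} reduces to the binomial theorem, since only the
indices between j and n contribute. -/
theorem sum_expLower_mul (a b : ℂ) (j n : ℕ) :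
    ∑ k ∈ Finset.range (n + 1), expLower a j k * expLower b k n = expLower (a + b) j n := by
  rcases lt_or_ge n j with h | h
  · rw [expLower_of_lt _ h]
    refine Finset.sum_eq_zero fun k hk => ?_
    rw [expLower_of_lt a (by have := Finset.mem_range.mp hk; omega), zero_mul]
  · obtain ⟨p, rfl⟩ := Nat.exists_eq_add_of_le h
    rw [show j + p + 1 = j + (p + 1) by ring, Finset.sum_range_add, Finset.sum_eq_zero, zero_add,
      expLower_add, add_pow]
    · rw [Finset.sum_div, Finset.sum_mul]
      refine Finset.sum_congr rfl fun i hi => ?_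
      obtain ⟨l, rfl⟩ := Nat.exists_eq_add_of_le (Nat.lt_succ_iff.mp (Finset.mem_range.mp hi))
      have h2 := expLower_add b (j + i) l
      rw [add_assoc] at h2
      rw [h2, expLower_add, Nat.add_sub_cancel_left]
      have hc : ((i + l).choose i : ℂ) * i.factorial * l.factorial = (i + l).factorial := by
        have := Nat.add_choose_mul_factorial_mul_factorial i l
        rw [← Nat.choose_symm_add] at this
        exact_mod_cast this
      have : (i.factorial : ℂ) ≠ 0 := by exact_mod_cast i.factorial_ne_zero
      have : (l.factorial : ℂ) ≠ 0 := by exact_mod_cast l.factorial_ne_zero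
      have : ((i + l).factorial : ℂ) ≠ 0 := by exact_mod_cast (i + l).factorial_ne_zero
      have := sqrt_factorial_ne_zero j
      have := sqrt_factorial_ne_zero (j + i)
      field_simp
      linear_combination (-a ^ i) * b ^ l * Real.sqrt ((j + (i + l)).factorial : ℝ) * hc
    · intro k hk
      rw [expLower_of_lt a (Finset.mem_range.mp hk), zero_mul]

theorem displacement_eq_sum_range (β : ℂ) (m : ℕ) {n M : ℕ} (h : n < M) :
    displacement β m n = (Real.exp (-(‖β‖ ^ 2) / 2) : ℂ) *
      ∑ j ∈ Finset.range M, expLower β j m * expLower (-conj β) j n := by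
  rw [displacement]
  congr 1
  refine Finset.sum_subset (Finset.range_mono (by omega)) fun j _ hj => ?_
  rw [expLower_of_lt (-conj β) (by simp at hj; omega), mul_zero]

/-- D(β)* = D(-β), and replacing β by -β multiplies the (n, m) entry by the parity (-1)^{m+n}. -/
theorem conj_displacement (β : ℂ) (m n : ℕ) :
    conj (displacement β m n) = (-1) ^ (m + n) * displacement β n m := by
  rw [displacement_eq_sum_range β m (show n < m + n + 1 by omega),
    displacement_eq_sum_range β n (show m < m + n + 1 by omega), map_mul, Complex.conj_ofReal,
    mul_left_comm, map_sum, Finset.mul_sum (a := (-1 : ℂ) ^ (m + n))]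
  congr 1
  refine Finset.sum_congr rfl fun j _ => ?_
  rw [map_mul, conj_expLower, conj_expLower, map_neg, Complex.conj_conj, expLower_neg,
    expLower_neg (conj β)]
  rcases lt_or_ge m j with h | h
  · simp [expLower_of_lt _ h]
  rcases lt_or_ge n j with h' | h'
  · simp [expLower_of_lt _ h']
  · have : (-1 : ℂ) ^ (m + n) = (-1) ^ (m - j) * (-1) ^ (n - j) := by
      rw [← pow_add, show m + n = m - j + (n - j) + 2 * j by omega, pow_add _ (m - j + (n - j)),
        pow_mul]
      simp
    have h2 : (-1 : ℂ) ^ (m - j) * (-1 : ℂ) ^ (m - j) = 1 := by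
      rw [← mul_pow]; simp
    rw [this]
    linear_combination (-(-1 : ℂ) ^ (n - j) * expLower (conj β) j m * expLower β j n) * h2

theorem norm_displacement_comm (β : ℂ) (m n : ℕ) :
    ‖displacement β m n‖ = ‖displacement β n m‖ := by
  rw [← RCLike.norm_conj, conj_displacement]
  simp

/-! ### Ladder operators of one oscillator -/

/-- The annihilation operator on sequences. -/
noncomputable def lower (f : ℕ → ℂ) : ℕ → ℂ := fun m => (Real.sqrt (m + 1) : ℂ) * f (m + 1)

/-- The creation operator on sequences. -/
noncomputable def raise (f : ℕ → ℂ) : ℕ → ℂ := fun m => (Real.sqrt m : ℂ) * f (m - 1)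

theorem lower_displacement_zero (β : ℂ) (m : ℕ) :
    lower (displacement β · 0) m = β * displacement β m 0 := by
  simp only [lower, displacement_eq_sum_range β _ zero_lt_one, Finset.sum_range_one]
  have := sqrt_mul_expLower_zero_succ β m
  linear_combination (Real.exp (-(‖β‖ ^ 2) / 2) : ℂ) * expLower (-conj β) 0 0 * this

theorem lower_displacement_succ (β : ℂ) (m n : ℕ) :
    lower (displacement β · (n + 1)) m =
      β * displacement β m (n + 1) + Real.sqrt (n + 1) * displacement β m n := by
  simp only [lower]
  have key : (Real.sqrt (m + 1) : ℂ) *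
      ∑ j ∈ Finset.range (n + 2), expLower β j (m + 1) * expLower (-conj β) j (n + 1) =
      β * ∑ j ∈ Finset.range (n + 2), expLower β j m * expLower (-conj β) j (n + 1) +
      Real.sqrt (n + 1) * ∑ j ∈ Finset.range (n + 1), expLower β j m * expLower (-conj β) j n := by
    rw [Finset.sum_range_succ', Finset.sum_range_succ' _ (n + 1), mul_add, mul_add,
      Finset.mul_sum, Finset.mul_sum, Finset.mul_sum, add_right_comm, ← Finset.sum_add_distrib]
    congr 1
    · refine Finset.sum_congr rfl fun j _ => ?_
      linear_combination expLower (-conj β) (j + 1) (n + 1) * sqrt_mul_expLower_succ β j m +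
        expLower β j m * sqrt_mul_expLower_succ_succ (-conj β) j n
    · linear_combination expLower (-conj β) 0 (n + 1) * sqrt_mul_expLower_zero_succ β m
  rw [displacement_eq_sum_range β (m + 1) (show n + 1 < n + 2 by omega),
    displacement_eq_sum_range β m (show n + 1 < n + 2 by omega),
    displacement_eq_sum_range β m (show n < n + 1 by omega)]
  linear_combination (Real.exp (-(‖β‖ ^ 2) / 2) : ℂ) * key

/-- This says b D(β) = D(β)(b + β). For n = 0 the truncated index `n - 1` is harmless because it
comes with the factor √0. -/
theorem lower_displacement (β : ℂ) (n : ℕ) :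
    lower (displacement β · n) =
      fun m => β * displacement β m n + Real.sqrt n * displacement β m (n - 1) := by
  funext m
  cases n with
  | zero => simp [lower_displacement_zero]
  | succ n => rw [lower_displacement_succ]; simp

/-- The relation for b† is the one for b read along rows instead of columns: the parity symmetry
`conj_displacement` exchanges the two indices. -/
theorem raise_displacement (β : ℂ) (n : ℕ) :
    raise (displacement β · n) =
      fun m => Real.sqrt (n + 1) * displacement β m (n + 1) + conj β * displacement β m n := by
  funext m
  have h := congrArg conj (congrFun (lower_displacement β m) n)
  simp only [lower, map_add, map_mul, Complex.conj_ofReal, conj_displacement] at h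
  have h2 : ((-1 : ℂ) ^ (m + n)) * (-1 : ℂ) ^ (m + n) = 1 := by
    rw [← mul_pow]; simp
  simp only [raise]
  cases m with
  | zero =>
    simp only [CharP.cast_eq_zero, Real.sqrt_zero, Complex.ofReal_zero, zero_mul, add_zero,
      zero_add, pow_succ] at h h2 ⊢
    linear_combination ((-1 : ℂ) ^ n) * h - (-Real.sqrt (n + 1) * displacement β 0 (n + 1) -
      conj β * displacement β 0 n) * h2
  | succ m =>
    simp only [Nat.add_sub_cancel] at h ⊢
    have e1 : (-1 : ℂ) ^ (n + 1 + (m + 1)) = -(-1) ^ (m + 1 + n) := by ring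
    have e2 : (-1 : ℂ) ^ (n + (m + 1)) = (-1) ^ (m + 1 + n) := by ring
    have e3 : (-1 : ℂ) ^ (n + m) = -(-1) ^ (m + 1 + n) := by ring
    rw [e1, e2, e3] at h
    linear_combination ((-1 : ℂ) ^ (m + 1 + n)) * h - (Real.sqrt ((m + 1 : ℕ) : ℝ) *
      displacement β m n - Real.sqrt (n + 1) * displacement β (m + 1) (n + 1) -
      conj β * displacement β (m + 1) n) * h2

/-! ### Square summable sequences -/

theorem memℓp_two_iff {ι : Type*} (f : ι → ℂ) : Memℓp f 2 ↔ Summable fun i => ‖f i‖ ^ 2 := by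
  rw [memℓp_gen_iff (by norm_num)]
  simp

theorem lp_norm_sq {ι : Type*} (f : lp (fun _ : ι => ℂ) 2) : ‖f‖ ^ 2 = ∑' i, ‖f i‖ ^ 2 := by
  have := lp.norm_rpow_eq_tsum (p := 2) (by norm_num) f
  simpa using this

theorem lp_hasSum_inner {ι : Type*} (f g : lp (fun _ : ι => ℂ) 2) :
    HasSum (fun i => conj (f i) * g i) (inner ℂ f g) := by
  have := lp.hasSum_inner (𝕜 := ℂ) f g
  simpa [RCLike.inner_apply, mul_comm] using this

theorem summable_conj_mul {ι : Type*} {f g : ι → ℂ} (hf : Memℓp f 2) (hg : Memℓp g 2) :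
    Summable fun i => conj (f i) * g i :=
  (lp_hasSum_inner ⟨f, hf⟩ ⟨g, hg⟩).summable

/-! ### Displaced number states of one oscillator -/

/-- Adjointness of b and b† is a shift of the summation index, so it holds for all sequences, with
convergence on either side equivalent; the extra term at index 0 carries √0. -/
theorem hasSum_conj_mul_raise_iff (f g : ℕ → ℂ) (s : ℂ) :
    HasSum (fun m => conj (f m) * raise g m) s ↔ HasSum (fun m => conj (lower f m) * g m) s := by
  rw [← hasSum_nat_add_iff' 1]
  simp only [raise, lower, Finset.sum_range_one, CharP.cast_eq_zero, Real.sqrt_zero,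
    Complex.ofReal_zero, zero_mul, mul_zero, sub_zero, Nat.add_sub_cancel, map_mul,
    Complex.conj_ofReal, Nat.cast_add, Nat.cast_one]
  refine iff_of_eq (congrArg (fun F => HasSum F s _) (funext fun m => ?_))
  ring

theorem hasSum_conj_mul_lower_iff (f g : ℕ → ℂ) (s : ℂ) :
    HasSum (fun m => conj (f m) * lower g m) s ↔ HasSum (fun m => conj (raise f m) * g m) s := by
  rw [← hasSum_nat_add_iff' (f := fun m => conj (raise f m) * g m) 1]
  simp only [raise, lower, Finset.sum_range_one, CharP.cast_eq_zero, Real.sqrt_zero,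
    Complex.ofReal_zero, zero_mul, sub_zero, Nat.add_sub_cancel, map_mul,
    Complex.conj_ofReal, Nat.cast_add, Nat.cast_one]
  refine iff_of_eq (congrArg (fun F => HasSum F s _) (funext fun m => ?_))
  ring

/-- The displaced number state `D(β)|n⟩` of one oscillator. -/
noncomputable def displacedState (β : ℂ) (n : ℕ) : lp (fun _ : ℕ => ℂ) 2 :=
  ⟨fun m => displacement β m n, displacement_memℓp β n⟩

@[simp] theorem displacedState_apply (β : ℂ) (n m : ℕ) :
    displacedState β n m = displacement β m n := rfl

/-- The occupation numbers of the coherent state D(β)|0⟩ are Poisson distributed with mean |β|². -/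
theorem hasSum_norm_sq_displacement_zero (β : ℂ) :
    HasSum (fun m => ‖displacement β m 0‖ ^ 2) 1 := by
  have h := (NormedSpace.expSeries_div_hasSum_exp (‖β‖ ^ 2)).mul_left (Real.exp (-‖β‖ ^ 2))
  rw [← Real.exp_eq_exp_ℝ, ← Real.exp_add, neg_add_cancel, Real.exp_zero] at h
  refine h.congr_fun fun m => ?_
  rw [displacement_eq_sum_range β m zero_lt_one, Finset.sum_range_one, norm_mul, norm_mul,
    Complex.norm_real, Real.norm_of_nonneg (Real.exp_pos _).le]
  have h1 := expLower_add β 0 m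
  have h2 := expLower_add (-conj β) 0 0
  simp only [zero_add, Nat.factorial_zero, Nat.cast_one, Real.sqrt_one, Complex.ofReal_one,
    div_one, pow_zero, mul_one] at h1 h2
  rw [h1, h2, norm_one, mul_one, norm_mul, norm_div, norm_pow, Complex.norm_natCast,
    Complex.norm_real, Real.norm_of_nonneg (Real.sqrt_nonneg _), mul_pow, mul_pow,
    Real.sq_sqrt (by positivity), ← Real.exp_nat_mul]
  have : (m.factorial : ℝ) ≠ 0 := by exact_mod_cast m.factorial_ne_zero
  have e : ((2 : ℕ) : ℝ) * (-(‖β‖ ^ 2) / 2) = -‖β‖ ^ 2 := by push_cast; ring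
  rw [e, pow_right_comm]
  field_simp

/-- Moving b† - β* from the right vector to b - β on the left one replaces unitarity of D(β):
together with ⟨D0, D0⟩ = 1 this recursion determines all inner products. -/
theorem inner_displacedState_recursion (β : ℂ) (n k : ℕ) :
    (Real.sqrt (k + 1) : ℂ) * inner ℂ (displacedState β n) (displacedState β (k + 1)) =
      Real.sqrt n * inner ℂ (displacedState β (n - 1)) (displacedState β k) := by
  have h1 := lp_hasSum_inner (displacedState β n) (displacedState β (k + 1))
  have h2 := lp_hasSum_inner (displacedState β n) (displacedState β k)
  have h3 := lp_hasSum_inner (displacedState β (n - 1)) (displacedState β k)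
  have h4 := (h1.mul_left (Real.sqrt (k + 1) : ℂ)).add (h2.mul_left (conj β))
  have h5 := (h2.mul_left (conj β)).add (h3.mul_left (Real.sqrt n : ℂ))
  have h6 : HasSum (fun m => conj (displacement β m n) * raise (displacement β · k) m) _ :=
    h4.congr_fun fun m => by
      rw [raise_displacement]; simp only [displacedState_apply]; ring
  rw [hasSum_conj_mul_raise_iff] at h6
  have h7 : HasSum (fun m => conj (lower (displacement β · n) m) * displacement β m k) _ :=
    h5.congr_fun fun m => by
      rw [lower_displacement]; simp only [displacedState_apply, map_add, map_mul,
        Complex.conj_ofReal]; ring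
  have := h6.unique h7
  linear_combination this

theorem orthonormal_displacedState (β : ℂ) : Orthonormal ℂ (displacedState β) := by
  rw [orthonormal_iff_ite]
  have h00 : inner ℂ (displacedState β 0) (displacedState β 0) = (1 : ℂ) := by
    rw [inner_self_eq_norm_sq_to_K, ← RCLike.ofReal_pow, lp_norm_sq]
    have := (hasSum_norm_sq_displacement_zero β).tsum_eq
    simp only [displacedState_apply]
    rw [this]
    simp
  have h0 : ∀ k, inner ℂ (displacedState β 0) (displacedState β (k + 1)) = (0 : ℂ) := fun k => by
    have := inner_displacedState_recursion β 0 k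
    simp only [CharP.cast_eq_zero, Real.sqrt_zero, Complex.ofReal_zero, zero_mul] at this
    exact (mul_eq_zero.mp this).resolve_left (sqrt_succ_ne_zero k)
  intro n k
  induction k generalizing n with
  | zero =>
    cases n with
    | zero => simpa using h00
    | succ n => rw [← inner_conj_symm, h0]; simp
  | succ k ih =>
    have := inner_displacedState_recursion β n k
    rw [ih] at this
    refine mul_left_cancel₀ (sqrt_succ_ne_zero k) (this.trans ?_)
    cases n with
    | zero => simp
    | succ n =>
      simp only [Nat.add_sub_cancel, Nat.cast_add, Nat.cast_one, Nat.add_right_cancel_iff]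
      split_ifs with h
      · rw [h]
      · simp

/-- The displaced number operator `(b† - β*)(b - β)` acting on sequences. -/
noncomputable def displacedNumber (β : ℂ) (f : ℕ → ℂ) : ℕ → ℂ := fun m =>
  (m : ℂ) * f m + (‖β‖ : ℂ) ^ 2 * f m - (β * raise f m + conj β * lower f m)

theorem raise_lower (f : ℕ → ℂ) (m : ℕ) : raise (lower f) m = m * f m := by
  cases m with
  | zero => simp [raise]
  | succ m =>
    simp only [raise, lower, Nat.add_sub_cancel]
    have := ofReal_sqrt_mul_self m
    push_cast
    linear_combination f (m + 1) * this

/-- The operator factors as (b† - β*)(b - β), and the two ladder relations send D(β)|n⟩ to √n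
D(β)|n-1⟩ and back. Here b†b is written as `raise (lower ·)`. -/
theorem displacedNumber_displacement (β : ℂ) (n : ℕ) :
    displacedNumber β (displacement β · n) = fun m => n * displacement β m n := by
  funext m
  have h1 := raise_lower (displacement β · n) m
  simp only [displacedNumber, ← h1]
  rw [lower_displacement]
  have h2 := congrFun (raise_displacement β n) m
  have h3 := congrFun (raise_displacement β (n - 1)) m
  have h4 := Complex.mul_conj β
  rw [Complex.normSq_eq_norm_sq] at h4
  push_cast at h4
  have h5 : raise (fun m => β * displacement β m n + Real.sqrt n * displacement β m (n - 1)) m =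
      β * raise (displacement β · n) m + Real.sqrt n * raise (displacement β · (n - 1)) m := by
    simp only [raise]; ring
  rw [h5, h2, h3]
  cases n with
  | zero =>
    simp only [CharP.cast_eq_zero, Real.sqrt_zero, Complex.ofReal_zero]
    linear_combination (-displacement β m 0) * h4
  | succ n =>
    have := ofReal_sqrt_mul_self n
    simp only [Nat.add_sub_cancel, Nat.cast_add, Nat.cast_one]
    linear_combination (-displacement β m (n + 1)) * h4 + displacement β m (n + 1) * this

theorem memℓp_lower_displacement (β : ℂ) (n : ℕ) : Memℓp (lower (displacement β · n)) 2 := by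
  rw [lower_displacement]
  exact ((displacement_memℓp β n).const_mul β).add
    ((displacement_memℓp β (n - 1)).const_mul (Real.sqrt n : ℂ))

theorem memℓp_raise_displacement (β : ℂ) (n : ℕ) : Memℓp (raise (displacement β · n)) 2 := by
  rw [raise_displacement]
  exact ((displacement_memℓp β (n + 1)).const_mul (Real.sqrt (n + 1) : ℂ)).add
    ((displacement_memℓp β n).const_mul (conj β))

/-- Writing N = b†b and applying the ladder relations twice leaves a finite combination of displaced
states. Thus D(β)|n⟩ is regular enough to be paired with the number operator applied to any square
summable sequence. -/
theorem memℓp_natCast_mul_displacement (β : ℂ) (n : ℕ) :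
    Memℓp (fun m : ℕ => (m : ℂ) * displacement β m n) 2 := by
  have h := ((memℓp_raise_displacement β n).const_mul β).add
    ((memℓp_raise_displacement β (n - 1)).const_mul (Real.sqrt n : ℂ))
  have e : (fun m : ℕ => (m : ℂ) * displacement β m n) = fun m =>
      β * raise (displacement β · n) m + Real.sqrt n * raise (displacement β · (n - 1)) m := by
    funext m
    rw [← raise_lower (displacement β · n) m, lower_displacement]
    simp only [raise]
    ring
  rw [e]
  exact h

/-- The displaced number operator is symmetric between `D(β)|n⟩` and square summable sequences. -/
theorem hasSum_conj_displacement_mul_displacedNumber (β : ℂ) (n : ℕ) {f : ℕ → ℂ}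
    (hf : Memℓp f 2) {s : ℂ} (hs : HasSum (fun m => conj (displacement β m n) * f m) s) :
    HasSum (fun m => conj (displacement β m n) * displacedNumber β f m) (n * s) := by
  have h1 := (summable_conj_mul (memℓp_natCast_mul_displacement β n) hf).hasSum
  have h2 := (summable_conj_mul (memℓp_lower_displacement β n) hf).hasSum
  have h3 := (summable_conj_mul (memℓp_raise_displacement β n) hf).hasSum
  have h2' := (hasSum_conj_mul_raise_iff _ f _).mpr h2
  have h3' := (hasSum_conj_mul_lower_iff _ f _).mpr h3
  have hL := (h1.add (hs.mul_left ((‖β‖ : ℂ) ^ 2))).sub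
    ((h2'.mul_left β).add (h3'.mul_left (conj β)))
  have hR := (h1.add (hs.mul_left ((‖β‖ : ℂ) ^ 2))).sub
    ((h2.mul_left β).add (h3.mul_left (conj β)))
  have e := hR.unique ((hs.mul_left (n : ℂ)).congr_fun fun m => by
    have := congrArg conj (congrFun (displacedNumber_displacement β n) m)
    simp only [displacedNumber, map_sub, map_add, map_mul, map_pow, Complex.conj_ofReal,
      Complex.conj_conj, Complex.conj_natCast] at this ⊢
    linear_combination f m * this)
  rw [e] at hL
  refine hL.congr_fun fun m => ?_
  simp only [displacedNumber, map_mul, Complex.conj_natCast]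
  ring

/-! ### Exponential moments of the displaced number states -/

/-- Conjugation by q^N rescales b† by q and b by 1/q, so q^N D(β) is a scalar times e^{qβb†}
e^{-β*b/q} q^N. Splitting -β*/q = -qβ* + β*(q - 1/q) in the second exponent turns this into a scalar
times D(qβ) e^{β*(q - 1/q)b} q^N, and the last exponential has finite columns. -/
theorem pow_mul_displacement (β : ℂ) {q : ℝ} (hq : 0 < q) (m n : ℕ) :
    (q : ℂ) ^ m * displacement β m n = (q : ℂ) ^ n * Real.exp (‖β‖ ^ 2 * (q ^ 2 - 1) / 2) *
      ∑ k ∈ Finset.range (n + 1),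
        expLower (conj β * (q - q⁻¹)) k n * displacement (q * β) m k := by
  have hqc : (q : ℂ) ≠ 0 := by exact_mod_cast hq.ne'
  have hsum : ∑ k ∈ Finset.range (n + 1),
        expLower (conj β * (q - q⁻¹)) k n * displacement (q * β) m k =
      Real.exp (-(q ^ 2 * ‖β‖ ^ 2) / 2) * ∑ j ∈ Finset.range (n + 1),
        expLower (q * β) j m * expLower ((q : ℂ)⁻¹ * -conj β) j n := by
    have h1 : ∀ k ∈ Finset.range (n + 1),
        expLower (conj β * (q - q⁻¹)) k n * displacement (q * β) m k =
        ∑ j ∈ Finset.range (n + 1), Real.exp (-(q ^ 2 * ‖β‖ ^ 2) / 2) *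
          (expLower (q * β) j m * (expLower (-(q * conj β)) j k *
            expLower (conj β * (q - q⁻¹)) k n)) := fun k hk => by
      rw [displacement_eq_sum_range _ _ (Finset.mem_range.mp hk), norm_mul, Complex.norm_real,
        Real.norm_of_nonneg hq.le, mul_pow, Finset.mul_sum, Finset.mul_sum]
      refine Finset.sum_congr rfl fun j _ => ?_
      rw [map_mul, Complex.conj_ofReal]
      ring
    rw [Finset.sum_congr rfl h1, Finset.sum_comm, Finset.mul_sum]
    refine Finset.sum_congr rfl fun j _ => ?_
    rw [← Finset.mul_sum, ← Finset.mul_sum, sum_expLower_mul]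
    congr 4
    push_cast
    ring
  rw [hsum, displacement, Finset.mul_sum, Finset.mul_sum, Finset.mul_sum, Finset.mul_sum]
  refine Finset.sum_congr rfl fun j hj => ?_
  have hjn : j ≤ n := Nat.lt_succ_iff.mp (Finset.mem_range.mp hj)
  rw [expLower_smul, expLower_smul, expRaise]
  rcases lt_or_ge m j with h | h
  · simp [expLower_of_lt _ h]
  obtain ⟨a, rfl⟩ := Nat.exists_eq_add_of_le h
  obtain ⟨b, rfl⟩ := Nat.exists_eq_add_of_le hjn
  have he : (Real.exp (‖β‖ ^ 2 * (q ^ 2 - 1) / 2) : ℂ) * Real.exp (-(q ^ 2 * ‖β‖ ^ 2) / 2) =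
      Real.exp (-(‖β‖ ^ 2) / 2) := by
    rw [← Complex.ofReal_mul, ← Real.exp_add]
    congr 2
    ring
  rw [← he, Nat.add_sub_cancel_left, Nat.add_sub_cancel_left, inv_pow, pow_add, pow_add]
  field_simp

/-- By `pow_mul_displacement` the weighted column is a finite combination of the orthonormal vectors
D(qβ)|k⟩, so Pythagoras gives the moment exactly. -/
theorem hasSum_norm_sq_displacement (β : ℂ) {q : ℝ} (hq : 0 < q) (n : ℕ) :
    HasSum (fun m => ‖displacement β m n‖ ^ 2 * (q ^ m / q ^ n) ^ 2)
      (Real.exp (‖β‖ ^ 2 * (q ^ 2 - 1)) *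
        ∑ k ∈ Finset.range (n + 1), ‖expLower (conj β * (q - q⁻¹)) k n‖ ^ 2) := by
  set c := fun k => expLower (conj β * (q - q⁻¹)) k n with hc
  set ψ : lp (fun _ : ℕ => ℂ) 2 :=
    ∑ k ∈ Finset.range (n + 1), c k • displacedState (q * β) k with hψ
  have hnorm : ‖ψ‖ ^ 2 = ∑ k ∈ Finset.range (n + 1), ‖c k‖ ^ 2 := by
    have h := (orthonormal_displacedState (q * β)).inner_sum c c (Finset.range (n + 1))
    rw [← hψ, inner_self_eq_norm_sq_to_K] at h
    have h2 : ∀ k, conj (c k) * c k = ((‖c k‖ ^ 2 : ℝ) : ℂ) := fun k => by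
      rw [mul_comm, Complex.mul_conj, Complex.normSq_eq_norm_sq]
    simp only [h2] at h
    exact Complex.ofReal_injective (by push_cast at h ⊢; exact h)
  have hψm : ∀ m, ψ m = ∑ k ∈ Finset.range (n + 1), c k * displacement (q * β) m k := fun m => by
    simp only [hψ]
    rw [lp.coeFn_sum]
    simp
  have hs : HasSum (fun m => ‖ψ m‖ ^ 2) (‖ψ‖ ^ 2) := by
    rw [lp_norm_sq]
    exact ((memℓp_two_iff _).mp ψ.2).hasSum
  rw [hnorm] at hs
  refine (hs.mul_left _).congr_fun fun m => ?_
  have h : ‖_‖ ^ 2 = ‖_‖ ^ 2 := congrArg (fun z => ‖z‖ ^ 2) (pow_mul_displacement β hq m n)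
  rw [← hψm] at h
  simp only [norm_mul, norm_pow, Complex.norm_real, Real.norm_of_nonneg hq.le,
    Real.norm_of_nonneg (Real.exp_pos _).le, mul_pow, ← Real.exp_nat_mul] at h
  have e : ((2 : ℕ) : ℝ) * (‖β‖ ^ 2 * (q ^ 2 - 1) / 2) = ‖β‖ ^ 2 * (q ^ 2 - 1) := by
    push_cast; ring
  rw [e] at h
  have : q ^ n ≠ 0 := by positivity
  field_simp
  linear_combination h

/-- With p = n - k quanta removed, the term is at most (n|c|²)^p / p! because n!/(n-p)! ≤ n^p; the
sum is then part of an exponential series. -/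
theorem sum_norm_sq_expLower_le (c : ℂ) (n : ℕ) :
    ∑ k ∈ Finset.range (n + 1), ‖expLower c k n‖ ^ 2 ≤ Real.exp (n * ‖c‖ ^ 2) := by
  rw [← Finset.sum_range_reflect]
  refine le_trans (Finset.sum_le_sum fun p hp => ?_)
    (Real.sum_le_exp_of_nonneg (by positivity) (n + 1))
  have hp' : p ≤ n := Nat.lt_succ_iff.mp (Finset.mem_range.mp hp)
  have e : n + 1 - 1 - p = n - p := by omega
  rw [e, expLower, if_pos (Nat.sub_le _ _), Nat.sub_sub_self hp', norm_mul, norm_div, norm_pow,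
    Complex.norm_natCast, Complex.norm_real, Real.norm_of_nonneg (Real.sqrt_nonneg _), mul_pow,
    Real.sq_sqrt (by positivity), mul_pow]
  have h1 : (n.factorial : ℝ) ≤ (n : ℝ) ^ p * (n - p).factorial := by
    have h := Nat.factorial_mul_descFactorial hp'
    have h2 := Nat.descFactorial_le_pow n p
    rw [← h]
    push_cast
    rw [mul_comm]
    gcongr
    exact_mod_cast h2
  have h3 : (1 : ℝ) ≤ p.factorial := by exact_mod_cast p.factorial_pos
  have h4 : (0 : ℝ) < (n - p).factorial := by exact_mod_cast (n - p).factorial_pos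
  have h5 : (n.factorial : ℝ) / (n - p).factorial ≤ (n : ℝ) ^ p := by
    rw [div_le_iff₀ h4]; exact h1
  calc (‖c‖ ^ p / (p.factorial : ℝ)) ^ 2 * ((n.factorial : ℝ) / (n - p).factorial)
      ≤ (‖c‖ ^ p / (p.factorial : ℝ)) ^ 2 * (n : ℝ) ^ p := by gcongr
    _ = (n : ℝ) ^ p * (‖c‖ ^ 2) ^ p / (p.factorial * p.factorial) := by
        rw [div_pow]; ring
    _ ≤ (n : ℝ) ^ p * (‖c‖ ^ 2) ^ p / (p.factorial * 1) := by gcongr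
    _ = _ := by rw [mul_one]

/-- This converts exponential weights in |√n - √m| into weights in |n - m| at the rate n^{-1/2}; the
maximum with 1 covers n = 0. -/
theorem abs_sqrt_sub_sqrt_mul_le (n m : ℕ) :
    |Real.sqrt n - Real.sqrt m| * Real.sqrt (max n 1 : ℕ) ≤ |(n : ℝ) - m| := by
  rcases Nat.eq_zero_or_pos n with rfl | hn
  · simp only [CharP.cast_eq_zero, Real.sqrt_zero, zero_sub, abs_neg, zero_le, max_eq_right,
      Nat.cast_one, Real.sqrt_one, mul_one]
    rw [abs_of_nonneg (Real.sqrt_nonneg _), Nat.abs_cast]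
    rcases Nat.eq_zero_or_pos m with rfl | hm
    · simp
    · have : (1 : ℝ) ≤ m := by exact_mod_cast hm
      exact Real.sqrt_le_iff.mpr ⟨by positivity, by nlinarith⟩
  · rw [max_eq_left hn]
    have h : (n : ℝ) - m = (Real.sqrt n - Real.sqrt m) * (Real.sqrt n + Real.sqrt m) := by
      have h1 := Real.mul_self_sqrt (Nat.cast_nonneg (α := ℝ) n)
      have h2 := Real.mul_self_sqrt (Nat.cast_nonneg (α := ℝ) m)
      linear_combination h2 - h1
    have h1 := Real.sqrt_nonneg (n : ℝ)
    have h2 := Real.sqrt_nonneg (m : ℝ)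
    rw [h, abs_mul, abs_of_nonneg (by positivity : 0 ≤ Real.sqrt n + Real.sqrt m)]
    gcongr
    linarith

theorem abs_exp_sub_exp_neg_le (t : ℝ) :
    |Real.exp t - Real.exp (-t)| ≤ 2 * |t| * Real.exp |t| := by
  wlog ht : 0 ≤ t generalizing t
  · have := this (-t) (by linarith)
    rwa [neg_neg, abs_sub_comm, abs_neg] at this
  rw [abs_of_nonneg ht, abs_of_nonneg (sub_nonneg.mpr (Real.exp_le_exp.mpr (by linarith)))]
  have h := Real.add_one_le_exp (-2 * t)
  have e : Real.exp (-t) = Real.exp t * Real.exp (-2 * t) := by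
    rw [← Real.exp_add]; ring_nf
  rw [e]
  nlinarith [Real.exp_pos t]

/-- Take q = e^t in the exact formula. The coefficient q - 1/q is of order t, so n|q - 1/q|² is of
order nt² ≤ 4μ²: this choice of t is what makes the bound independent of n. -/
theorem displacement_exp_moment (β : ℂ) {μ : ℝ} (hμ : 0 < μ) (n : ℕ) {t : ℝ}
    (ht : |t| = 2 * μ / Real.sqrt (max n 1 : ℕ)) :
    Summable (fun m : ℕ => ‖displacement β m n‖ ^ 2 * Real.exp (2 * t * ((m : ℝ) - n))) ∧
    ∑' m : ℕ, ‖displacement β m n‖ ^ 2 * Real.exp (2 * t * ((m : ℝ) - n)) ≤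
      Real.exp (‖β‖ ^ 2 * Real.exp (4 * μ)) *
        Real.exp (‖β‖ ^ 2 * (16 * μ ^ 2 * Real.exp (4 * μ))) := by
  have h := hasSum_norm_sq_displacement β (Real.exp_pos t) n
  have h' : HasSum (fun m : ℕ => ‖displacement β m n‖ ^ 2 * Real.exp (2 * t * ((m : ℝ) - n))) _ :=
    h.congr_fun fun m => by
      rw [← Real.exp_nat_mul, ← Real.exp_nat_mul, ← Real.exp_sub, ← Real.exp_nat_mul]
      congr 2
      push_cast
      ring
  refine ⟨h'.summable, ?_⟩
  rw [h'.tsum_eq]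
  have hmax : (1 : ℝ) ≤ (max n 1 : ℕ) := by exact_mod_cast le_max_right n 1
  have hs1 : 1 ≤ Real.sqrt (max n 1 : ℕ) := Real.one_le_sqrt.mpr hmax
  have ht1 : |t| ≤ 2 * μ := by
    rw [ht]
    exact div_le_self (by positivity) hs1
  have ht2 : (n : ℝ) * |t| ^ 2 ≤ 4 * μ ^ 2 := by
    rw [ht, div_pow, Real.sq_sqrt (by positivity), mul_div_assoc', div_le_iff₀ (by positivity)]
    have : (n : ℝ) ≤ (max n 1 : ℕ) := by exact_mod_cast le_max_left n 1
    nlinarith [sq_nonneg μ]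
  gcongr
  · rw [← Real.exp_nat_mul]
    have : Real.exp (((2 : ℕ) : ℝ) * t) ≤ Real.exp (4 * μ) :=
      Real.exp_le_exp.mpr (by push_cast; linarith [le_abs_self t])
    linarith
  · refine (sum_norm_sq_expLower_le _ n).trans (Real.exp_le_exp.mpr ?_)
    have e : ‖conj β * ((Real.exp t : ℂ) - ((Real.exp t)⁻¹ : ℝ))‖ =
        ‖β‖ * |Real.exp t - Real.exp (-t)| := by
      rw [norm_mul, RCLike.norm_conj, ← Complex.ofReal_sub,
        Complex.norm_real, Real.norm_eq_abs, Real.exp_neg]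
    rw [e]
    have h1 := abs_exp_sub_exp_neg_le t
    have h2 : Real.exp |t| ^ 2 ≤ Real.exp (4 * μ) := by
      rw [← Real.exp_nat_mul]
      exact Real.exp_le_exp.mpr (by push_cast; linarith)
    calc (n : ℝ) * (‖β‖ * |Real.exp t - Real.exp (-t)|) ^ 2
        ≤ n * (‖β‖ * (2 * |t| * Real.exp |t|)) ^ 2 := by gcongr
      _ = ‖β‖ ^ 2 * (4 * (n * |t| ^ 2) * Real.exp |t| ^ 2) := by ring
      _ ≤ ‖β‖ ^ 2 * (4 * (4 * μ ^ 2) * Real.exp (4 * μ)) := by gcongr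
      _ = _ := by ring

theorem displacementSum_ne_top (β : ℂ) {μ : ℝ} (hμ : 0 < μ) : displacementSum β μ ≠ ∞ := by
  set A := Real.exp (‖β‖ ^ 2 * Real.exp (4 * μ)) *
    Real.exp (‖β‖ ^ 2 * (16 * μ ^ 2 * Real.exp (4 * μ))) with hA
  refine ne_top_of_le_ne_top (ENNReal.ofReal_ne_top (r := A + A)) (iSup_le fun n => ?_)
  set t := 2 * μ / Real.sqrt (max n 1 : ℕ) with ht
  have hmax : (1 : ℝ) ≤ (max n 1 : ℕ) := by exact_mod_cast le_max_right n 1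
  have hs : 0 < Real.sqrt (max n 1 : ℕ) := Real.sqrt_pos.mpr (by linarith)
  have ht0 : 0 < t := by positivity
  obtain ⟨hs1, hb1⟩ := displacement_exp_moment β hμ n (abs_of_pos ht0)
  obtain ⟨hs2, hb2⟩ := displacement_exp_moment β hμ n ((abs_neg t).trans (abs_of_pos ht0))
  calc ∑' m : ℕ, ENNReal.ofReal
        (‖displacement β n m‖ ^ 2 * Real.exp (4 * μ * |Real.sqrt n - Real.sqrt m|))
      -- The exponential of an absolute value is dominated by the sum of the exponentials with both
      -- signs.
      ≤ ∑' m : ℕ, ENNReal.ofReal (‖displacement β m n‖ ^ 2 * Real.exp (2 * t * ((m : ℝ) - n)) +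
          ‖displacement β m n‖ ^ 2 * Real.exp (2 * -t * ((m : ℝ) - n))) := by
        refine ENNReal.tsum_le_tsum fun m => ENNReal.ofReal_le_ofReal ?_
        rw [norm_displacement_comm, ← mul_add]
        refine mul_le_mul_of_nonneg_left ?_ (by positivity)
        have h1 : 4 * μ * |Real.sqrt n - Real.sqrt m| ≤ 2 * t * |(n : ℝ) - m| := by
          have := abs_sqrt_sub_sqrt_mul_le n m
          rw [ht]
          have e : 2 * (2 * μ / Real.sqrt (max n 1 : ℕ)) * |(n : ℝ) - m| =
            4 * μ * |(n : ℝ) - m| / Real.sqrt (max n 1 : ℕ) := by ring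
          rw [e, le_div_iff₀ hs, mul_assoc]
          gcongr
        refine (Real.exp_le_exp.mpr h1).trans ?_
        rcases abs_cases ((n : ℝ) - m) with ⟨h, -⟩ | ⟨h, -⟩ <;> rw [h]
        · have e : 2 * t * ((n : ℝ) - m) = 2 * -t * ((m : ℝ) - n) := by ring
          rw [e]
          linarith [Real.exp_pos (2 * t * ((m : ℝ) - n))]
        · have e : 2 * t * -((n : ℝ) - m) = 2 * t * ((m : ℝ) - n) := by ring
          rw [e]
          linarith [Real.exp_pos (2 * -t * ((m : ℝ) - n))]
    _ = ENNReal.ofReal (∑' m : ℕ, (‖displacement β m n‖ ^ 2 * Real.exp (2 * t * ((m : ℝ) - n)) +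
          ‖displacement β m n‖ ^ 2 * Real.exp (2 * -t * ((m : ℝ) - n)))) :=
        (ENNReal.ofReal_tsum_of_nonneg (fun m => by positivity) (hs1.add hs2)).symm
    _ ≤ ENNReal.ofReal (A + A) := by
        rw [hs1.tsum_add hs2]
        exact ENNReal.ofReal_le_ofReal (add_le_add hb1 hb2)

theorem displacementSum_ne_zero (β : ℂ) (μ : ℝ) : displacementSum β μ ≠ 0 := by
  have h : ENNReal.ofReal (‖displacement β 0 0‖ ^ 2 *
      Real.exp (4 * μ * |Real.sqrt (0 : ℕ) - Real.sqrt (0 : ℕ)|)) ≤ displacementSum β μ :=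
    (ENNReal.le_tsum (f := fun m : ℕ => ENNReal.ofReal (‖displacement β 0 m‖ ^ 2 *
      Real.exp (4 * μ * |Real.sqrt (0 : ℕ) - Real.sqrt m|))) 0).trans
      (le_iSup (fun n : ℕ => ∑' m : ℕ, ENNReal.ofReal (‖displacement β n m‖ ^ 2 *
        Real.exp (4 * μ * |Real.sqrt n - Real.sqrt m|))) 0)
  refine (lt_of_lt_of_le (ENNReal.ofReal_pos.mpr ?_) h).ne'
  have : displacement β 0 0 ≠ 0 := by
    simp [displacement, expRaise, expLower, Complex.exp_ne_zero]
  positivity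

theorem displacementSum_toReal_pos (β : ℂ) {μ : ℝ} (hμ : 0 < μ) :
    0 < (displacementSum β μ).toReal :=
  ENNReal.toReal_pos (displacementSum_ne_zero β μ) (displacementSum_ne_top β hμ)

theorem decayConst_pos {c : ℝ} (hc : 0 < c) (β : ℂ) {μ : ℝ} (hμ : 0 < μ) :
    0 < decayConst c β μ := by
  have := displacementSum_toReal_pos β hμ
  rw [decayConst]
  positivity

/-! ### Cauchy–Schwarz and the Schur test in `[0, ∞]` -/

theorem sq_tsum_mul_le {ι : Type*} (f g : ι → ℝ≥0∞) :
    (∑' i, f i * g i) ^ 2 ≤ (∑' i, f i ^ 2) * ∑' i, g i ^ 2 := by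
  let _ : MeasurableSpace ι := ⊤
  have h := ENNReal.lintegral_mul_le_Lp_mul_Lq MeasureTheory.Measure.count
    Real.HolderConjugate.two_two (f := f) (g := g) measurable_from_top.aemeasurable
    measurable_from_top.aemeasurable
  simp only [MeasureTheory.lintegral_count, Pi.mul_apply, ENNReal.rpow_two] at h
  refine (pow_le_pow_left' h 2).trans_eq ?_
  rw [mul_pow, ← ENNReal.rpow_natCast, ← ENNReal.rpow_natCast, ← ENNReal.rpow_mul,
    ← ENNReal.rpow_mul]
  norm_num

theorem rpow_half_sq (x : ℝ≥0∞) : (x ^ (1 / 2 : ℝ)) ^ 2 = x := by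
  rw [← ENNReal.rpow_natCast, ← ENNReal.rpow_mul]
  norm_num

/-- A Schur test for a kernel that is bounded only relative to w. Cauchy–Schwarz is applied to k f =
(k/w)^{1/2} · (k w)^{1/2} f: the first factor is summed along rows, and the second along columns,
where k contributes one more w. -/
theorem tsum_sq_tsum_mul_le {ι κ : Type*} (k : ι → κ → ℝ≥0∞) {w : κ → ℝ≥0∞}
    (hw0 : ∀ b, w b ≠ 0) (hw : ∀ b, w b ≠ ∞) {A C : ℝ≥0∞}
    (hrow : ∀ a, ∑' b, k a b * (w b)⁻¹ ≤ A) (hcol : ∀ b, ∑' a, k a b ≤ C * w b)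
    (f : κ → ℝ≥0∞) :
    ∑' a, (∑' b, k a b * f b) ^ 2 ≤ A * C * ∑' b, (w b * f b) ^ 2 := by
  have h1 : ∀ a, (∑' b, k a b * f b) ^ 2 ≤ A * ∑' b, k a b * (w b * f b ^ 2) := fun a => by
    have e : ∀ b, k a b * f b =
        (k a b * (w b)⁻¹) ^ (1 / 2 : ℝ) * ((k a b * w b) ^ (1 / 2 : ℝ) * f b) := fun b => by
      rw [← mul_assoc, ← ENNReal.mul_rpow_of_nonneg _ _ (by norm_num),
        show k a b * (w b)⁻¹ * (k a b * w b) = k a b ^ 2 * (w b * (w b)⁻¹) by ring,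
        ENNReal.mul_inv_cancel (hw0 b) (hw b), mul_one, ← ENNReal.rpow_natCast,
        ← ENNReal.rpow_mul]
      norm_num
    simp only [e]
    refine (sq_tsum_mul_le _ _).trans ?_
    simp only [mul_pow, rpow_half_sq]
    simp only [mul_assoc]
    exact mul_le_mul_left (by simpa using hrow a) _
  calc ∑' a, (∑' b, k a b * f b) ^ 2
      ≤ ∑' a, A * ∑' b, k a b * (w b * f b ^ 2) := ENNReal.tsum_le_tsum h1
    _ = A * ∑' b, (∑' a, k a b) * (w b * f b ^ 2) := by
        rw [ENNReal.tsum_mul_left, ENNReal.tsum_comm]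
        simp only [ENNReal.tsum_mul_right]
    _ ≤ A * ∑' b, C * (w b * f b) ^ 2 := by
        refine mul_le_mul_right (ENNReal.tsum_le_tsum fun b => ?_) A
        calc (∑' a, k a b) * (w b * f b ^ 2) ≤ C * w b * (w b * f b ^ 2) := by
              gcongr; exact hcol b
          _ = C * (w b * f b) ^ 2 := by ring
    _ = A * C * ∑' b, (w b * f b) ^ 2 := by rw [ENNReal.tsum_mul_left, mul_assoc]

theorem mul_le_of_sq_le {x y c : ℝ≥0∞} (hx : x ^ 2 ≤ c) (hy : y ^ 2 ≤ c) : x * y ≤ c := by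
  rcases le_total x y with h | h
  · exact (mul_le_mul_left h y).trans (by rwa [← sq])
  · exact (mul_le_mul_right h x).trans (by rwa [← sq])

/-! ### Sums of exponentials of square roots -/

theorem sqrt_succ_sub_sqrt_bounds (m : ℕ) :
    1 / Real.sqrt (m + 1) ≤ 2 * (Real.sqrt (m + 1) - Real.sqrt m) ∧
      0 ≤ Real.sqrt (m + 1) - Real.sqrt m ∧ Real.sqrt (m + 1) - Real.sqrt m ≤ 1 := by
  have h0 : (0 : ℝ) ≤ m := by positivity
  have h1 := Real.mul_self_sqrt h0
  have h2 := Real.mul_self_sqrt (by positivity : (0 : ℝ) ≤ (m : ℝ) + 1)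
  have h3 := Real.sqrt_nonneg (m : ℝ)
  have h4 : 0 < Real.sqrt ((m : ℝ) + 1) := Real.sqrt_pos.mpr (by positivity)
  have h5 : Real.sqrt (m : ℝ) ≤ Real.sqrt ((m : ℝ) + 1) := Real.sqrt_le_sqrt (by linarith)
  have h6 : 1 ≤ Real.sqrt ((m : ℝ) + 1) := Real.one_le_sqrt.mpr (by linarith)
  refine ⟨?_, by linarith, by nlinarith⟩
  rw [div_le_iff₀ h4]
  nlinarith

/-- A bounded primitive of `m ↦ e^{-λ |√n - √m|} / √(m + 1)`. -/
noncomputable def sqrtExpPrimitive (l : ℝ) (n m : ℕ) : ℝ :=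
  if m ≤ n then Real.exp (-l * (Real.sqrt n - Real.sqrt m))
  else 2 - Real.exp (-l * (Real.sqrt m - Real.sqrt n))

/-- Since 1/√(m+1) ≤ 2(√(m+1) - √m), the left side compares with an increment of a primitive of
e^{-l|√n - s|} in the variable s = √m. The sum then telescopes. -/
theorem sqrtExp_le_primitive_sub {l : ℝ} (hl : 0 < l) (n m : ℕ) :
    Real.exp (-l * |Real.sqrt n - Real.sqrt m|) / Real.sqrt (m + 1) ≤
      2 * (1 + l) / l * (sqrtExpPrimitive l n (m + 1) - sqrtExpPrimitive l n m) := by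
  obtain ⟨h1, h2, h3⟩ := sqrt_succ_sub_sqrt_bounds m
  set h := Real.sqrt ((m : ℝ) + 1) - Real.sqrt m with hh
  have hs : Real.sqrt ((m + 1 : ℕ) : ℝ) = Real.sqrt m + h := by rw [hh]; push_cast; ring
  -- Here x is the exponential itself. Below n the primitive grows by at least lh·x; from n on it
  -- grows by x(1 - e^{-lh}) ≥ x·lh/(1+l), using h ≤ 1. The weaker of the two bounds serves both
  -- cases.
  suffices H : ∀ x ≥ 0, x * (2 * (l * h) / (1 + l)) ≤
      2 * (sqrtExpPrimitive l n (m + 1) - sqrtExpPrimitive l n m) →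
      Real.exp (-l * |Real.sqrt n - Real.sqrt m|) ≤ x →
      Real.exp (-l * |Real.sqrt n - Real.sqrt m|) / Real.sqrt (m + 1) ≤
      2 * (1 + l) / l * (sqrtExpPrimitive l n (m + 1) - sqrtExpPrimitive l n m) by
    rcases lt_or_ge m n with hmn | hmn
    · have hle : Real.sqrt m ≤ Real.sqrt n := Real.sqrt_le_sqrt (by exact_mod_cast hmn.le)
      refine H (Real.exp (-l * (Real.sqrt n - Real.sqrt m))) (Real.exp_pos _).le ?_ ?_
      · rw [sqrtExpPrimitive, sqrtExpPrimitive, if_pos hmn.le, if_pos (Nat.succ_le_of_lt hmn), hs]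
        have e : Real.exp (-l * (Real.sqrt n - (Real.sqrt m + h))) =
            Real.exp (-l * (Real.sqrt n - Real.sqrt m)) * Real.exp (l * h) := by
          rw [← Real.exp_add]; ring_nf
        rw [e]
        have h4 := Real.add_one_le_exp (l * h)
        have h5 : 2 * (l * h) / (1 + l) ≤ 2 * (l * h) :=
          div_le_self (by positivity) (by linarith)
        have h6 := Real.exp_pos (-l * (Real.sqrt n - Real.sqrt m))
        nlinarith
      · rw [abs_of_nonneg (by linarith)]
    · have hle : Real.sqrt n ≤ Real.sqrt m := Real.sqrt_le_sqrt (by exact_mod_cast hmn)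
      refine H (Real.exp (-l * (Real.sqrt m - Real.sqrt n))) (Real.exp_pos _).le ?_ ?_
      · have em : sqrtExpPrimitive l n m = 2 - Real.exp (-l * (Real.sqrt m - Real.sqrt n)) := by
          rw [sqrtExpPrimitive]
          split_ifs with hm
          · rw [le_antisymm hm hmn]
            simp
            norm_num
          · rfl
        rw [em, sqrtExpPrimitive, if_neg (by omega), hs]
        have e : Real.exp (-l * (Real.sqrt m + h - Real.sqrt n)) =
            Real.exp (-l * (Real.sqrt m - Real.sqrt n)) * Real.exp (-(l * h)) := by
          rw [← Real.exp_add]; ring_nf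
        rw [e]
        have h6 := Real.exp_pos (-l * (Real.sqrt m - Real.sqrt n))
        have h7 : l * h / (1 + l) ≤ 1 - Real.exp (-(l * h)) := by
          have h4 := Real.add_one_le_exp (l * h)
          have hlh : 0 ≤ l * h := by positivity
          have h8 : Real.exp (-(l * h)) ≤ 1 / (1 + l * h) := by
            rw [Real.exp_neg, ← one_div]
            exact one_div_le_one_div_of_le (by linarith) (by linarith)
          have h9 : l * h / (1 + l) ≤ l * h / (1 + l * h) :=
            div_le_div_of_nonneg_left hlh (by linarith) (by nlinarith)
          have h10 : 1 - 1 / (1 + l * h) = l * h / (1 + l * h) := by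
            have : 1 + l * h ≠ 0 := by positivity
            field_simp
            ring
          linarith
        have h11 : 2 * (l * h) / (1 + l) = 2 * (l * h / (1 + l)) := by ring
        rw [h11]
        nlinarith
      · rw [abs_sub_comm, abs_of_nonneg (by linarith)]
  intro x hx hP hE
  have hl1 : 0 < 1 + l := by linarith
  calc Real.exp (-l * |Real.sqrt n - Real.sqrt m|) / Real.sqrt (m + 1)
      ≤ x * (1 / Real.sqrt (m + 1)) := by
        rw [div_eq_mul_one_div]
        gcongr
    _ ≤ x * (2 * h) := by gcongr
    _ = (1 + l) / l * (x * (2 * (l * h) / (1 + l))) := by field_simp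
    _ ≤ (1 + l) / l * (2 * (sqrtExpPrimitive l n (m + 1) - sqrtExpPrimitive l n m)) := by gcongr
    _ = _ := by ring

theorem tsum_sqrtExp_div_le {l : ℝ} (hl : 0 < l) (n : ℕ) :
    ∑' m : ℕ, ENNReal.ofReal (Real.exp (-l * |Real.sqrt n - Real.sqrt m|) / Real.sqrt (m + 1)) ≤
      ENNReal.ofReal (4 * (1 + l) / l) := by
  refine ENNReal.tsum_le_of_sum_range_le fun M => ?_
  rw [← ENNReal.ofReal_sum_of_nonneg fun m _ => by positivity]
  refine ENNReal.ofReal_le_ofReal ?_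
  refine (Finset.sum_le_sum fun m _ => sqrtExp_le_primitive_sub hl n m).trans ?_
  rw [← Finset.mul_sum, Finset.sum_range_sub]
  have h1 : sqrtExpPrimitive l n M ≤ 2 := by
    rw [sqrtExpPrimitive]
    split_ifs with h
    · have : Real.exp (-l * (Real.sqrt n - Real.sqrt M)) ≤ 1 := by
        rw [Real.exp_le_one_iff]
        have : Real.sqrt M ≤ Real.sqrt n := Real.sqrt_le_sqrt (by exact_mod_cast h)
        nlinarith
      linarith
    · linarith [Real.exp_pos (-l * (Real.sqrt M - Real.sqrt n))]
  have h2 : 0 ≤ sqrtExpPrimitive l n 0 := by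
    rw [sqrtExpPrimitive, if_pos (Nat.zero_le _)]
    positivity
  calc 2 * (1 + l) / l * (sqrtExpPrimitive l n M - sqrtExpPrimitive l n 0)
      ≤ 2 * (1 + l) / l * 2 := by gcongr; linarith
    _ = 4 * (1 + l) / l := by ring

theorem sqrt_succ_le_add_abs (n m : ℕ) :
    Real.sqrt (m + 1) ≤ Real.sqrt (n + 1) + |Real.sqrt n - Real.sqrt m| := by
  rcases le_total m n with h | h
  · have h1 : Real.sqrt ((m : ℝ) + 1) ≤ Real.sqrt (n + 1) :=
      Real.sqrt_le_sqrt (by have : (m : ℝ) ≤ n := by exact_mod_cast h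
                            linarith)
    linarith [abs_nonneg (Real.sqrt n - Real.sqrt m)]
  · have hnm : (n : ℝ) ≤ m := by exact_mod_cast h
    have h0 : Real.sqrt n ≤ Real.sqrt m := Real.sqrt_le_sqrt hnm
    rw [abs_sub_comm, abs_of_nonneg (by linarith)]
    have a1 := Real.mul_self_sqrt (Nat.cast_nonneg (α := ℝ) n)
    have a2 := Real.mul_self_sqrt (Nat.cast_nonneg (α := ℝ) m)
    have a3 := Real.mul_self_sqrt (by positivity : (0 : ℝ) ≤ (n : ℝ) + 1)
    have b1 := Real.sqrt_nonneg (n : ℝ)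
    have b3 := Real.sqrt_nonneg ((n : ℝ) + 1)
    have b4 : Real.sqrt (n : ℝ) ≤ Real.sqrt (n + 1) := Real.sqrt_le_sqrt (by linarith)
    refine Real.sqrt_le_iff.mpr ⟨by linarith, ?_⟩
    nlinarith

/-- Half of the exponential pays for the missing factor 1/√(m+1): with r = |√n - √m| one has √(m+1)
≤ √(n+1) + r and r e^{-μr} ≤ 1/μ. The growth √(n+1) reflects that about √n integers m lie within
distance 1 of n in the square-root metric. -/
theorem tsum_sqrtExp_le {μ : ℝ} (hμ : 0 < μ) (n : ℕ) :
    ∑' m : ℕ, ENNReal.ofReal (Real.exp (-(2 * μ) * |Real.sqrt n - Real.sqrt m|)) ≤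
      ENNReal.ofReal (4 * (1 + μ) ^ 2 / μ ^ 2 * Real.sqrt (n + 1)) := by
  have hpt : ∀ m : ℕ, Real.exp (-(2 * μ) * |Real.sqrt n - Real.sqrt m|) ≤
      (Real.sqrt (n + 1) + 1 / μ) *
        (Real.exp (-μ * |Real.sqrt n - Real.sqrt m|) / Real.sqrt (m + 1)) := fun m => by
    have hs : 0 < Real.sqrt ((m : ℝ) + 1) := Real.sqrt_pos.mpr (by positivity)
    rw [← mul_div_assoc, le_div_iff₀ hs]
    set r := |Real.sqrt n - Real.sqrt m| with hr
    have hr0 : 0 ≤ r := abs_nonneg _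
    have h1 := sqrt_succ_le_add_abs n m
    have e : Real.exp (-(2 * μ) * r) = Real.exp (-μ * r) * Real.exp (-μ * r) := by
      rw [← Real.exp_add]; ring_nf
    have h2 : Real.exp (-μ * r) ≤ 1 := Real.exp_le_one_iff.mpr (by nlinarith)
    have h3 : Real.exp (-μ * r) * r ≤ 1 / μ := by
      have h4 := Real.add_one_le_exp (μ * r)
      have e2 : Real.exp (-μ * r) * Real.exp (μ * r) = 1 := by
        rw [← Real.exp_add]; simp
      rw [le_div_iff₀ hμ]
      nlinarith [Real.exp_pos (-μ * r)]
    have h5 := Real.sqrt_nonneg ((n : ℝ) + 1)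
    have h6 : Real.exp (-μ * r) * Real.sqrt (m + 1) ≤ Real.sqrt (n + 1) + 1 / μ := by
      have := mul_le_mul_of_nonneg_left h1 (Real.exp_pos (-μ * r)).le
      nlinarith
    rw [e]
    nlinarith [Real.exp_pos (-μ * r)]
  calc ∑' m : ℕ, ENNReal.ofReal (Real.exp (-(2 * μ) * |Real.sqrt n - Real.sqrt m|))
      ≤ ∑' m : ℕ, ENNReal.ofReal (Real.sqrt (n + 1) + 1 / μ) * ENNReal.ofReal
        (Real.exp (-μ * |Real.sqrt n - Real.sqrt m|) / Real.sqrt (m + 1)) :=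
        ENNReal.tsum_le_tsum fun m => by
          rw [← ENNReal.ofReal_mul (by positivity)]
          exact ENNReal.ofReal_le_ofReal (hpt m)
    _ ≤ ENNReal.ofReal (Real.sqrt (n + 1) + 1 / μ) * ENNReal.ofReal (4 * (1 + μ) / μ) := by
        rw [ENNReal.tsum_mul_left]
        gcongr
        exact tsum_sqrtExp_div_le hμ n
    _ ≤ _ := by
        rw [← ENNReal.ofReal_mul (by positivity)]
        refine ENNReal.ofReal_le_ofReal ?_
        have h6 : 1 ≤ Real.sqrt ((n : ℝ) + 1) :=
          Real.one_le_sqrt.mpr (by linarith [Nat.cast_nonneg (α := ℝ) n])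
        have e : 4 * (1 + μ) ^ 2 / μ ^ 2 * Real.sqrt (n + 1) =
            (Real.sqrt (n + 1) + 1 / μ * Real.sqrt (n + 1)) * (4 * (1 + μ) / μ) := by
          field_simp
          ring
        rw [e]
        gcongr
        exact le_mul_of_one_le_right (by positivity) h6

/-! ### Weighted sums of displacement matrix elements -/

/-- `|⟨n| D(β) |m⟩| e^{μ |√n - √m|}`. -/
noncomputable def weightedDisplacement (β : ℂ) (μ : ℝ) (n m : ℕ) : ℝ :=
  ‖displacement β n m‖ * Real.exp (μ * |Real.sqrt n - Real.sqrt m|)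

theorem weightedDisplacement_nonneg (β : ℂ) (μ : ℝ) (n m : ℕ) :
    0 ≤ weightedDisplacement β μ n m := by
  rw [weightedDisplacement]; positivity

theorem weightedDisplacement_comm (β : ℂ) (μ : ℝ) (n m : ℕ) :
    weightedDisplacement β μ n m = weightedDisplacement β μ m n := by
  rw [weightedDisplacement, weightedDisplacement, norm_displacement_comm, abs_sub_comm]

/-- Cauchy–Schwarz after writing e^{μr} = e^{2μr} e^{-μr}. The square of the first factor is the
weight e^{4μr} in `displacementSum`. -/
theorem sq_tsum_weightedDisplacement_mul_le (β : ℂ) (μ : ℝ) (n : ℕ) (w : ℕ → ℝ)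
    (hw : ∀ m, 0 ≤ w m) :
    (∑' m, ENNReal.ofReal (weightedDisplacement β μ n m * w m)) ^ 2 ≤
      displacementSum β μ * ∑' m : ℕ, ENNReal.ofReal
        (Real.exp (-(2 * μ) * |Real.sqrt n - Real.sqrt m|) * w m ^ 2) := by
  have e : ∀ m : ℕ, ENNReal.ofReal (weightedDisplacement β μ n m * w m) =
      ENNReal.ofReal (‖displacement β n m‖ * Real.exp (2 * μ * |Real.sqrt n - Real.sqrt m|)) *
        ENNReal.ofReal (Real.exp (-μ * |Real.sqrt n - Real.sqrt m|) * w m) := fun m => by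
    rw [← ENNReal.ofReal_mul (by positivity), weightedDisplacement]
    congr 1
    have : Real.exp (μ * |Real.sqrt n - Real.sqrt m|) =
        Real.exp (2 * μ * |Real.sqrt n - Real.sqrt m|) *
          Real.exp (-μ * |Real.sqrt n - Real.sqrt m|) := by
      rw [← Real.exp_add]; ring_nf
    rw [this]
    ring
  simp only [e]
  refine (sq_tsum_mul_le _ _).trans (mul_le_mul' ?_ ?_)
  · refine le_trans (le_of_eq (tsum_congr fun m => ?_))
      (le_iSup (fun n : ℕ => ∑' m : ℕ, ENNReal.ofReal
        (‖displacement β n m‖ ^ 2 * Real.exp (4 * μ * |Real.sqrt n - Real.sqrt m|))) n)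
    rw [← ENNReal.ofReal_pow (by positivity), mul_pow, ← Real.exp_nat_mul]
    congr 3
    push_cast
    ring
  · refine le_of_eq (tsum_congr fun m => ?_)
    rw [← ENNReal.ofReal_pow (mul_nonneg (Real.exp_pos _).le (hw m)), mul_pow, ← Real.exp_nat_mul]
    congr 3
    push_cast
    ring

theorem sq_tsum_weightedDisplacement_le (β : ℂ) {μ : ℝ} (hμ : 0 < μ) (n : ℕ) :
    (∑' m, ENNReal.ofReal (weightedDisplacement β μ n m)) ^ 2 ≤
      displacementSum β μ * ENNReal.ofReal (4 * (1 + μ) ^ 2 / μ ^ 2 * Real.sqrt (n + 1)) := by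
  have h := sq_tsum_weightedDisplacement_mul_le β μ n (fun _ => 1) fun _ => zero_le_one
  simp only [mul_one, one_pow] at h
  exact h.trans (mul_le_mul_right (tsum_sqrtExp_le hμ n) _)

/-- The fourth root becomes 1/√(m+1) after squaring, which removes the growth in n. The constant is
enlarged to agree with `sq_tsum_weightedDisplacement_le`, so that rows and columns share one Schur
constant. -/
theorem sq_tsum_weightedDisplacement_div_le (β : ℂ) {μ : ℝ} (hμ : 0 < μ) (n : ℕ) :
    (∑' m : ℕ, ENNReal.ofReal
      (weightedDisplacement β μ n m * (1 / Real.sqrt (Real.sqrt (m + 1))))) ^ 2 ≤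
      displacementSum β μ * ENNReal.ofReal (4 * (1 + μ) ^ 2 / μ ^ 2) := by
  have h := sq_tsum_weightedDisplacement_mul_le β μ n
    (fun m => 1 / Real.sqrt (Real.sqrt (m + 1))) fun _ => by positivity
  refine h.trans (mul_le_mul_right (le_trans (le_of_eq (tsum_congr fun m => ?_))
    ((tsum_sqrtExp_div_le (by positivity : 0 < 2 * μ) n).trans
      (ENNReal.ofReal_le_ofReal ?_))) _)
  · rw [div_pow, Real.sq_sqrt (Real.sqrt_nonneg _), one_pow, mul_one_div]
  · rw [div_le_div_iff₀ (by positivity) (by positivity)]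
    nlinarith [pow_pos hμ 2, pow_pos hμ 3]

/-! ### Coordinates in a Hilbert basis -/

section HilbertBasis

variable {ι E : Type*} [NormedAddCommGroup E] [InnerProductSpace ℂ E]

theorem memℓp_two_of_norm_le {f g : ι → ℂ} (hf : Memℓp f 2) (C : ℝ)
    (h : ∀ a, ‖g a‖ ≤ C * ‖f a‖) : Memℓp g 2 := by
  rw [memℓp_two_iff] at hf ⊢
  refine Summable.of_nonneg_of_le (fun a => by positivity) (fun a => ?_) (hf.mul_left (C ^ 2))
  rw [← mul_pow]
  exact pow_le_pow_left₀ (norm_nonneg _) (h a) 2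

theorem exists_repr_eq (e : HilbertBasis ι ℂ E) {f : ι → ℂ} (hf : Memℓp f 2) :
    ∃ ψ : E, ∀ a, e.repr ψ a = f a :=
  ⟨e.repr.symm ⟨f, hf⟩, fun a => by simp⟩

theorem ext_repr (e : HilbertBasis ι ℂ E) {ψ φ : E} (h : ∀ a, e.repr ψ a = e.repr φ a) : ψ = φ :=
  e.repr.injective (lp.ext (funext h))

theorem repr_memℓp (e : HilbertBasis ι ℂ E) (ψ : E) : Memℓp (fun a => e.repr ψ a) 2 :=
  (e.repr ψ).2

theorem norm_sq_eq_tsum_repr (e : HilbertBasis ι ℂ E) (ψ : E) :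
    ‖ψ‖ ^ 2 = ∑' a, ‖e.repr ψ a‖ ^ 2 := by
  rw [← e.repr.norm_map, lp_norm_sq]

theorem norm_le_of_repr_le (e : HilbertBasis ι ℂ E) {ψ φ : E} {C : ℝ} (hC : 0 ≤ C)
    (h : ∀ a, ‖e.repr ψ a‖ ≤ C * ‖e.repr φ a‖) : ‖ψ‖ ≤ C * ‖φ‖ := by
  refine (abs_le_of_sq_le_sq' ?_ (by positivity)).2
  have hφ := (memℓp_two_iff _).mp (repr_memℓp e φ)
  have hψ := (memℓp_two_iff _).mp (repr_memℓp e ψ)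
  rw [mul_pow, norm_sq_eq_tsum_repr e, norm_sq_eq_tsum_repr e, ← tsum_mul_left]
  refine hψ.tsum_le_tsum (fun a => ?_) (hφ.mul_left _)
  rw [← mul_pow]
  exact pow_le_pow_left₀ (norm_nonneg _) (h a) 2

theorem enorm_sq_eq_tsum_repr (e : HilbertBasis ι ℂ E) (ψ : E) :
    ‖ψ‖ₑ ^ 2 = ∑' a, ‖e.repr ψ a‖ₑ ^ 2 := by
  have hψ := (memℓp_two_iff _).mp (repr_memℓp e ψ)
  have h : ∀ x : ℂ, ‖x‖ₑ ^ 2 = ENNReal.ofReal (‖x‖ ^ 2) := fun x => by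
    rw [ENNReal.ofReal_pow (norm_nonneg _), ofReal_norm]
  simp only [h]
  rw [← ENNReal.ofReal_tsum_of_nonneg (fun _ => by positivity) hψ, ← norm_sq_eq_tsum_repr,
    ENNReal.ofReal_pow (norm_nonneg _), ofReal_norm]

/-- The operator acting diagonally in a Hilbert basis, with bounded diagonal entries. -/
theorem exists_diagonal (e : HilbertBasis ι ℂ E) (w : ι → ℂ) {C : ℝ} (hC : 0 ≤ C)
    (hw : ∀ a, ‖w a‖ ≤ C) :
    ∃ G : E →L[ℂ] E, ∀ ψ a, e.repr (G ψ) a = w a * e.repr ψ a := by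
  have hm : ∀ ψ, ∃ φ : E, ∀ a, e.repr φ a = w a * e.repr ψ a := fun ψ =>
    exists_repr_eq e (memℓp_two_of_norm_le (repr_memℓp e ψ) C fun a => by
      rw [norm_mul]
      exact mul_le_mul_of_nonneg_right (hw a) (norm_nonneg _))
  choose G hG using hm
  refine ⟨LinearMap.mkContinuous
    { toFun := G
      map_add' := fun ψ φ => ext_repr e fun a => ?_
      map_smul' := fun c ψ => ext_repr e fun a => ?_ } C fun ψ => ?_, fun ψ a => hG ψ a⟩
  · rw [hG, map_add, map_add, lp.coeFn_add, lp.coeFn_add, Pi.add_apply, Pi.add_apply, hG, hG,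
      mul_add]
  · rw [hG, RingHom.id_apply, map_smul, map_smul, lp.coeFn_smul, lp.coeFn_smul, Pi.smul_apply,
      Pi.smul_apply, hG, smul_eq_mul, smul_eq_mul, mul_left_comm]
  · refine norm_le_of_repr_le e hC fun a => ?_
    change ‖e.repr (G ψ) a‖ ≤ _
    rw [hG, norm_mul]
    exact mul_le_mul_of_nonneg_right (hw a) (norm_nonneg _)

/-! ### Resolvents -/

theorem IsResolvent.unique {T : E →ₗ.[ℂ] E} {z : ℂ} {R R' : E →L[ℂ] E}
    (h : IsResolvent T z R) (h' : IsResolvent T z R') : R = R' := by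
  ext f
  obtain ⟨hd, hf⟩ := h.1 f
  have := h'.2 ⟨R f, hd⟩
  rw [hf] at this
  exact this.symm

/-- The operator `T` is `ω N + B` in the basis `e`, with `N` diagonal and `B` bounded, on the
domain of `N`. -/
structure IsDiagonalPlusBounded (T : E →ₗ.[ℂ] E) (e : HilbertBasis ι ℂ E) (ω : ℝ) (N : ι → ℕ)
    (B : E →L[ℂ] E) : Prop where
  mem_domain_iff : ∀ ψ, ψ ∈ T.domain ↔ Memℓp (fun a => (N a : ℂ) * e.repr ψ a) 2
  repr_apply : ∀ (ψ : T.domain) (a : ι),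
    e.repr (T ψ) a = (ω * N a : ℂ) * e.repr ψ a + e.repr (B ψ) a

variable {T : E →ₗ.[ℂ] E} {e : HilbertBasis ι ℂ E} {ω : ℝ} {N : ι → ℕ} {B : E →L[ℂ] E}

theorem norm_le_div_one_sub_of_le_add {x y t : ℝ} (ht : t < 1) (h : x ≤ y + t * x) :
    x ≤ y / (1 - t) := by
  rw [le_div_iff₀ (by linarith)]
  linarith

/-- The resolvent by a Neumann series, at points far from the spectrum of `ω N`. -/
theorem IsDiagonalPlusBounded.exists_isResolvent [CompleteSpace E]
    (hT : IsDiagonalPlusBounded T e ω N B)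
    (hω : 0 < ω) {z s : ℂ} {η κ : ℝ} (hη : ∀ a, η ≤ ‖(ω * N a : ℂ) - z‖)
    (hκ0 : 0 ≤ κ) (hκη : κ < η) (hB : ∀ ψ, ‖B ψ - s • ψ‖ ≤ κ * ‖ψ‖) :
    ∃ R : E →L[ℂ] E, IsResolvent T (z + s) R ∧
      ∀ y : ℝ, 0 < y → (∀ a, y ≤ ‖(ω * N a : ℂ) - z‖) → y * ‖R‖ ≤ η / (η - κ) := by
  have hη0 : 0 < η := hκ0.trans_lt hκη
  have hne : ∀ a, (ω * N a : ℂ) - z ≠ 0 := fun a => norm_pos_iff.mp (hη0.trans_le (hη a))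
  have hωc : (ω : ℂ) ≠ 0 := by exact_mod_cast hω.ne'
  obtain ⟨G, hG⟩ := exists_diagonal e (fun a => ((ω * N a : ℂ) - z)⁻¹) (inv_nonneg.mpr hη0.le)
    fun a => by rw [norm_inv]; exact inv_anti₀ hη0 (hη a)
  have hGn : ∀ y : ℝ, 0 < y → (∀ a, y ≤ ‖(ω * N a : ℂ) - z‖) → ∀ ψ, ‖G ψ‖ ≤ y⁻¹ * ‖ψ‖ :=
    fun y hy hya ψ => norm_le_of_repr_le e (inv_nonneg.mpr hy.le) fun a => by
      rw [hG, norm_mul, norm_inv]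
      exact mul_le_mul_of_nonneg_right (inv_anti₀ hy (hya a)) (norm_nonneg _)
  -- `G` is the resolvent of ωN at z, and ωN G g = g + z G g is square summable.
  have hGd : ∀ g, G g ∈ T.domain := fun g => by
    rw [hT.mem_domain_iff]
    have h := ((repr_memℓp e g).add ((repr_memℓp e (G g)).const_mul z)).const_mul (ω : ℂ)⁻¹
    have e1 : (fun a => (N a : ℂ) * e.repr (G g) a) =
        fun a => (ω : ℂ)⁻¹ * (e.repr g a + z * e.repr (G g) a) := by
      funext a
      rw [hG]
      linear_combination ((ω : ℂ)⁻¹ * e.repr g a) * inv_mul_cancel₀ (hne a) -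
        ((N a : ℂ) * ((ω * N a : ℂ) - z)⁻¹ * e.repr g a) * inv_mul_cancel₀ hωc
    rw [e1]
    exact h
  -- On ran G one has T - (z + s) = (1 - K) G⁻¹, so the resolvent is G (1 - K)⁻¹; ‖K‖ ≤ κ/η < 1.
  set K : E →L[ℂ] E := -((B - s • ContinuousLinearMap.id ℂ E) ∘L G) with hK
  have hKapp : ∀ g, K g = -(B (G g) - s • G g) := fun g => rfl
  have hKn : ∀ g, ‖K g‖ ≤ κ / η * ‖g‖ := fun g => by
    rw [hKapp, norm_neg]
    refine (hB _).trans ?_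
    rw [div_eq_mul_inv, mul_assoc]
    exact mul_le_mul_of_nonneg_left (hGn η hη0 hη g) hκ0
  have ht1 : κ / η < 1 := (div_lt_one hη0).mpr hκη
  have hKlt : ‖K‖ < 1 := (ContinuousLinearMap.opNorm_le_bound _ (by positivity) hKn).trans_lt ht1
  set U := Units.oneSub K hKlt with hU
  have hUapp : ∀ g, (U : E →L[ℂ] E) g = g + (B (G g) - s • G g) := fun g => by
    rw [hU, Units.val_oneSub, sub_eq_add_neg]
    change g + -(K g) = _
    rw [hKapp, neg_neg]
  have hUinv : ∀ f, (U : E →L[ℂ] E) ((↑U⁻¹ : E →L[ℂ] E) f) = f := fun f => by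
    have := congrArg (fun A : E →L[ℂ] E => A f) U.mul_inv
    exact this
  have hinvU : ∀ f, (↑U⁻¹ : E →L[ℂ] E) ((U : E →L[ℂ] E) f) = f := fun f => by
    have := congrArg (fun A : E →L[ℂ] E => A f) U.inv_mul
    exact this
  have hcoord : ∀ (ψ : T.domain) (g : E), (∀ a, e.repr g a = ((ω * N a : ℂ) - z) * e.repr ψ a) →
      T ψ - (z + s) • (ψ : E) = g + (B ψ - s • (ψ : E)) := fun ψ g hg => ext_repr e fun a => by
    simp only [map_sub, map_add, map_smul, lp.coeFn_sub, lp.coeFn_add, lp.coeFn_smul,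
      Pi.sub_apply, Pi.add_apply, Pi.smul_apply, smul_eq_mul, hT.repr_apply, hg]
    ring
  refine ⟨G ∘L (↑U⁻¹ : E →L[ℂ] E), ⟨fun f => ⟨hGd _, ?_⟩, fun ψ => ?_⟩, fun y hy hya => ?_⟩
  · set g := (↑U⁻¹ : E →L[ℂ] E) f with hg
    have h := hcoord ⟨G g, hGd g⟩ g fun a => by
      change _ = _ * e.repr (G g) a
      rw [hG, mul_inv_cancel_left₀ (hne a)]
    refine h.trans ?_
    change g + (B (G g) - s • G g) = f
    rw [← hUapp, hg, hUinv]
  · have hm : Memℓp (fun a => ((ω * N a : ℂ) - z) * e.repr ψ a) 2 := by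
      have h := (((hT.mem_domain_iff ψ).mp ψ.2).const_mul (ω : ℂ)).sub
        ((repr_memℓp e ψ).const_mul z)
      have e1 : (fun a => ((ω * N a : ℂ) - z) * e.repr ψ a) =
          fun a => ω * ((N a : ℂ) * e.repr ψ a) - z * e.repr ψ a := by
        funext a; ring
      rw [e1]
      exact h
    obtain ⟨g, hg⟩ := exists_repr_eq e hm
    have hGg : G g = ψ := ext_repr e fun a => by
      rw [hG, hg, inv_mul_cancel_left₀ (hne a)]
    rw [hcoord ψ g hg, ← hGg, ← hUapp]
    change G ((↑U⁻¹ : E →L[ℂ] E) _) = _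
    rw [hinvU]
  · rw [← le_div_iff₀' hy]
    refine ContinuousLinearMap.opNorm_le_bound _
      (div_nonneg (div_nonneg hη0.le (by linarith)) hy.le) fun f => ?_
    set g := (↑U⁻¹ : E →L[ℂ] E) f with hg
    have h1 : ‖g‖ ≤ ‖f‖ + κ / η * ‖g‖ := by
      have h2 : g = f + K g := by
        have := hUinv f
        rw [← hg, hUapp] at this
        rw [hKapp, ← this]
        abel
      calc ‖g‖ = ‖f + K g‖ := by rw [← h2]
        _ ≤ ‖f‖ + ‖K g‖ := norm_add_le _ _
        _ ≤ _ := by gcongr; exact hKn g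
    have h3 := norm_le_div_one_sub_of_le_add ht1 h1
    have e2 : ‖f‖ / (1 - κ / η) = η / (η - κ) * ‖f‖ := by
      have : η - κ ≠ 0 := by linarith
      have : 1 - κ / η ≠ 0 := by linarith
      field_simp
    rw [e2] at h3
    calc ‖G g‖ ≤ y⁻¹ * ‖g‖ := hGn y hy hya g
      _ ≤ y⁻¹ * (η / (η - κ) * ‖f‖) := by gcongr
      _ = _ := by ring

/-! ### The Combes–Thomas estimate for a diagonal plus a bounded operator -/

theorem repr_apply_hasSum (e : HilbertBasis ι ℂ E) (B : E →L[ℂ] E) (ψ : E) (a : ι) :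
    HasSum (fun b => inner ℂ (e a) (B (e b)) * e.repr ψ b) (e.repr (B ψ) a) := by
  have h := ((innerSL ℂ (e a)) ∘L B).hasSum (e.hasSum_repr ψ)
  rw [e.repr_apply_apply]
  refine h.congr_fun fun b => ?_
  simp [mul_comm]

/-- Positivity of B gives ω⟨φ, Nφ⟩ ≤ Re⟨φ, Tφ⟩ ≤ ‖φ‖‖Tφ‖. This is what pays for the weight √(N+1) in
the Schur test. -/
theorem IsDiagonalPlusBounded.energy_le (hT : IsDiagonalPlusBounded T e ω N B) (hω : 0 < ω)
    (hpos : ∀ ψ, 0 ≤ (inner ℂ ψ (B ψ) : ℂ).re) (φ : T.domain) :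
    Summable (fun a => ((N a : ℝ) + 1) * ‖e.repr φ a‖ ^ 2) ∧
      ω * Real.sqrt (∑' a, ((N a : ℝ) + 1) * ‖e.repr φ a‖ ^ 2) ≤
        (‖T φ‖ + 2 * ω * ‖(φ : E)‖) / 2 := by
  have hs1 := (summable_conj_mul (repr_memℓp e φ) ((hT.mem_domain_iff φ).mp φ.2)).hasSum
  have e1 : ∀ a, conj (e.repr φ a) * ((N a : ℂ) * e.repr φ a) =
      (((N a : ℝ) * ‖e.repr φ a‖ ^ 2 : ℝ) : ℂ) := fun a => by
    have := Complex.mul_conj (e.repr φ a)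
    rw [Complex.normSq_eq_norm_sq] at this
    push_cast at this ⊢
    linear_combination (N a : ℂ) * this
  simp only [e1] at hs1
  have hsN : Summable (fun a => (N a : ℝ) * ‖e.repr φ a‖ ^ 2) := by
    exact_mod_cast hs1.summable
  have hsφ := (memℓp_two_iff _).mp (repr_memℓp e φ)
  have hsum : Summable (fun a => ((N a : ℝ) + 1) * ‖e.repr φ a‖ ^ 2) :=
    (hsN.add hsφ).congr fun a => by ring
  refine ⟨hsum, ?_⟩
  set En := ∑' a, ((N a : ℝ) + 1) * ‖e.repr φ a‖ ^ 2 with hEn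
  have hEn0 : 0 ≤ En := tsum_nonneg fun a => by positivity
  have hEn' : En = ∑' a, (N a : ℝ) * ‖e.repr φ a‖ ^ 2 + ‖(φ : E)‖ ^ 2 := by
    rw [norm_sq_eq_tsum_repr e, ← hsN.tsum_add hsφ, hEn]
    exact tsum_congr fun a => by ring
  have hin : (inner ℂ (φ : E) (T φ) : ℂ) =
      ((ω * ∑' a, (N a : ℝ) * ‖e.repr φ a‖ ^ 2 : ℝ) : ℂ) + inner ℂ (φ : E) (B φ) := by
    rw [← e.repr.inner_map_map, ← e.repr.inner_map_map (φ : E) (B φ)]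
    have h1 := lp_hasSum_inner (e.repr φ) (e.repr (T φ))
    have h2 := lp_hasSum_inner (e.repr φ) (e.repr (B φ))
    have h3 := (Complex.hasSum_ofReal.mpr hsN.hasSum).mul_left (ω : ℂ)
    refine h1.unique ?_
    push_cast at h3 ⊢
    refine (h3.add h2).congr_fun fun a => ?_
    have := e1 a
    push_cast at this
    rw [hT.repr_apply, ← this]
    ring
  have h1 : ω * En ≤ ‖(φ : E)‖ * (‖T φ‖ + ω * ‖(φ : E)‖) := by
    have h2 : (inner ℂ (φ : E) (T φ) : ℂ).re ≤ ‖(φ : E)‖ * ‖T φ‖ :=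
      (Complex.re_le_norm _).trans (norm_inner_le_norm _ _)
    rw [hin, Complex.add_re, Complex.ofReal_re] at h2
    have := hpos φ
    rw [hEn']
    nlinarith
  have h3 := norm_nonneg (φ : E)
  have h4 := norm_nonneg (T φ)
  -- With x = ω‖φ‖ and t = ‖Tφ‖ the energy bound reads ω²·`En` ≤ x(t + x) ≤ ((t + 2x)/2)².
  refine (abs_le_of_sq_le_sq' ?_ (by positivity)).2
  rw [mul_pow, Real.sq_sqrt hEn0]
  nlinarith [sq_nonneg (‖T φ‖), mul_le_mul_of_nonneg_left h1 hω.le]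

/-- The Combes–Thomas argument without conjugating T: φ = gRf solves (T - z)φ = f + q with q the
commutator of B and g applied to Rf. The Schur test and the energy bound give ‖q‖ ≤ θ‖(T - z)φ‖,
hence ‖(T - z)φ‖ ≤ ‖f‖/(1 - θ). Boundedness of g keeps φ in the domain. -/
theorem IsDiagonalPlusBounded.weighted_resolvent (hT : IsDiagonalPlusBounded T e ω N B)
    (hω : 0 < ω) (hpos : ∀ ψ, 0 ≤ (inner ℂ ψ (B ψ) : ℂ).re) {z : ℂ} {R : E →L[ℂ] E}
    (hR : IsResolvent T z R) {g : ι → ℝ} {C : ℝ} (hg0 : ∀ a, 0 < g a) (hgC : ∀ a, g a ≤ C)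
    {k : ι → ι → ℝ≥0∞}
    (hk : ∀ a b, ‖inner ℂ (e a) (B (e b)) * ((1 - g a / g b : ℝ) : ℂ)‖ₑ ≤ k a b)
    {A : ℝ} (hA : 0 ≤ A)
    (hrow : ∀ a, ∑' b, k a b * (ENNReal.ofReal (Real.sqrt (N b + 1)))⁻¹ ≤ ENNReal.ofReal A)
    (hcol : ∀ b, ∑' a, k a b ≤ ENNReal.ofReal A * ENNReal.ofReal (Real.sqrt (N b + 1)))
    {θ : ℝ} (hθ1 : θ < 1) (hθ : A * resolventSize ω z R ≤ 2 * ω * θ)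
    (f : E) (hf : ∀ a, e.repr f a ≠ 0 → g a = 1) :
    ∃ φ : E, (∀ a, e.repr φ a = g a * e.repr (R f) a) ∧ ‖φ‖ ≤ ‖R‖ / (1 - θ) * ‖f‖ := by
  obtain ⟨hψd, hψ⟩ := hR.1 f
  set ψ := R f with hψdef
  have hgn : ∀ a, ‖(g a : ℂ)‖ ≤ C := fun a => by
    rw [Complex.norm_real, Real.norm_of_nonneg (hg0 a).le]; exact hgC a
  obtain ⟨φ, hφ⟩ := exists_repr_eq e (f := fun a => (g a : ℂ) * e.repr ψ a)
    (memℓp_two_of_norm_le (repr_memℓp e ψ) C fun a => by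
      rw [norm_mul]
      exact mul_le_mul_of_nonneg_right (hgn a) (norm_nonneg _))
  have hφd : φ ∈ T.domain := by
    rw [hT.mem_domain_iff]
    refine memℓp_two_of_norm_le ((hT.mem_domain_iff ψ).mp hψd) C fun a => ?_
    rw [hφ, mul_left_comm, norm_mul]
    exact mul_le_mul_of_nonneg_right (hgn a) (norm_nonneg _)
  set G := T ⟨φ, hφd⟩ - z • φ with hG
  set q := G - f with hq
  have hRG : R G = φ := hR.2 ⟨φ, hφd⟩
  have hfa : ∀ a, e.repr f a = (ω * N a : ℂ) * e.repr ψ a + e.repr (B ψ) a - z * e.repr ψ a :=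
    fun a => by
      have := hT.repr_apply ⟨ψ, hψd⟩ a
      rw [← this]
      nth_rewrite 1 [← hψ]
      rw [map_sub, map_smul]
      rfl
  -- The terms ωN and z commute with the weight, and gf = f because g = 1 on the support of f.
  have hqa : ∀ a, e.repr q a = e.repr (B φ) a - g a * e.repr (B ψ) a := fun a => by
    have h1 : (g a : ℂ) * e.repr f a = e.repr f a := by
      by_cases h : e.repr f a = 0
      · rw [h, mul_zero]
      · rw [hf a h, Complex.ofReal_one, one_mul]
    have h2 := hT.repr_apply ⟨φ, hφd⟩ a
    have h3 : e.repr q a = e.repr (T ⟨φ, hφd⟩) a - z * e.repr φ a - e.repr f a := by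
      rw [hq, hG, map_sub, map_sub, map_smul]; rfl
    rw [h3, h2, ← h1, hfa, hφ]
    ring
  have hqk : ∀ a, ‖e.repr q a‖ₑ ≤ ∑' b, k a b * ‖e.repr φ b‖ₑ := fun a => by
    have h1 := (repr_apply_hasSum e B φ a).sub ((repr_apply_hasSum e B ψ a).mul_left (g a : ℂ))
    rw [← hqa] at h1
    rw [← h1.tsum_eq]
    refine enorm_tsum_le_tsum_enorm.trans (ENNReal.tsum_le_tsum fun b => ?_)
    have hgb : (g b : ℂ) ≠ 0 := by exact_mod_cast (hg0 b).ne'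
    have e1 : inner ℂ (e a) (B (e b)) * e.repr φ b -
        g a * (inner ℂ (e a) (B (e b)) * e.repr ψ b) =
        inner ℂ (e a) (B (e b)) * ((1 - g a / g b : ℝ) : ℂ) * e.repr φ b := by
      rw [hφ]
      push_cast
      linear_combination (inner ℂ (e a) (B (e b)) * e.repr ψ b) *
        div_mul_cancel₀ (g a : ℂ) hgb
    rw [e1, enorm_mul]
    exact mul_le_mul_left (hk a b) _
  obtain ⟨hsum, hen⟩ := hT.energy_le hω hpos ⟨φ, hφd⟩
  set En := ∑' a, ((N a : ℝ) + 1) * ‖e.repr φ a‖ ^ 2 with hEn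
  have hEn0 : 0 ≤ En := tsum_nonneg fun a => by positivity
  have hqn : ‖q‖ ≤ A * Real.sqrt En := by
    have h1 : ‖q‖ₑ ^ 2 ≤ ENNReal.ofReal (A * A * En) := by
      rw [enorm_sq_eq_tsum_repr e]
      refine (ENNReal.tsum_le_tsum fun a => pow_le_pow_left' (hqk a) 2).trans ?_
      refine (tsum_sq_tsum_mul_le k (fun b => ?_) (fun b => ENNReal.ofReal_ne_top)
        hrow hcol _).trans_eq ?_
      · exact (ENNReal.ofReal_pos.mpr (Real.sqrt_pos.mpr (by positivity))).ne'
      · rw [ENNReal.ofReal_mul (by positivity), ENNReal.ofReal_mul hA, hEn,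
          ENNReal.ofReal_tsum_of_nonneg (fun a => by positivity) hsum]
        congr 1
        refine tsum_congr fun b => ?_
        rw [← ofReal_norm, ← ENNReal.ofReal_mul (by positivity),
          ← ENNReal.ofReal_pow (by positivity), mul_pow, Real.sq_sqrt (by positivity)]
    rw [← ofReal_norm, ← ENNReal.ofReal_pow (norm_nonneg _),
      ENNReal.ofReal_le_ofReal_iff (by positivity)] at h1
    refine (abs_le_of_sq_le_sq' ?_ (by positivity)).2
    rw [mul_pow, Real.sq_sqrt hEn0]
    linarith
  -- With `G = (T - z)φ` one has φ = R G and Tφ = (1 + zR)G.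
  have hsize : ‖T ⟨φ, hφd⟩‖ + 2 * ω * ‖φ‖ ≤ resolventSize ω z R * ‖G‖ := by
    have h1 : T ⟨φ, hφd⟩ = (ContinuousLinearMap.id ℂ E + z • R) G := by
      change _ = G + z • R G
      rw [hRG, hG]
      abel
    have h2 : ‖φ‖ ≤ ‖R‖ * ‖G‖ := by
      rw [← hRG]; exact R.le_opNorm G
    have h3 : ‖T ⟨φ, hφd⟩‖ ≤ ‖ContinuousLinearMap.id ℂ E + z • R‖ * ‖G‖ := by
      rw [h1]; exact ContinuousLinearMap.le_opNorm _ _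
    have h4 : 0 ≤ ω * (‖R‖ * ‖G‖) := by positivity
    rw [resolventSize]
    nlinarith
  have hGn : ‖G‖ ≤ ‖f‖ + θ * ‖G‖ := by
    have h1 : G = f + q := by rw [hq]; abel
    have h2 : ‖q‖ ≤ θ * ‖G‖ := by
      have h3 : 2 * ω * ‖q‖ ≤ 2 * ω * (θ * ‖G‖) := by
        calc 2 * ω * ‖q‖ ≤ 2 * ω * (A * Real.sqrt En) := by gcongr
          _ = A * (2 * (ω * Real.sqrt En)) := by ring
          _ ≤ A * (resolventSize ω z R * ‖G‖) := by
              refine mul_le_mul_of_nonneg_left ?_ hA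
              have : 2 * (ω * Real.sqrt En) ≤ ‖T ⟨φ, hφd⟩‖ + 2 * ω * ‖φ‖ := by
                have := hen
                simp only at this
                linarith
              exact this.trans hsize
          _ = A * resolventSize ω z R * ‖G‖ := by ring
          _ ≤ 2 * ω * θ * ‖G‖ := by gcongr
          _ = _ := by ring
      exact le_of_mul_le_mul_left h3 (by positivity)
    calc ‖G‖ = ‖f + q‖ := by rw [← h1]
      _ ≤ ‖f‖ + ‖q‖ := norm_add_le _ _
      _ ≤ _ := by gcongr
  refine ⟨φ, hφ, ?_⟩
  have h5 := norm_le_div_one_sub_of_le_add hθ1 hGn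
  calc ‖φ‖ = ‖R G‖ := by rw [hRG]
    _ ≤ ‖R‖ * ‖G‖ := R.le_opNorm G
    _ ≤ ‖R‖ * (‖f‖ / (1 - θ)) := by gcongr
    _ = _ := by ring

end HilbertBasis

/-! ### The displaced basis -/

section Kets

variable {D : ℕ} {Λ : Set (Fin D → ℤ)}

theorem update_apply_self (m : Config Λ) (x : Λ) (j : ℕ) : (m.update x j) x = j := by
  classical
  simp [Finsupp.update_apply]

theorem update_apply_of_ne (m : Config Λ) {x u : Λ} (h : u ≠ x) (j : ℕ) :
    (m.update x j) u = m u := by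
  classical
  simp [Finsupp.update_apply, h]

theorem excitation_add (m ξ : Config Λ) : excitation (m + ξ) = excitation m + excitation ξ :=
  Finsupp.sum_add_index' (fun _ => rfl) fun _ _ _ => rfl

theorem excitation_update (m : Config Λ) (x : Λ) (j : ℕ) :
    excitation (m.update x j) = excitation (m.erase x) + j := by
  rw [Finsupp.update_eq_erase_add_single, excitation_add]
  congr 1
  simp [excitation]

theorem excitation_eq_erase_add (m : Config Λ) (x : Λ) :
    excitation m = excitation (m.erase x) + m x := by
  rw [← excitation_update, Finsupp.update_self]

theorem erase_eq_erase_iff (m ξ : Config Λ) (x : Λ) :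
    m.erase x = ξ.erase x ↔ ∀ u, u ≠ x → m u = ξ u := by
  classical
  constructor
  · intro h u hu
    have := DFunLike.congr_fun h u
    simpa [Finsupp.erase_ne hu] using this
  · intro h
    ext u
    by_cases hu : u = x
    · subst hu; simp
    · simp [Finsupp.erase_ne hu, h u hu]

/-- The labels that differ from `a` only in the oscillator at the particle position. -/
noncomputable def fiber (a : Label Λ) (j : ℕ) : Label Λ := (a.1, a.2.update a.1 j)

theorem fiber_injective (a : Label Λ) : Function.Injective (fiber a) := fun i j hij => by
  have h := congrArg (fun c : Label Λ => c.2 a.1) hij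
  simpa [fiber, update_apply_self] using h

theorem fiber_self (a : Label Λ) : fiber a (a.2 a.1) = a := by
  rw [fiber, Finsupp.update_self]

theorem ketFun_fiber (β : ℂ) (a : Label Λ) (j : ℕ) :
    ketFun β a (fiber a j) = displacement β j (a.2 a.1) := by
  rw [ketFun, if_pos ⟨rfl, fun u hu => update_apply_of_ne _ hu _⟩, fiber]
  simp only
  rw [update_apply_self]

open Classical in
theorem ketFun_fiber' (β : ℂ) (b c : Label Λ) (j : ℕ) :
    ketFun β b (fiber c j) =
      (if c.1 = b.1 ∧ c.2.erase c.1 = b.2.erase c.1 then 1 else 0) *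
        displacement β j (b.2 c.1) := by
  rw [ketFun, fiber]
  by_cases h : c.1 = b.1
  · have e : (∀ u, u ≠ b.1 → (c.2.update c.1 j) u = b.2 u) ↔ c.2.erase c.1 = b.2.erase c.1 := by
      rw [erase_eq_erase_iff, h]
      exact forall_congr' fun u => forall_congr' fun hu => by
        rw [update_apply_of_ne _ hu]
    simp only [e]
    rw [← h, update_apply_self]
    split_ifs <;> simp
  · simp [h]

/-- A displaced basis state is supported on the fiber of its label, so every pairing with it is a
sum for a single oscillator. -/
theorem hasSum_conj_ketFun_mul_iff (β : ℂ) (a : Label Λ) (F : Label Λ → ℂ) (s : ℂ) :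
    HasSum (fun j => conj (displacement β j (a.2 a.1)) * F (fiber a j)) s ↔
      HasSum (fun c => conj (ketFun β a c) * F c) s := by
  rw [← (fiber_injective a).hasSum_iff]
  · refine iff_of_eq (congrArg (fun G => HasSum G s _) (funext fun j => ?_))
    simp [ketFun_fiber]
  · intro c hc
    have hn : ¬ (c.1 = a.1 ∧ ∀ u, u ≠ a.1 → c.2 u = a.2 u) := by
      rintro ⟨h1, h2⟩
      refine hc ⟨c.2 a.1, Prod.ext h1.symm (Finsupp.ext fun u => ?_)⟩
      by_cases hu : u = a.1
      · subst hu
        simp [fiber, update_apply_self]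
      · simp [fiber, update_apply_of_ne _ hu, h2 u hu]
    rw [ketFun, if_neg hn, map_zero, zero_mul]

theorem hasSum_inner_ket (β : ℂ) (a : Label Λ) (ψ : Hilb Λ) :
    HasSum (fun j => conj (displacement β j (a.2 a.1)) * ψ (fiber a j))
      (inner ℂ (ket β a) ψ) :=
  (hasSum_conj_ketFun_mul_iff β a ψ _).mpr (lp_hasSum_inner (ket β a) ψ)

theorem orthonormal_ket (β : ℂ) : Orthonormal ℂ (ket β : Label Λ → Hilb Λ) := by
  classical
  rw [orthonormal_iff_ite]
  intro a b
  have h1 := hasSum_inner_ket β a (ket β b)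
  have h2 := lp_hasSum_inner (displacedState β (a.2 a.1)) (displacedState β (b.2 a.1))
  rw [orthonormal_iff_ite.mp (orthonormal_displacedState β)] at h2
  have hval : (if a.1 = b.1 ∧ a.2.erase a.1 = b.2.erase a.1 then (1 : ℂ) else 0) *
      (if a.2 a.1 = b.2 a.1 then 1 else 0) = if a = b then 1 else 0 := by
    by_cases h : a = b
    · subst h; simp
    · rw [if_neg h]
      by_cases h' : a.1 = b.1 ∧ a.2.erase a.1 = b.2.erase a.1
      · suffices h4 : ¬ a.2 a.1 = b.2 a.1 by rw [if_neg h4, mul_zero]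
        intro h3
        refine h (Prod.ext h'.1 ?_)
        rw [← Finsupp.update_self a.2 a.1, ← Finsupp.update_self b.2 a.1,
          Finsupp.update_eq_erase_add_single, Finsupp.update_eq_erase_add_single, h'.2, h3]
      · rw [if_neg h', zero_mul]
  rw [← hval]
  refine h1.unique ((h2.mul_left _).congr_fun fun j => ?_)
  change _ * ketFun β b (fiber a j) = _
  rw [ketFun_fiber']
  simp only [displacedState_apply]
  ring

theorem ket_mem_spanKets (β : ℂ) {S : Set (Label Λ)} {a : Label Λ} (ha : a ∈ S) :
    ket β a ∈ spanKets β S :=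
  Submodule.le_topologicalClosure _ (Submodule.subset_span ⟨a, ha, rfl⟩)

theorem inner_eq_zero_of_mem_spanKets (β : ℂ) {S : Set (Label Λ)} {ψ φ : Hilb Λ}
    (h : ∀ a ∈ S, inner ℂ (ket β a) ψ = 0) (hφ : φ ∈ spanKets β S) : inner ℂ φ ψ = 0 := by
  have hle : spanKets β S ≤ (ℂ ∙ ψ)ᗮ := by
    refine Submodule.topologicalClosure_minimal _ (Submodule.span_le.mpr ?_)
      (Submodule.isClosed_orthogonal _)
    rintro _ ⟨a, ha, rfl⟩
    rw [SetLike.mem_coe, Submodule.mem_orthogonal_singleton_iff_inner_right, ← inner_conj_symm,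
      h a ha, map_zero]
  have := Submodule.mem_orthogonal_singleton_iff_inner_right.mp (hle hφ)
  rw [← inner_conj_symm, this, map_zero]

/-- The Hilbert basis of `ran P_S` consisting of the displaced states with labels in `S`. -/
theorem exists_hilbertBasis_spanKets (β : ℂ) (S : Set (Label Λ)) :
    ∃ e : HilbertBasis S ℂ (spanKets β S), ∀ a : S, (e a : Hilb Λ) = ket β a := by
  have hv : Orthonormal ℂ fun a : S => (⟨ket β a, ket_mem_spanKets β a.2⟩ : spanKets β S) := by
    rw [orthonormal_iff_ite]
    intro a b
    have h := (orthonormal_iff_ite (𝕜 := ℂ)).mp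
      ((orthonormal_ket (Λ := Λ) β).comp ((↑) : S → Label Λ) Subtype.val_injective) a b
    exact h
  refine ⟨HilbertBasis.mkOfOrthogonalEqBot hv ?_, fun a => ?_⟩
  · rw [Submodule.eq_bot_iff]
    intro ψ hψ
    have h : ∀ a ∈ S, inner ℂ (ket β a) (ψ : Hilb Λ) = 0 := fun a ha =>
      (Submodule.mem_orthogonal _ _).mp hψ _ (Submodule.subset_span ⟨⟨a, ha⟩, rfl⟩)
    have := inner_eq_zero_of_mem_spanKets β h ψ.2
    exact Subtype.ext (inner_self_eq_zero.mp this)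
  · rw [HilbertBasis.coe_mkOfOrthogonalEqBot]

theorem repr_spanKets {β : ℂ} {S : Set (Label Λ)} {e : HilbertBasis S ℂ (spanKets β S)}
    (he : ∀ a : S, (e a : Hilb Λ) = ket β a) (ψ : spanKets β S) (a : S) :
    e.repr ψ a = inner ℂ (ket β a) (ψ : Hilb Λ) := by
  rw [e.repr_apply_apply, ← he]
  rfl

theorem repr_orthogonalProjectionOnto {β : ℂ} {S : Set (Label Λ)}
    {e : HilbertBasis S ℂ (spanKets β S)} (he : ∀ a : S, (e a : Hilb Λ) = ket β a)
    (ψ : Hilb Λ) (a : S) :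
    e.repr ((spanKets β S).orthogonalProjectionOnto ψ) a = inner ℂ (ket β a) ψ := by
  rw [e.repr_apply_apply, Submodule.inner_orthogonalProjectionOnto_eq_of_mem_left, he]

/-! ### The Hamiltonian in the displaced basis -/

/-- The displaced number operator `N - (β b_X† + β* b_X) + |β|²` on wave functions. -/
noncomputable def formalNumber (β : ℂ) (ψ : Label Λ → ℂ) : Label Λ → ℂ := fun a =>
  ((excitation a.2 : ℂ) + (‖β‖ : ℂ) ^ 2) * ψ a - (β * create ψ a + conj β * annihilate ψ a)

theorem formalHamiltonian_eq (bc : LaplacianKind) (γ : ℝ) {ω : ℝ} (hω : ω ≠ 0) (α : ℂ)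
    (v : Λ → ℝ) (ψ : Label Λ → ℂ) (a : Label Λ) :
    formalHamiltonian bc γ ω α v ψ a = ω * formalNumber (α / ω) ψ a +
      (γ * laplacian bc ψ a + v a.1 * ψ a) := by
  have hωc : (ω : ℂ) ≠ 0 := by exact_mod_cast hω
  have h1 : (ω : ℂ) * (‖α / (ω : ℂ)‖ : ℂ) ^ 2 = ((‖α‖ ^ 2 / ω : ℝ) : ℂ) := by
    rw [norm_div, Complex.norm_real, Real.norm_eq_abs]
    have h2 : |ω| ^ 2 = ω ^ 2 := sq_abs ω
    have : ω * (‖α‖ / |ω|) ^ 2 = ‖α‖ ^ 2 / ω := by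
      rw [div_pow, h2]; field_simp
    exact_mod_cast this
  have h2 : (ω : ℂ) * (α / ω) = α := mul_div_cancel₀ _ hωc
  have h3 : (ω : ℂ) * conj (α / ω) = conj α := by
    rw [map_div₀, Complex.conj_ofReal]; exact mul_div_cancel₀ _ hωc
  change (γ : ℂ) * laplacian bc ψ a - (α * create ψ a + conj α * annihilate ψ a)
    + (ω : ℂ) * ((excitation a.2 : ℂ) * ψ a) + ((‖α‖ ^ 2 / ω : ℝ) : ℂ) * ψ a + (v a.1 : ℂ) * ψ a = _
  rw [formalNumber, ← h1]
  linear_combination (-create ψ a) * (-h2) + (-annihilate ψ a) * (-h3)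

/-- b_X and b_X† change only the oscillator at the particle, so each fiber is invariant and the
other oscillators contribute a constant. -/
theorem formalNumber_fiber (β : ℂ) (ψ : Label Λ → ℂ) (a : Label Λ) (j : ℕ) :
    formalNumber β ψ (fiber a j) = (excitation (a.2.erase a.1) : ℂ) * ψ (fiber a j) +
      displacedNumber β (fun i => ψ (fiber a i)) j := by
  have h1 : create ψ (fiber a j) = raise (fun i => ψ (fiber a i)) j := by
    simp only [create, raise, fiber, update_apply_self]
    congr 3
    ext u
    by_cases hu : u = a.1
    · subst hu
      simp [update_apply_self]
    · simp only [Finsupp.tsub_apply, update_apply_of_ne _ hu, Finsupp.single_apply,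
        if_neg (Ne.symm hu), tsub_zero]
  have h2 : annihilate ψ (fiber a j) = lower (fun i => ψ (fiber a i)) j := by
    simp only [annihilate, lower, fiber, update_apply_self]
    congr 3
    ext u
    by_cases hu : u = a.1
    · subst hu
      simp [update_apply_self]
    · simp only [Finsupp.add_apply, update_apply_of_ne _ hu, Finsupp.single_apply,
        if_neg (Ne.symm hu), add_zero]
  rw [formalNumber, h1, h2, displacedNumber]
  have h3 : (excitation (fiber a j).2 : ℂ) = excitation (a.2.erase a.1) + j := by
    rw [fiber, excitation_update]; push_cast; rfl
  rw [h3]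
  ring

theorem formalNumber_ket (β : ℂ) (b c : Label Λ) :
    formalNumber β (ketFun β b) c = (excitation b.2 : ℂ) * ketFun β b c := by
  classical
  conv_lhs => rw [← fiber_self c]
  rw [formalNumber_fiber]
  conv_rhs => rw [← fiber_self c]
  simp only [ketFun_fiber']
  set κ : ℂ := if c.1 = b.1 ∧ c.2.erase c.1 = b.2.erase c.1 then 1 else 0 with hκ
  have h1 : displacedNumber β (fun i => κ * displacement β i (b.2 c.1)) (c.2 c.1) =
      κ * displacedNumber β (displacement β · (b.2 c.1)) (c.2 c.1) := by
    simp only [displacedNumber, raise, lower]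
    ring
  rw [h1, displacedNumber_displacement]
  by_cases h : c.1 = b.1 ∧ c.2.erase c.1 = b.2.erase c.1
  · rw [excitation_eq_erase_add b.2 c.1, ← h.2]
    push_cast
    ring
  · have : κ = 0 := if_neg h
    simp [this]

/-- Symmetry of the displaced number operator against a basis state. Here ψ need not be in any
domain; this makes the coordinates of the compressed operator computable on its maximal domain. -/
theorem hasSum_conj_ketFun_mul_formalNumber (β : ℂ) (a : Label Λ) (ψ : Hilb Λ) :
    HasSum (fun c => conj (ketFun β a c) * formalNumber β ψ c)
      ((excitation a.2 : ℂ) * inner ℂ (ket β a) ψ) := by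
  rw [← hasSum_conj_ketFun_mul_iff]
  have h1 := hasSum_inner_ket β a ψ
  have hm : Memℓp (fun j => ψ (fiber a j)) 2 := by
    have := (memℓp_two_iff _).mp ψ.2
    exact (memℓp_two_iff _).mpr (this.comp_injective (fiber_injective a))
  have h2 := hasSum_conj_displacement_mul_displacedNumber β _ hm h1
  have h3 := (h1.mul_left (excitation (a.2.erase a.1) : ℂ)).add h2
  rw [excitation_eq_erase_add a.2 a.1]
  have e : ((excitation (a.2.erase a.1) + a.2 a.1 : ℕ) : ℂ) * inner ℂ (ket β a) ψ =
      (excitation (a.2.erase a.1) : ℂ) * inner ℂ (ket β a) ψ +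
        (a.2 a.1 : ℂ) * inner ℂ (ket β a) ψ := by push_cast; ring
  rw [e]
  refine h3.congr_fun fun j => ?_
  rw [formalNumber_fiber]
  ring

/-- Each value of the formal operator involves finitely many coordinates, so it is continuous in ψ
although the operator is unbounded. -/
theorem formalNumber_hasSum (β : ℂ) {ι : Type*} {f : ι → Hilb Λ} {ψ : Hilb Λ} (h : HasSum f ψ)
    (c : Label Λ) : HasSum (fun i => formalNumber β (f i) c) (formalNumber β ψ c) := by
  have he : ∀ d : Label Λ, HasSum (fun i => f i d) (ψ d) := fun d =>
    (lp.evalCLM ℂ (fun _ : Label Λ => ℂ) 2 d).hasSum h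
  exact ((he c).mul_left _).sub (((((he _).mul_left _)).mul_left β).add
    ((((he _).mul_left _)).mul_left (conj β)))

/-- The coordinates of H_Sψ come from pairing with basis states. The delicate point is that the
maximal domain, cut down to ran P_S, is exactly the domain of N. -/
theorem restrictedHamiltonian_isDiagonalPlusBounded (bc : LaplacianKind) (γ : ℝ) {ω : ℝ}
    (hω : 0 < ω) (α : ℂ) (v : Λ → ℝ) (S : Set (Label Λ))
    {e : HilbertBasis S ℂ (spanKets (α / ω) S)} (he : ∀ a : S, (e a : Hilb Λ) = ket (α / ω) a)
    {B : Hilb Λ →L[ℂ] Hilb Λ}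
    (hB : ∀ ψ a, B ψ a = γ * laplacian bc ψ a + v a.1 * ψ a) :
    IsDiagonalPlusBounded (restrictedHamiltonian bc γ ω α v S) e ω (fun a => excitation a.1.2)
      ((spanKets (α / ω) S).orthogonalProjectionOnto ∘L B ∘L (spanKets (α / ω) S).subtypeL) := by
  have hωc : (ω : ℂ) ≠ 0 := by exact_mod_cast hω.ne'
  have hH : ∀ (ψ : Hilb Λ) a, formalHamiltonian bc γ ω α v ψ a =
      ω * formalNumber (α / ω) ψ a + B ψ a := fun ψ a => by
    rw [formalHamiltonian_eq bc γ hω.ne', hB]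
  have happ : ∀ (ψ : (restrictedHamiltonian bc γ ω α v S).domain) (a : S),
      e.repr (restrictedHamiltonian bc γ ω α v S ψ) a =
        (ω * (excitation a.1.2 : ℕ) : ℂ) * e.repr ψ a + e.repr
          ((spanKets (α / ω) S).orthogonalProjectionOnto (B (ψ : spanKets (α / ω) S))) a :=
      fun ψ a => by
    have h1 := repr_orthogonalProjectionOnto he
      (hamiltonian bc γ ω α v ⟨((ψ : spanKets (α / ω) S) : Hilb Λ), ψ.2⟩) a
    refine h1.trans ?_
    rw [repr_orthogonalProjectionOnto he, repr_spanKets he]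
    have h2 := lp_hasSum_inner (ket (α / ω) a.1)
      (hamiltonian bc γ ω α v ⟨((ψ : spanKets (α / ω) S) : Hilb Λ), ψ.2⟩)
    have h3 := (hasSum_conj_ketFun_mul_formalNumber (α / ω) a.1
      ((ψ : spanKets (α / ω) S) : Hilb Λ)).mul_left (ω : ℂ)
    have h4 := lp_hasSum_inner (ket (α / ω) a.1) (B (ψ : spanKets (α / ω) S))
    rw [mul_assoc]
    refine h2.unique ((h3.add h4).congr_fun fun c => ?_)
    change conj (ketFun (α / ω) a.1 c) * formalHamiltonian bc γ ω α v _ c = _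
    rw [hH]
    change _ = _ + conj (ketFun (α / ω) a.1 c) * _
    ring
  refine ⟨fun ψ => ⟨fun hψ => ?_, fun hψ => ?_⟩, happ⟩
  · have h := ((repr_memℓp e (restrictedHamiltonian bc γ ω α v S ⟨ψ, hψ⟩)).sub
      (repr_memℓp e ((spanKets (α / ω) S).orthogonalProjectionOnto (B ψ)))).const_mul (ω : ℂ)⁻¹
    have e1 : (fun a : S => ((excitation a.1.2 : ℕ) : ℂ) * e.repr ψ a) = fun a : S => (ω : ℂ)⁻¹ *
        (e.repr (restrictedHamiltonian bc γ ω α v S ⟨ψ, hψ⟩) a -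
          e.repr ((spanKets (α / ω) S).orthogonalProjectionOnto (B ψ)) a) := by
      funext a
      rw [happ ⟨ψ, hψ⟩ a]
      field_simp
      ring
    rw [e1]
    exact h
  -- If the coordinates N(a)ψ_a are square summable they define a vector χ = Nψ in ran P_S.
  -- Expanding ψ in eigenvectors shows pointwise that the formal Hamiltonian sends ψ to ωχ + Bψ,
  -- which lies in ℓ².
  · obtain ⟨χ, hχ⟩ := exists_repr_eq e hψ
    change Memℓp (formalHamiltonian bc γ ω α v (ψ : Hilb Λ)) 2
    have h1 := (spanKets (α / ω) S).subtypeL.hasSum (e.hasSum_repr ψ)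
    have h2 := (spanKets (α / ω) S).subtypeL.hasSum (e.hasSum_repr χ)
    have e1 : formalHamiltonian bc γ ω α v (ψ : Hilb Λ) =
        fun a => ω * (χ : Hilb Λ) a + B ψ a := by
      funext c
      rw [hH]
      congr 2
      have h3 := formalNumber_hasSum (α / ω) h1 c
      have h4 := (lp.evalCLM ℂ (fun _ : Label Λ => ℂ) 2 c).hasSum h2
      refine h3.unique (h4.congr_fun fun a => ?_)
      change formalNumber (α / ω) (e.repr ψ a • (e a : Hilb Λ) : Hilb Λ) c =
        e.repr χ a • (e a : Hilb Λ) c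
      rw [he, hχ]
      have h5 := formalNumber_ket (α / ω) a.1 c
      have h6 : formalNumber (α / ω) (e.repr ψ a • ket (α / ω) a.1 : Hilb Λ) c =
          e.repr ψ a * formalNumber (α / ω) (ketFun (α / ω) a.1) c := by
        change formalNumber (α / ω) (fun d => e.repr ψ a * ketFun (α / ω) a.1 d) c = _
        simp only [formalNumber, create, annihilate]
        ring
      rw [h6, h5]
      change _ = _ * ketFun (α / ω) a.1 c
      ring
    rw [e1]
    exact ((lp.memℓp (χ : Hilb Λ)).const_mul (ω : ℂ)).add (lp.memℓp (B ψ))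

end Kets

/-! ### The bounded part of the Hamiltonian -/

theorem lp_enorm_sq {ι : Type*} (f : lp (fun _ : ι => ℂ) 2) : ‖f‖ₑ ^ 2 = ∑' i, ‖f i‖ₑ ^ 2 := by
  have hψ := (memℓp_two_iff _).mp f.2
  have h : ∀ x : ℂ, ‖x‖ₑ ^ 2 = ENNReal.ofReal (‖x‖ ^ 2) := fun x => by
    rw [ENNReal.ofReal_pow (norm_nonneg _), ofReal_norm]
  simp only [h]
  rw [← ENNReal.ofReal_tsum_of_nonneg (fun _ => by positivity) hψ, ← lp_norm_sq,
    ENNReal.ofReal_pow (norm_nonneg _), ofReal_norm]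

theorem memℓp_two_of_tsum_enorm_ne_top {ι : Type*} {f : ι → ℂ} (h : ∑' i, ‖f i‖ₑ ^ 2 ≠ ∞) :
    Memℓp f 2 := by
  rw [memℓp_two_iff]
  have := ENNReal.summable_toReal h
  simpa [ENNReal.toReal_pow] using this

/-- A linear map on functions that is bounded on `ℓ²` induces a bounded operator. -/
theorem exists_continuousLinearMap {ι : Type*} (F : (ι → ℂ) →ₗ[ℂ] (ι → ℂ)) {C : ℝ} (hC : 0 ≤ C)
    (hF : ∀ ψ : lp (fun _ : ι => ℂ) 2,
      ∑' a, ‖F ψ a‖ₑ ^ 2 ≤ ENNReal.ofReal C ^ 2 * ∑' a, ‖ψ a‖ₑ ^ 2) :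
    ∃ X : lp (fun _ : ι => ℂ) 2 →L[ℂ] lp (fun _ : ι => ℂ) 2,
      (∀ ψ a, X ψ a = F ψ a) ∧ ∀ ψ, ‖X ψ‖ ≤ C * ‖ψ‖ := by
  have hm : ∀ ψ : lp (fun _ : ι => ℂ) 2, Memℓp (F ψ) 2 := fun ψ =>
    memℓp_two_of_tsum_enorm_ne_top (ne_top_of_le_ne_top (by
      rw [← lp_enorm_sq]
      exact ENNReal.mul_ne_top (by simp) (by simp)) (hF ψ))
  let X : lp (fun _ : ι => ℂ) 2 →ₗ[ℂ] lp (fun _ : ι => ℂ) 2 :=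
    { toFun := fun ψ => ⟨F ψ, hm ψ⟩
      map_add' := fun ψ φ => Subtype.ext (map_add F (ψ : ι → ℂ) φ)
      map_smul' := fun c ψ => Subtype.ext (map_smul F c (ψ : ι → ℂ)) }
  have hX : ∀ ψ, ‖X ψ‖ ≤ C * ‖ψ‖ := fun ψ => by
    have h := hF ψ
    rw [← lp_enorm_sq ψ] at h
    have h2 : ‖X ψ‖ₑ ^ 2 ≤ ENNReal.ofReal C ^ 2 * ‖ψ‖ₑ ^ 2 := by
      rw [lp_enorm_sq]; exact h
    rw [← mul_pow, ← ofReal_norm, ← ofReal_norm, ← ENNReal.ofReal_mul hC,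
      ← ENNReal.ofReal_pow (norm_nonneg _), ← ENNReal.ofReal_pow (by positivity),
      ENNReal.ofReal_le_ofReal_iff (by positivity)] at h2
    exact (abs_le_of_sq_le_sq' h2 (by positivity)).2
  exact ⟨X.mkContinuous C hX, fun ψ a => rfl, hX⟩

section Lattice

variable {D : ℕ} {Λ : Set (Fin D → ℤ)}

theorem eq_update_of_sum_abs_sub_eq_one {x y : Fin D → ℤ} (h : ∑ i, |x i - y i| = 1) :
    ∃ p : Fin D × Bool, y = Function.update x p.1 (x p.1 + if p.2 then 1 else -1) := by
  have hex : ∃ i, x i - y i ≠ 0 := by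
    by_contra! hn
    simp [hn] at h
  obtain ⟨i, hi⟩ := hex
  have h1 : |x i - y i| + ∑ j ∈ Finset.univ.erase i, |x j - y j| = 1 := by
    rw [Finset.add_sum_erase _ (fun i => |x i - y i|) (Finset.mem_univ i), h]
  have h2 : 1 ≤ |x i - y i| := Int.one_le_abs hi
  have h3 : 0 ≤ ∑ j ∈ Finset.univ.erase i, |x j - y j| :=
    Finset.sum_nonneg fun j _ => abs_nonneg _
  have h4 : ∑ j ∈ Finset.univ.erase i, |x j - y j| = 0 := by omega
  have h5 : |x i - y i| = 1 := by omega
  have h6 : ∀ j, j ≠ i → y j = x j := fun j hj => by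
    have := (Finset.sum_eq_zero_iff_of_nonneg fun j _ => abs_nonneg _).mp h4 j
      (Finset.mem_erase.mpr ⟨hj, Finset.mem_univ _⟩)
    have := abs_eq_zero.mp this
    omega
  refine ⟨(i, decide (y i = x i + 1)), funext fun j => ?_⟩
  by_cases hj : j = i
  · subst hj
    by_cases hy : y j = x j + 1
    · simp [hy]
    · have : x j - y j = 1 ∨ x j - y j = -1 := eq_or_eq_neg_of_abs_eq h5
      have e : y j = x j + -1 := by omega
      simp [e]
  · simp [hj, h6 j hj]

theorem card_neighborFinset_le (x : Λ) :
    ((latticeGraph Λ).neighborFinset x).card ≤ 2 * D := by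
  classical
  have hsub : (((latticeGraph Λ).neighborFinset x).map ⟨Subtype.val, Subtype.val_injective⟩) ⊆
      Finset.univ.image fun p : Fin D × Bool =>
        Function.update x.1 p.1 (x.1 p.1 + if p.2 then 1 else -1) := by
    intro z hz
    obtain ⟨y, hy, rfl⟩ := Finset.mem_map.mp hz
    obtain ⟨p, hp⟩ :=
      eq_update_of_sum_abs_sub_eq_one (((latticeGraph Λ).mem_neighborFinset x y).mp hy)
    exact Finset.mem_image.mpr ⟨p, Finset.mem_univ _, hp.symm⟩
  have h := (Finset.card_le_card hsub).trans Finset.card_image_le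
  rw [Finset.card_map] at h
  simpa [mul_comm] using h

/-- The labels obtained by moving the particle to a neighbouring site. -/
noncomputable def hops (a : Label Λ) : Finset (Label Λ) :=
  ((latticeGraph Λ).neighborFinset a.1).map ⟨fun y => (y, a.2), fun _ _ h => congrArg Prod.fst h⟩

theorem mem_hops {a b : Label Λ} :
    b ∈ hops a ↔ (latticeGraph Λ).Adj a.1 b.1 ∧ a.2 = b.2 := by
  constructor
  · intro h
    obtain ⟨y, hy, rfl⟩ := Finset.mem_map.mp h
    exact ⟨((latticeGraph Λ).mem_neighborFinset _ _).mp hy, rfl⟩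
  · rintro ⟨h1, h2⟩
    exact Finset.mem_map.mpr ⟨b.1, ((latticeGraph Λ).mem_neighborFinset _ _).mpr h1,
      Prod.ext rfl h2⟩

theorem mem_hops_comm {a b : Label Λ} : b ∈ hops a ↔ a ∈ hops b := by
  rw [mem_hops, mem_hops]
  exact and_congr ((latticeGraph Λ).adj_comm _ _) eq_comm

theorem laplacian_eq (bc : LaplacianKind) (ψ : Label Λ → ℂ) (a : Label Λ) :
    laplacian bc ψ a = (laplacianDiag bc a.1 : ℂ) * ψ a - ∑ b ∈ hops a, ψ b := by
  rw [laplacian, hops, Finset.sum_map]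
  rfl

/-- This is the row sum of |Δ - 2D|; it is at most 2D for both diagonals because a missing neighbour
lowers the hopping sum by as much as it can raise the diagonal deviation. -/
theorem card_hops_add_le (bc : LaplacianKind) (a : Label Λ) :
    |(laplacianDiag bc a.1 : ℝ) - 2 * D| + (hops a).card ≤ 2 * D := by
  have h : (hops a).card ≤ 2 * D := by
    rw [hops, Finset.card_map]; exact card_neighborFinset_le _
  have h' : ((hops a).card : ℝ) ≤ 2 * D := by exact_mod_cast h
  cases bc with
  | graph =>
    have e : (laplacianDiag .graph a.1 : ℝ) = (hops a).card := by
      rw [hops, Finset.card_map]; rfl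
    rw [e, abs_of_nonpos (by linarith)]
    linarith
  | restricted =>
    have e : (laplacianDiag .restricted a.1 : ℝ) = 2 * D := by
      change ((2 * D : ℕ) : ℝ) = _
      push_cast; rfl
    rw [e]
    simpa using h'

/-- `γ Δ + V` as a bounded operator, with spectrum in `[0, V₊ + 4 D γ]`. -/
theorem exists_laplacian_add_potential (bc : LaplacianKind) {γ Vplus : ℝ} (hγ : 0 ≤ γ)
    (hV : 0 ≤ Vplus) {v : Λ → ℝ} (hv : ∀ x, v x ∈ Set.Icc 0 Vplus) :
    ∃ B : Hilb Λ →L[ℂ] Hilb Λ, (∀ ψ a, B ψ a = γ * laplacian bc ψ a + v a.1 * ψ a) ∧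
      ∀ ψ, ‖B ψ - (((Vplus + 4 * D * γ) / 2 : ℝ) : ℂ) • ψ‖ ≤
        (Vplus + 4 * D * γ) / 2 * ‖ψ‖ := by
  classical
  -- Subtracting the midpoint s leaves a symmetric kernel with row sums at most 2Dγ + V₊/2 = s, so
  -- the Schur test with weight 1 applies.
  set s := (Vplus + 4 * D * γ) / 2 with hs
  have hs0 : 0 ≤ s := by positivity
  let F : (Label Λ → ℂ) →ₗ[ℂ] (Label Λ → ℂ) :=
    { toFun := fun ψ a => γ * laplacian bc ψ a + v a.1 * ψ a - (s : ℂ) * ψ a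
      map_add' := fun ψ φ => by
        funext a
        simp only [laplacian, Pi.add_apply, Finset.sum_add_distrib]
        ring
      map_smul' := fun c ψ => by
        funext a
        simp only [laplacian, Pi.smul_apply, smul_eq_mul, ← Finset.mul_sum, RingHom.id_apply]
        ring }
  have hFapp : ∀ ψ a, F ψ a = γ * laplacian bc ψ a + v a.1 * ψ a - (s : ℂ) * ψ a :=
    fun _ _ => rfl
  let k : Label Λ → Label Λ → ℝ≥0∞ := fun a b =>
    (if b = a then ENNReal.ofReal (γ * |(laplacianDiag bc a.1 : ℝ) - 2 * D| + Vplus / 2) else 0) +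
      if b ∈ hops a then ENNReal.ofReal γ else 0
  have hksum : ∀ (a : Label Λ) (f : Label Λ → ℝ≥0∞), ∑' b, k a b * f b =
      ENNReal.ofReal (γ * |(laplacianDiag bc a.1 : ℝ) - 2 * D| + Vplus / 2) * f a +
        ∑ b ∈ hops a, ENNReal.ofReal γ * f b := fun a f => by
    simp only [k, add_mul, ite_mul, zero_mul]
    rw [ENNReal.tsum_add, tsum_ite_eq]
    congr 1
    rw [tsum_eq_sum (s := hops a) fun b hb => if_neg hb]
    exact Finset.sum_congr rfl fun b hb => if_pos hb
  have hrow : ∀ a, ∑' b, k a b ≤ ENNReal.ofReal s := fun a => by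
    have h := hksum a fun _ => 1
    simp only [mul_one] at h
    rw [h, Finset.sum_const, nsmul_eq_mul, ← ENNReal.ofReal_natCast,
      ← ENNReal.ofReal_mul (by positivity), ← ENNReal.ofReal_add (by positivity) (by positivity)]
    refine ENNReal.ofReal_le_ofReal ?_
    have := mul_le_mul_of_nonneg_left (card_hops_add_le bc a) hγ
    rw [hs]
    linarith
  have hsymm : ∀ a b, k a b = k b a := fun a b => by
    simp only [k, mem_hops_comm (a := a) (b := b)]
    by_cases h : a = b
    · subst h; rfl
    · rw [if_neg h, if_neg (Ne.symm h)]
  have hpt : ∀ ψ a, ‖F ψ a‖ₑ ≤ ∑' b, k a b * ‖ψ b‖ₑ := fun ψ a => by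
    rw [hksum]
    have e : F ψ a = ((γ * ((laplacianDiag bc a.1 : ℝ) - 2 * D) + (v a.1 - Vplus / 2) : ℝ) : ℂ) *
        ψ a - ∑ b ∈ hops a, (γ : ℂ) * ψ b := by
      rw [hFapp, laplacian_eq, ← Finset.mul_sum, hs]
      push_cast
      ring
    rw [e]
    refine (enorm_sub_le).trans (add_le_add ?_ ?_)
    · rw [enorm_mul]
      gcongr
      rw [← ofReal_norm, Complex.norm_real, Real.norm_eq_abs]
      refine ENNReal.ofReal_le_ofReal ((abs_add_le _ _).trans (add_le_add ?_ ?_))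
      · rw [abs_mul, abs_of_nonneg hγ]
      · have := hv a.1
        rw [abs_le]
        constructor <;> linarith [this.1, this.2]
    · refine (enorm_sum_le _ _).trans (Finset.sum_le_sum fun b _ => ?_)
      rw [enorm_mul, ← ofReal_norm (γ : ℂ), Complex.norm_real, Real.norm_of_nonneg hγ]
  obtain ⟨X, hX, hXn⟩ := exists_continuousLinearMap F hs0 fun ψ => by
    refine (ENNReal.tsum_le_tsum fun a => pow_le_pow_left' (hpt ψ a) 2).trans ?_
    refine (tsum_sq_tsum_mul_le k (w := fun _ => 1) (fun _ => one_ne_zero)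
      (fun _ => ENNReal.one_ne_top) (A := ENNReal.ofReal s) (C := ENNReal.ofReal s)
      (fun a => by simpa using hrow a) (fun b => ?_) _).trans_eq ?_
    · simp only [mul_one, hsymm _ b]
      exact hrow b
    · simp only [one_mul, sq]
  refine ⟨X + (s : ℂ) • ContinuousLinearMap.id ℂ (Hilb Λ), fun ψ a => ?_, fun ψ => ?_⟩
  · change X ψ a + (s : ℂ) * ψ a = _
    rw [hX, hFapp]
    ring
  · have : (X + (s : ℂ) • ContinuousLinearMap.id ℂ (Hilb Λ)) ψ - (s : ℂ) • ψ = X ψ :=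
      add_sub_cancel_right _ _
    rw [this]
    exact hXn ψ

/-- An operator within distance s of s·1 is nonnegative; so one norm bound serves both the Neumann
series and the energy estimate. -/
theorem re_inner_nonneg_of_norm_sub_smul_le {E : Type*} [NormedAddCommGroup E]
    [InnerProductSpace ℂ E] {ψ φ : E} {s : ℝ} (h : ‖φ - (s : ℂ) • ψ‖ ≤ s * ‖ψ‖) :
    0 ≤ (inner ℂ ψ φ : ℂ).re := by
  have h1 : (inner ℂ ψ (φ - (s : ℂ) • ψ) : ℂ).re = (inner ℂ ψ φ : ℂ).re - s * ‖ψ‖ ^ 2 := by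
    rw [inner_sub_right, inner_smul_right, inner_self_eq_norm_sq_to_K, Complex.sub_re]
    congr 1
    have e : (s : ℂ) * (‖ψ‖ : ℂ) ^ 2 = ((s * ‖ψ‖ ^ 2 : ℝ) : ℂ) := by push_cast; rfl
    exact (congrArg Complex.re e).trans (Complex.ofReal_re _)
  have h2 : -(‖ψ‖ * ‖φ - (s : ℂ) • ψ‖) ≤ (inner ℂ ψ (φ - (s : ℂ) • ψ) : ℂ).re :=
    (neg_le_neg (norm_inner_le_norm _ _)).trans (neg_le_of_abs_le (Complex.abs_re_le_norm _))
  have h3 := mul_le_mul_of_nonneg_left h (norm_nonneg ψ)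
  nlinarith

/-! ### Matrix elements of the hopping term between displaced states. -/

/-- Labels coupled by the hopping term in the displaced basis. -/
def Coupled (a b : Label Λ) : Prop :=
  (latticeGraph Λ).Adj a.1 b.1 ∧ ∀ u, u ≠ a.1 → u ≠ b.1 → a.2 u = b.2 u

theorem Coupled.symm {a b : Label Λ} (h : Coupled a b) : Coupled b a :=
  ⟨h.1.symm, fun u h1 h2 => (h.2 u h2 h1).symm⟩

open Classical in
theorem inner_ket_apply_ket (bc : LaplacianKind) {γ : ℝ} {v : Λ → ℝ} {B : Hilb Λ →L[ℂ] Hilb Λ}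
    (hB : ∀ ψ a, B ψ a = γ * laplacian bc ψ a + v a.1 * ψ a) (β : ℂ) {a b : Label Λ}
    (hab : a ≠ b) :
    inner ℂ (ket β a) (B (ket β b)) = if Coupled a b then
      -(γ * (conj (displacement β (b.2 a.1) (a.2 a.1)) * displacement β (a.2 b.1) (b.2 b.1)))
      else 0 := by
  have h0 := hasSum_inner_ket β a (ket β b)
  rw [orthonormal_iff_ite.mp (orthonormal_ket β) a b, if_neg hab] at h0
  have h1 := hasSum_inner_ket β a (B (ket β b))
  set s : ℂ := if Coupled a b then
    conj (displacement β (b.2 a.1) (a.2 a.1)) * displacement β (a.2 b.1) (b.2 b.1) else 0 with hs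
  have hket : ∀ (y : Λ) (j : ℕ), (latticeGraph Λ).Adj a.1 y →
      ketFun β b (y, a.2.update a.1 j) =
        if y = b.1 ∧ j = b.2 a.1 ∧ Coupled a b then displacement β (a.2 b.1) (b.2 b.1) else 0 := by
    intro y j hy
    rw [ketFun]
    by_cases hyb : y = b.1
    · subst hyb
      have hne : b.1 ≠ a.1 := hy.ne'
      simp only [true_and]
      rw [update_apply_of_ne _ hne]
      refine if_congr ⟨fun h => ⟨?_, hy, fun u h1 h2 => ?_⟩, fun h u hu => ?_⟩ rfl rfl
      · have := h a.1 hne.symm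
        rwa [update_apply_self] at this
      · have := h u h2
        rwa [update_apply_of_ne _ h1] at this
      · by_cases hua : u = a.1
        · subst hua; rw [update_apply_self, h.1]
        · rw [update_apply_of_ne _ hua, h.2.2 u hua hu]
    · simp [hyb]
  -- After the hop the displaced oscillator sits at b.1, so the one at a.1 must have exactly `b.2
  -- a.1` quanta: a single j survives.
  have hsum : HasSum (fun j => conj (displacement β j (a.2 a.1)) *
      ∑ c ∈ hops (fiber a j), ketFun β b c) s := by
    have e : ∀ j, ∑ c ∈ hops (fiber a j), ketFun β b c =
        if j = b.2 a.1 ∧ Coupled a b then displacement β (a.2 b.1) (b.2 b.1) else 0 := fun j => by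
      rw [hops, Finset.sum_map]
      change ∑ y ∈ (latticeGraph Λ).neighborFinset a.1, ketFun β b (y, a.2.update a.1 j) = _
      rw [Finset.sum_congr rfl fun y hy => hket y j
        (((latticeGraph Λ).mem_neighborFinset _ _).mp hy)]
      by_cases h : j = b.2 a.1 ∧ Coupled a b
      · simp only [h.1, h.2, and_true, if_true]
        rw [Finset.sum_ite_eq' _ b.1, if_pos]
        exact ((latticeGraph Λ).mem_neighborFinset _ _).mpr h.2.1
      · rw [if_neg h]
        exact Finset.sum_eq_zero fun y _ => if_neg fun h' => h h'.2
    simp only [e]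
    have h2 := hasSum_single (f := fun j => conj (displacement β j (a.2 a.1)) *
      if j = b.2 a.1 ∧ Coupled a b then displacement β (a.2 b.1) (b.2 b.1) else 0) (b.2 a.1)
      fun j hj => by simp [hj]
    convert h2 using 1
    rw [hs]
    by_cases h : Coupled a b <;> simp [h]
  -- The diagonal of the Laplacian and the potential are constant on the fiber, so they multiply ⟨a,
  -- b⟩ = 0.
  have h2 := (h0.mul_left ((γ : ℂ) * laplacianDiag bc a.1 + v a.1)).sub (hsum.mul_left (γ : ℂ))
  have h3 := h1.unique (h2.congr_fun fun j => by
    rw [hB, laplacian_eq]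
    change conj (displacement β j (a.2 a.1)) * (γ * ((laplacianDiag bc a.1 : ℂ) *
      ket β b (fiber a j) - ∑ c ∈ hops (fiber a j), ketFun β b c) + v a.1 * ket β b (fiber a j)) = _
    ring)
  rw [h3, hs]
  split_ifs <;> ring

theorem norm_inner_ket_apply_ket_of_coupled (bc : LaplacianKind) {γ : ℝ} (hγ : 0 ≤ γ)
    {v : Λ → ℝ} {B : Hilb Λ →L[ℂ] Hilb Λ}
    (hB : ∀ ψ a, B ψ a = γ * laplacian bc ψ a + v a.1 * ψ a) (β : ℂ) {a b : Label Λ}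
    (h : Coupled a b) :
    ‖inner ℂ (ket β a) (B (ket β b))‖ =
      γ * (‖displacement β (a.2 a.1) (b.2 a.1)‖ * ‖displacement β (a.2 b.1) (b.2 b.1)‖) := by
  classical
  have hab : a ≠ b := fun h' => h.1.ne (congrArg Prod.fst h')
  rw [inner_ket_apply_ket bc hB β hab, if_pos h, norm_neg, norm_mul, norm_mul, RCLike.norm_conj,
    Complex.norm_real, Real.norm_of_nonneg hγ, norm_displacement_comm β (b.2 a.1)]

end Lattice

section Metric

variable {D : ℕ} {Λ : Set (Fin D → ℤ)}

/-! ### The metric along one hop -/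

theorem oscDist_eq_sum (m ξ : Config Λ) {s : Finset Λ} (h : m.support ∪ ξ.support ⊆ s) :
    oscDist m ξ = ∑ x ∈ s, |Real.sqrt (m x) - Real.sqrt (ξ x)| := by
  rw [oscDist]
  refine Finset.sum_subset h fun x _ hx => ?_
  rw [Finset.mem_union, not_or, Finsupp.notMem_support_iff, Finsupp.notMem_support_iff] at hx
  simp [hx.1, hx.2]

theorem oscDist_nonneg (m ξ : Config Λ) : 0 ≤ oscDist m ξ :=
  Finset.sum_nonneg fun _ _ => abs_nonneg _

theorem oscDist_triangle (m ξ η : Config Λ) : oscDist m η ≤ oscDist m ξ + oscDist ξ η := by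
  set s := m.support ∪ ξ.support ∪ η.support with hs
  rw [oscDist_eq_sum m η (s := s) (by intro x; simp [hs]; tauto),
    oscDist_eq_sum m ξ (s := s) (by intro x; simp [hs]; tauto),
    oscDist_eq_sum ξ η (s := s) (by intro x; simp [hs]; tauto), ← Finset.sum_add_distrib]
  exact Finset.sum_le_sum fun x _ => abs_sub_le _ _ _

/-- The length of one hop between coupled labels. -/
noncomputable def hopLength (a b : Label Λ) : ℝ :=
  1 + |Real.sqrt (a.2 a.1) - Real.sqrt (b.2 a.1)| + |Real.sqrt (a.2 b.1) - Real.sqrt (b.2 b.1)|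

theorem hopLength_nonneg (a b : Label Λ) : 0 ≤ hopLength a b := by
  rw [hopLength]; positivity

theorem hopLength_comm (a b : Label Λ) : hopLength a b = hopLength b a := by
  rw [hopLength, hopLength, abs_sub_comm, abs_sub_comm (Real.sqrt (a.2 b.1))]
  ring

theorem Coupled.oscDist_le {a b : Label Λ} (h : Coupled a b) :
    1 + oscDist a.2 b.2 ≤ hopLength a b := by
  classical
  have h1 := oscDist_eq_sum a.2 b.2 (s := a.2.support ∪ b.2.support ∪ {a.1, b.1})
    Finset.subset_union_left
  have h2 : ∑ x ∈ ({a.1, b.1} : Finset Λ), |Real.sqrt (a.2 x) - Real.sqrt (b.2 x)| =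
      ∑ x ∈ a.2.support ∪ b.2.support ∪ {a.1, b.1}, |Real.sqrt (a.2 x) - Real.sqrt (b.2 x)| := by
    refine Finset.sum_subset Finset.subset_union_right fun x _ hx => ?_
    simp only [Finset.mem_insert, Finset.mem_singleton, not_or] at hx
    rw [h.2 x hx.1 hx.2]
    simp
  rw [h1, ← h2, Finset.sum_pair h.1.ne, hopLength]
  linarith

/-- Prefix the hop to a walk from b to c. Sites where a and c differ are visited: a agrees with b
away from the two endpoints of the hop, and both endpoints lie on the new walk. -/
theorem Coupled.walkDist_le {a b : Label Λ} (h : Coupled a b) (c : Label Λ) :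
    walkDist a c ≤ 1 + walkDist b c := by
  rw [← tsub_le_iff_left]
  refine le_iInf₂ fun p hp => ?_
  rw [tsub_le_iff_left]
  refine (iInf₂_le (SimpleGraph.Walk.cons h.1 p) fun w hw => ?_).trans_eq ?_
  · rw [SimpleGraph.Walk.support_cons, List.mem_cons]
    by_cases h1 : w = a.1
    · exact Or.inl h1
    · right
      by_cases h2 : w = b.1
      · rw [h2]; exact p.start_mem_support
      · refine hp w ?_
        rwa [← h.2 w h1 h2]
  · rw [SimpleGraph.Walk.length_cons]
    push_cast
    rw [add_comm]

theorem Coupled.labelDist_le {a b : Label Λ} (h : Coupled a b) (c : Label Λ) :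
    labelDist a c ≤ ENNReal.ofReal (hopLength a b) + labelDist b c := by
  have h1 : (walkDist a c : ℝ≥0∞) ≤ 1 + (walkDist b c : ℝ≥0∞) := by
    have := h.walkDist_le c
    exact_mod_cast this
  have h2 : ENNReal.ofReal (oscDist a.2 c.2) ≤
      ENNReal.ofReal (oscDist a.2 b.2) + ENNReal.ofReal (oscDist b.2 c.2) := by
    rw [← ENNReal.ofReal_add (oscDist_nonneg _ _) (oscDist_nonneg _ _)]
    exact ENNReal.ofReal_le_ofReal (oscDist_triangle _ _ _)
  have h3 : 1 + ENNReal.ofReal (oscDist a.2 b.2) ≤ ENNReal.ofReal (hopLength a b) := by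
    rw [← ENNReal.ofReal_one, ← ENNReal.ofReal_add zero_le_one (oscDist_nonneg _ _)]
    exact ENNReal.ofReal_le_ofReal h.oscDist_le
  calc labelDist a c ≤ (1 + (walkDist b c : ℝ≥0∞)) +
        (ENNReal.ofReal (oscDist a.2 b.2) + ENNReal.ofReal (oscDist b.2 c.2)) := add_le_add h1 h2
    _ = (1 + ENNReal.ofReal (oscDist a.2 b.2)) + labelDist b c := by rw [labelDist]; ring
    _ ≤ _ := by gcongr

theorem labelDist_self (a : Label Λ) : labelDist a a = 0 := by
  have h1 : walkDist a a = 0 :=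
    le_antisymm (iInf₂_le SimpleGraph.Walk.nil fun w hw => absurd rfl hw) (zero_le)
  have h2 : oscDist a.2 a.2 = 0 := by simp [oscDist]
  simp [labelDist, h1, h2]

/-- The distance to a set of labels, cut off at `M`. -/
noncomputable def cutDist (S : Set (Label Λ)) (M : ℝ) (a : Label Λ) : ℝ :=
  (min (⨅ c ∈ S, labelDist a c) (ENNReal.ofReal M)).toReal

theorem cutDist_le (S : Set (Label Λ)) {M : ℝ} (hM : 0 ≤ M) (a : Label Λ) : cutDist S M a ≤ M :=
  ENNReal.toReal_le_of_le_ofReal hM (min_le_right _ _)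

theorem cutDist_of_mem {S : Set (Label Λ)} (M : ℝ) {a : Label Λ} (ha : a ∈ S) :
    cutDist S M a = 0 := by
  have : ⨅ c ∈ S, labelDist a c = 0 :=
    le_antisymm ((iInf₂_le a ha).trans_eq (labelDist_self a)) (zero_le)
  simp [cutDist, this]

theorem toReal_min_setDist_le_cutDist {S₁ S₂ : Set (Label Λ)} (M : ℝ) {a : Label Λ}
    (ha : a ∈ S₁) : (min (setDist S₁ S₂) (ENNReal.ofReal M)).toReal ≤ cutDist S₂ M a :=
  ENNReal.toReal_mono (ne_top_of_le_ne_top ENNReal.ofReal_ne_top (min_le_right _ _))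
    (min_le_min_right _ (iInf₂_le a ha))

theorem Coupled.cutDist_le_add {a b : Label Λ} (h : Coupled a b) (S : Set (Label Λ)) (M : ℝ) :
    cutDist S M a ≤ hopLength a b + cutDist S M b := by
  have h1 : ⨅ c ∈ S, labelDist a c ≤
      ENNReal.ofReal (hopLength a b) + ⨅ c ∈ S, labelDist b c := by
    rw [← tsub_le_iff_left]
    refine le_iInf₂ fun c hc => ?_
    rw [tsub_le_iff_left]
    exact (iInf₂_le c hc).trans (h.labelDist_le c)
  have h2 : min (⨅ c ∈ S, labelDist a c) (ENNReal.ofReal M) ≤ ENNReal.ofReal (hopLength a b) +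
      min (⨅ c ∈ S, labelDist b c) (ENNReal.ofReal M) := by
    rw [← min_add_add_left]
    exact min_le_min h1 le_add_self
  have hb : min (⨅ c ∈ S, labelDist b c) (ENNReal.ofReal M) ≠ ∞ :=
    ne_top_of_le_ne_top ENNReal.ofReal_ne_top (min_le_right _ _)
  have h3 := ENNReal.toReal_mono (ENNReal.add_ne_top.mpr ⟨ENNReal.ofReal_ne_top, hb⟩) h2
  rwa [ENNReal.toReal_add ENNReal.ofReal_ne_top hb,
    ENNReal.toReal_ofReal (hopLength_nonneg a b)] at h3

theorem Coupled.abs_cutDist_sub_le {a b : Label Λ} (h : Coupled a b) (S : Set (Label Λ)) (M : ℝ) :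
    |cutDist S M a - cutDist S M b| ≤ hopLength a b := by
  have h1 := h.cutDist_le_add S M
  have h2 := h.symm.cutDist_le_add S M
  rw [hopLength_comm] at h2
  rw [abs_le]
  constructor <;> linarith

/-- Convexity of the exponential on [0, μd] gives e^{νd} - 1 ≤ (ν/μ)(e^{μd} - 1). The factor ν/μ
makes the commutator small, while the exponential weight stays at the fixed rate μ. -/
theorem abs_one_sub_exp_le {μ ν t d : ℝ} (hμ : 0 < μ) (hν0 : 0 ≤ ν) (hνμ : ν ≤ μ) (h : |t| ≤ d) :
    |1 - Real.exp (ν * t)| ≤ ν / μ * Real.exp (μ * d) := by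
  have hl : ν / μ ≤ 1 := (div_le_one hμ).mpr hνμ
  have hl0 : 0 ≤ ν / μ := by positivity
  have hconv := convexOn_exp.2 (Set.mem_univ (μ * d)) (Set.mem_univ 0) hl0
    (sub_nonneg.mpr hl) (add_sub_cancel _ _)
  simp only [smul_eq_mul, mul_zero, add_zero, Real.exp_zero, mul_one] at hconv
  have e : ν / μ * (μ * d) = ν * d := by field_simp
  rw [e] at hconv
  have ht := abs_le.mp h
  have h1 : Real.exp (ν * t) ≤ Real.exp (ν * d) :=
    Real.exp_le_exp.mpr (mul_le_mul_of_nonneg_left ht.2 hν0)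
  have h2 : Real.exp (-(ν * d)) ≤ Real.exp (ν * t) :=
    Real.exp_le_exp.mpr (by nlinarith)
  have h3 : Real.exp (ν * d) * Real.exp (-(ν * d)) = 1 := by rw [← Real.exp_add]; simp
  have h4 := Real.exp_pos (ν * d)
  have h5 := Real.exp_pos (-(ν * d))
  rw [abs_le]
  constructor
  · linarith
  · nlinarith [sq_nonneg (Real.exp (ν * d) - 1)]

/-! ### Summation over coupled labels -/

open Classical in
theorem tsum_coupled_le (a : Label Λ) (G₁ : ℕ → ℝ≥0∞) (G₂ : Λ → ℕ → ℝ≥0∞) :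
    ∑' b, (if Coupled a b then G₁ (b.2 a.1) * G₂ b.1 (b.2 b.1) else 0) ≤
      ∑ y ∈ (latticeGraph Λ).neighborFinset a.1, (∑' i, G₁ i) * ∑' j, G₂ y j := by
  rw [ENNReal.tsum_prod', tsum_eq_sum (s := (latticeGraph Λ).neighborFinset a.1)]
  · refine Finset.sum_le_sum fun y hy => ?_
    have hadj : (latticeGraph Λ).Adj a.1 y := ((latticeGraph Λ).mem_neighborFinset _ _).mp hy
    have hne : a.1 ≠ y := hadj.ne
    -- Once the target site y is fixed, a coupled configuration is determined by its two occupation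
    -- numbers at `a.1` and y, so the sum factorizes.
    let g : ℕ × ℕ → Config Λ := fun p => (a.2.update a.1 p.1).update y p.2
    have hgx : ∀ p, g p a.1 = p.1 := fun p => by
      simp only [g]; rw [update_apply_of_ne _ hne, update_apply_self]
    have hgy : ∀ p, g p y = p.2 := fun p => update_apply_self _ _ _
    have hginj : Function.Injective g := fun p q h =>
      Prod.ext (by rw [← hgx p, ← hgx q, h]) (by rw [← hgy p, ← hgy q, h])
    rw [← hginj.tsum_eq]
    · rw [ENNReal.tsum_prod']
      simp only [hgx, hgy]
      calc ∑' i, ∑' j, (if Coupled a (y, g (i, j)) then G₁ i * G₂ y j else 0)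
          ≤ ∑' i, ∑' j, G₁ i * G₂ y j :=
            ENNReal.tsum_le_tsum fun i => ENNReal.tsum_le_tsum fun j => by
              split_ifs
              · exact le_rfl
              · exact zero_le
        _ = _ := by simp only [ENNReal.tsum_mul_left, ENNReal.tsum_mul_right]
    · intro ξ hξ
      have hc : Coupled a (y, ξ) := by
        by_contra hn
        exact hξ (if_neg hn)
      refine ⟨(ξ a.1, ξ y), Finsupp.ext fun u => ?_⟩
      by_cases h1 : u = y
      · subst h1; exact hgy _
      · by_cases h2 : u = a.1
        · subst h2; exact hgx _
        · simp only [g]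
          rw [update_apply_of_ne _ h1, update_apply_of_ne _ h2, hc.2 u h2 h1]
  · intro y hy
    refine ENNReal.tsum_eq_zero.mpr fun ξ => if_neg fun h => hy ?_
    exact ((latticeGraph Λ).mem_neighborFinset _ _).mpr h.1

theorem apply_le_excitation (m : Config Λ) (x : Λ) : m x ≤ excitation m := by
  rw [excitation_eq_erase_add m x]
  exact Nat.le_add_left _ _

open Classical in
/-- The bound on the hopping matrix elements used in the Schur test. -/
noncomputable def hopKernel (β : ℂ) (μ κ : ℝ) (a b : Label Λ) : ℝ≥0∞ :=
  if Coupled a b then ENNReal.ofReal (κ * (weightedDisplacement β μ (a.2 a.1) (b.2 a.1) *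
    weightedDisplacement β μ (a.2 b.1) (b.2 b.1))) else 0

theorem hopKernel_comm (β : ℂ) (μ κ : ℝ) (a b : Label Λ) :
    hopKernel β μ κ a b = hopKernel β μ κ b a := by
  rw [hopKernel, hopKernel]
  by_cases h : Coupled a b
  swap
  · rw [if_neg h, if_neg fun h' => h h'.symm]
  rw [if_pos h, if_pos h.symm, weightedDisplacement_comm, weightedDisplacement_comm β μ (a.2 b.1),
    mul_comm (weightedDisplacement β μ (b.2 a.1) (a.2 a.1))]

theorem sum_neighborFinset_mul_le (x : Λ) {f g : Λ → ℝ≥0∞} {c : ℝ≥0∞}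
    (hf : ∀ y, f y ^ 2 ≤ c) (hg : ∀ y, g y ^ 2 ≤ c) :
    ∑ y ∈ (latticeGraph Λ).neighborFinset x, f y * g y ≤ (2 * D : ℕ) * c := by
  refine (Finset.sum_le_card_nsmul _ _ c fun y _ => mul_le_of_sq_le (hf y) (hg y)).trans ?_
  rw [nsmul_eq_mul]
  gcongr
  exact card_neighborFinset_le x

/-- The constant in the Schur test for the hopping kernel. -/
noncomputable def hopConst (D : ℕ) (β : ℂ) (μ κ : ℝ) : ℝ :=
  κ * (2 * D * ((displacementSum β μ).toReal * (4 * (1 + μ) ^ 2 / μ ^ 2)))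

theorem hopConst_nonneg (D : ℕ) (β : ℂ) {μ κ : ℝ} (hκ : 0 ≤ κ) : 0 ≤ hopConst D β μ κ := by
  rw [hopConst]
  have := ENNReal.toReal_nonneg (a := displacementSum β μ)
  positivity

theorem ofReal_hopConst (D : ℕ) (β : ℂ) {μ κ : ℝ} (hμ : 0 < μ) (hκ : 0 ≤ κ) :
    ENNReal.ofReal (hopConst D β μ κ) = ENNReal.ofReal κ *
      ((2 * D : ℕ) * (displacementSum β μ * ENNReal.ofReal (4 * (1 + μ) ^ 2 / μ ^ 2))) := by
  rw [hopConst, ENNReal.ofReal_mul hκ, ENNReal.ofReal_mul (by positivity),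
    ENNReal.ofReal_mul ENNReal.toReal_nonneg, ENNReal.ofReal_toReal (displacementSum_ne_top β hμ),
    ← ENNReal.ofReal_natCast]
  push_cast
  rfl

/-- Each of the two occupation numbers is at most N(b), so (N(b)+1)^{-1/2} is at most the product of
their factors (j+1)^{-1/4}. The sum then splits into one uniformly bounded factor per oscillator. -/
theorem tsum_hopKernel_mul_inv_le (β : ℂ) {μ κ : ℝ} (hμ : 0 < μ) (hκ : 0 ≤ κ) (a : Label Λ) :
    ∑' b : Label Λ, hopKernel β μ κ a b *
      (ENNReal.ofReal (Real.sqrt ((excitation b.2 : ℝ) + 1)))⁻¹ ≤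
        ENNReal.ofReal (hopConst D β μ κ) := by
  classical
  let w : ℕ → ℝ := fun j => 1 / Real.sqrt (Real.sqrt (j + 1))
  have hw0 : ∀ j, 0 ≤ w j := fun j => by positivity
  let G : ℕ → ℕ → ℝ≥0∞ := fun n j => ENNReal.ofReal (weightedDisplacement β μ n j * w j)
  have hpt : ∀ b : Label Λ, hopKernel β μ κ a b *
      (ENNReal.ofReal (Real.sqrt ((excitation b.2 : ℝ) + 1)))⁻¹ ≤ ENNReal.ofReal κ *
        if Coupled a b then G (a.2 a.1) (b.2 a.1) * G (a.2 b.1) (b.2 b.1) else 0 := fun b => by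
    rw [hopKernel]
    split_ifs with h
    · have hs : 0 < Real.sqrt ((excitation b.2 : ℝ) + 1) := Real.sqrt_pos.mpr (by positivity)
      have hn1 := weightedDisplacement_nonneg β μ (a.2 a.1) (b.2 a.1)
      have hn2 := weightedDisplacement_nonneg β μ (a.2 b.1) (b.2 b.1)
      rw [← ENNReal.ofReal_inv_of_pos hs, ← ENNReal.ofReal_mul (by positivity),
        ← ENNReal.ofReal_mul (mul_nonneg hn1 (hw0 _)), ← ENNReal.ofReal_mul hκ]
      refine ENNReal.ofReal_le_ofReal ?_
      have h1 : (Real.sqrt ((excitation b.2 : ℝ) + 1))⁻¹ ≤ w (b.2 a.1) * w (b.2 b.1) := by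
        simp only [w]
        rw [div_mul_div_comm, one_mul, ← one_div]
        have hq : ∀ u : Λ, Real.sqrt (Real.sqrt ((b.2 u : ℝ) + 1)) ≤
            Real.sqrt (Real.sqrt ((excitation b.2 : ℝ) + 1)) := fun u => by
          have : (b.2 u : ℝ) ≤ excitation b.2 := by exact_mod_cast apply_le_excitation b.2 u
          exact Real.sqrt_le_sqrt (Real.sqrt_le_sqrt (by linarith))
        refine one_div_le_one_div_of_le (by positivity) ?_
        calc _ ≤ Real.sqrt (Real.sqrt ((excitation b.2 : ℝ) + 1)) *
              Real.sqrt (Real.sqrt ((excitation b.2 : ℝ) + 1)) := by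
              exact mul_le_mul (hq _) (hq _) (by positivity) (by positivity)
          _ = _ := Real.mul_self_sqrt hs.le
      calc κ * (weightedDisplacement β μ (a.2 a.1) (b.2 a.1) *
            weightedDisplacement β μ (a.2 b.1) (b.2 b.1)) *
            (Real.sqrt ((excitation b.2 : ℝ) + 1))⁻¹
          ≤ κ * (weightedDisplacement β μ (a.2 a.1) (b.2 a.1) *
            weightedDisplacement β μ (a.2 b.1) (b.2 b.1)) * (w (b.2 a.1) * w (b.2 b.1)) := by
            gcongr
        _ = _ := by ring
    · simp
  refine (ENNReal.tsum_le_tsum hpt).trans ?_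
  rw [ENNReal.tsum_mul_left, ofReal_hopConst D β hμ hκ]
  refine mul_le_mul_right ((tsum_coupled_le a (G (a.2 a.1)) fun y => G (a.2 y)).trans ?_) _
  exact sum_neighborFinset_mul_le _ (fun y => sq_tsum_weightedDisplacement_div_le β hμ _)
    fun y => sq_tsum_weightedDisplacement_div_le β hμ _

/-- Each of the two oscillator sums is at most a constant times (N(a)+1)^{1/4}. By symmetry of the
kernel this also bounds the column sums. -/
theorem tsum_hopKernel_le (β : ℂ) {μ κ : ℝ} (hμ : 0 < μ) (hκ : 0 ≤ κ) (a : Label Λ) :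
    ∑' b : Label Λ, hopKernel β μ κ a b ≤ ENNReal.ofReal (hopConst D β μ κ) *
      ENNReal.ofReal (Real.sqrt ((excitation a.2 : ℝ) + 1)) := by
  classical
  let G : ℕ → ℕ → ℝ≥0∞ := fun n j => ENNReal.ofReal (weightedDisplacement β μ n j)
  have hpt : ∀ b : Label Λ, hopKernel β μ κ a b = ENNReal.ofReal κ *
        if Coupled a b then G (a.2 a.1) (b.2 a.1) * G (a.2 b.1) (b.2 b.1) else 0 := fun b => by
    rw [hopKernel]
    split_ifs with h
    · rw [← ENNReal.ofReal_mul (weightedDisplacement_nonneg _ _ _ _), ← ENNReal.ofReal_mul hκ]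
    · simp
  simp only [hpt]
  rw [ENNReal.tsum_mul_left, ofReal_hopConst D β hμ hκ, mul_assoc, mul_assoc, mul_assoc,
    ← ENNReal.ofReal_mul (by positivity)]
  refine mul_le_mul_right ((tsum_coupled_le a (G (a.2 a.1)) fun y => G (a.2 y)).trans ?_) _
  have hq : ∀ u : Λ, (∑' j, G (a.2 u) j) ^ 2 ≤ displacementSum β μ *
      ENNReal.ofReal (4 * (1 + μ) ^ 2 / μ ^ 2 * Real.sqrt ((excitation a.2 : ℝ) + 1)) := fun u => by
    refine (sq_tsum_weightedDisplacement_le β hμ _).trans (mul_le_mul_right ?_ _)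
    have : (a.2 u : ℝ) ≤ excitation a.2 := by exact_mod_cast apply_le_excitation a.2 u
    refine ENNReal.ofReal_le_ofReal ?_
    gcongr
  exact sum_neighborFinset_mul_le _ (fun y => hq _) fun y => hq _

end Metric

section CombesThomas

variable {D : ℕ} {Λ : Set (Fin D → ℤ)}

/-! ### The general Combes–Thomas bound -/

theorem projKets_congr (β : ℂ) {S : Set (Label Λ)} {ψ φ : Hilb Λ}
    (h : ∀ a ∈ S, inner ℂ (ket β a) ψ = inner ℂ (ket β a) φ) :
    projKets β S ψ = projKets β S φ := by
  rw [← sub_eq_zero, ← map_sub, projKets, Submodule.starProjection_apply_eq_zero_iff,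
    Submodule.mem_orthogonal]
  intro χ hχ
  refine inner_eq_zero_of_mem_spanKets β (fun a ha => ?_) hχ
  rw [inner_sub_right, h a ha, sub_self]

theorem inner_ket_eq_zero_of_notMem (β : ℂ) {S : Set (Label Λ)} {a : Label Λ} (ha : a ∉ S)
    {φ : Hilb Λ} (hφ : φ ∈ spanKets β S) : inner ℂ (ket β a) φ = 0 := by
  classical
  have h := inner_eq_zero_of_mem_spanKets β (ψ := ket β a) (fun c hc => by
    rw [orthonormal_iff_ite.mp (orthonormal_ket β) c a, if_neg]
    rintro rfl
    exact ha hc) hφ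
  rw [← inner_conj_symm, h, map_zero]

theorem enorm_inner_ket_mul_le (bc : LaplacianKind) {γ : ℝ} (hγ : 0 ≤ γ)
    {v : Λ → ℝ} {B : Hilb Λ →L[ℂ] Hilb Λ}
    (hB : ∀ ψ a, B ψ a = γ * laplacian bc ψ a + v a.1 * ψ a) (β : ℂ) {μ ν : ℝ} (hμ : 0 < μ)
    (hν : 0 ≤ ν) (hνμ : ν ≤ μ) (S : Set (Label Λ)) (M : ℝ) (a b : Label Λ) :
    ‖inner ℂ (ket β a) (B (ket β b)) *
      ((1 - Real.exp (ν * cutDist S M a) / Real.exp (ν * cutDist S M b) : ℝ) : ℂ)‖ₑ ≤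
      hopKernel β μ (γ * (ν / μ) * Real.exp μ) a b := by
  classical
  by_cases hab : a = b
  · subst hab
    rw [div_self (Real.exp_pos _).ne', sub_self, Complex.ofReal_zero, mul_zero, enorm_zero]
    exact zero_le
  rw [hopKernel]
  by_cases h : Coupled a b
  · rw [if_pos h, ← ofReal_norm, norm_mul, norm_inner_ket_apply_ket_of_coupled bc hγ hB β h,
      Complex.norm_real, Real.norm_eq_abs, ← Real.exp_sub, ← mul_sub]
    refine ENNReal.ofReal_le_ofReal ?_
    have h1 := abs_one_sub_exp_le hμ hν hνμ (h.abs_cutDist_sub_le S M)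
    calc _ ≤ γ * (‖displacement β (a.2 a.1) (b.2 a.1)‖ * ‖displacement β (a.2 b.1) (b.2 b.1)‖) *
          (ν / μ * Real.exp (μ * hopLength a b)) := by gcongr
      _ = _ := by
        rw [hopLength, weightedDisplacement, weightedDisplacement, mul_add, mul_add, Real.exp_add,
          Real.exp_add, mul_one]
        ring
  · rw [if_neg h, inner_ket_apply_ket bc hB β hab, if_neg h, zero_mul, enorm_zero]

/-- The Schur constant carries 8D e^μ and the target 2(4D+1) e^{2μ}. This fixes the choice of c; the
added 1 keeps c meaningful for D = 0. -/
theorem hopConst_mul_le {c : ℝ} (hc : c = 1 / (4 * D + 1)) (β : ℂ) {γ ω μ ν : ℝ} (hγ : 0 ≤ γ)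
    (hω : 0 < ω) (hμ : 0 < μ) (hν : 0 ≤ ν) :
    hopConst D β μ (γ * (ν / μ) * Real.exp μ) ≤
      2 * ω * (ν * (γ / (decayConst c β μ * ω))) := by
  have hds := displacementSum_toReal_pos β hμ
  set X := (displacementSum β μ).toReal with hX
  have hE := Real.exp_pos μ
  have hE1 : 1 ≤ Real.exp μ := Real.one_le_exp hμ.le
  have e1 : 2 * ω * (ν * (γ / (decayConst c β μ * ω))) =
      2 * (4 * D + 1) * (γ * ν * X * (1 + μ) ^ 2 / μ ^ 3) * (Real.exp μ * Real.exp μ) := by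
    rw [decayConst, hc, ← hX, show -2 * μ = -(μ + μ) by ring, Real.exp_neg, Real.exp_add]
    have : (4 * (D : ℝ) + 1) ≠ 0 := by positivity
    field_simp
  have e2 : hopConst D β μ (γ * (ν / μ) * Real.exp μ) =
      8 * D * (γ * ν * X * (1 + μ) ^ 2 / μ ^ 3) * (Real.exp μ * 1) := by
    rw [hopConst, ← hX]
    field_simp
    ring
  rw [e1, e2]
  have hD : 0 ≤ (D : ℝ) := Nat.cast_nonneg D
  exact mul_le_mul (mul_le_mul_of_nonneg_right (by linarith) (by positivity))
    (mul_le_mul_of_nonneg_left hE1 hE.le) (by positivity) (by positivity)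

theorem tsum_subtype_hopKernel_mul_inv_le (β : ℂ) {μ κ : ℝ} (hμ : 0 < μ) (hκ : 0 ≤ κ)
    (S : Set (Label Λ)) (a : Label Λ) :
    ∑' b : S, hopKernel β μ κ a b * (ENNReal.ofReal (Real.sqrt ((excitation b.1.2 : ℝ) + 1)))⁻¹ ≤
      ENNReal.ofReal (hopConst D β μ κ) :=
  (ENNReal.tsum_comp_le_tsum_of_injective Subtype.val_injective fun b : Label Λ =>
    hopKernel β μ κ a b * (ENNReal.ofReal (Real.sqrt ((excitation b.2 : ℝ) + 1)))⁻¹).trans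
      (tsum_hopKernel_mul_inv_le β hμ hκ a)

theorem tsum_subtype_hopKernel_le (β : ℂ) {μ κ : ℝ} (hμ : 0 < μ) (hκ : 0 ≤ κ)
    (S : Set (Label Λ)) (b : Label Λ) :
    ∑' a : S, hopKernel β μ κ a b ≤ ENNReal.ofReal (hopConst D β μ κ) *
      ENNReal.ofReal (Real.sqrt ((excitation b.2 : ℝ) + 1)) := by
  simp only [hopKernel_comm _ _ _ _ b]
  exact (ENNReal.tsum_comp_le_tsum_of_injective Subtype.val_injective
    fun a : Label Λ => hopKernel β μ κ b a).trans (tsum_hopKernel_le β hμ hκ b)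
-- The weight is e^{ν d(·, S₂)} with the distance cut off at M, so that it is bounded. It equals 1
-- on S₂ and is at least e^{ν min(d(S₁,S₂), M)} on S₁.
theorem norm_sandwich_le_of_cutoff {c : ℝ} (hc : c = 1 / (4 * D + 1)) (bc : LaplacianKind)
    {γ ω Vplus : ℝ} {α : ℂ} {μ ν : ℝ} (hγ : 0 ≤ γ) (hω : 0 < ω) (hV : 0 ≤ Vplus) (hμ : 0 < μ)
    (hν : 0 ≤ ν) (hνμ : ν ≤ μ) {v : Λ → ℝ} (hv : ∀ x, v x ∈ Set.Icc 0 Vplus)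
    (S : Set (Label Λ)) {z : ℂ} {R : spanKets (α / ω) S →L[ℂ] spanKets (α / ω) S}
    (hR : IsResolvent (restrictedHamiltonian bc γ ω α v S) z R)
    (hθ : ν * (γ / (decayConst c (α / ω) μ * ω)) * resolventSize ω z R < 1)
    {S₁ S₂ : Set (Label Λ)} (h₁ : S₁ ⊆ S) {M : ℝ} (hM : 0 ≤ M) :
    ‖sandwich (α / ω) S S₁ S₂ R‖ ≤
      ‖R‖ / (1 - ν * (γ / (decayConst c (α / ω) μ * ω)) * resolventSize ω z R) *
        Real.exp (-ν * (min (setDist S₁ S₂) (ENNReal.ofReal M)).toReal) := by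
  classical
  obtain ⟨θ, hθdef⟩ : ∃ θ, θ = ν * (γ / (decayConst c (α / ω) μ * ω)) * resolventSize ω z R :=
    ⟨_, rfl⟩
  obtain ⟨r, hr⟩ : ∃ r, r = Real.exp (-ν * (min (setDist S₁ S₂) (ENNReal.ofReal M)).toReal) :=
    ⟨_, rfl⟩
  obtain ⟨κ, hκdef⟩ : ∃ κ, κ = γ * (ν / μ) * Real.exp μ := ⟨_, rfl⟩
  rw [← hθdef, ← hr]
  rw [← hθdef] at hθ
  have hr0 : 0 < r := hr ▸ Real.exp_pos _
  have hκ : 0 ≤ κ := by rw [hκdef]; positivity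
  obtain ⟨e, he⟩ := exists_hilbertBasis_spanKets (α / ω) S
  obtain ⟨B, hB, hBs⟩ := exists_laplacian_add_potential bc hγ hV hv
  have hT := restrictedHamiltonian_isDiagonalPlusBounded bc γ hω α v S he hB
  have hpos : ∀ ψ : spanKets (α / ω) S, 0 ≤ (inner ℂ ψ
      (((spanKets (α / ω) S).orthogonalProjectionOnto ∘L B ∘L
        (spanKets (α / ω) S).subtypeL) ψ) : ℂ).re := fun ψ => by
    have h := re_inner_nonneg_of_norm_sub_smul_le (hBs ψ)
    change 0 ≤ (inner ℂ ψ ((spanKets (α / ω) S).orthogonalProjectionOnto (B ψ)) : ℂ).re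
    rwa [Submodule.inner_orthogonalProjectionOnto_eq_of_mem_left]
  have hsize : 0 ≤ resolventSize ω z R := by rw [resolventSize]; positivity
  have hRn : 0 ≤ ‖R‖ / (1 - θ) := div_nonneg (norm_nonneg R) (by linarith)
  refine ContinuousLinearMap.opNorm_le_bound _
    (mul_nonneg hRn hr0.le) fun u => ?_
  obtain ⟨f, hf⟩ : ∃ f, f = (spanKets (α / ω) S).orthogonalProjectionOnto
    (projKets (α / ω) S₂ u) := ⟨_, rfl⟩
  have hfn : ‖f‖ ≤ ‖u‖ := hf ▸
    (Submodule.norm_orthogonalProjectionOnto_apply_le _ _).trans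
      (Submodule.norm_starProjection_apply_le _ _)
  have hk : ∀ a b : S, ‖(inner ℂ (e a) (((spanKets (α / ω) S).orthogonalProjectionOnto ∘L B ∘L
      (spanKets (α / ω) S).subtypeL) (e b)) : ℂ) *
        ((1 - Real.exp (ν * cutDist S₂ M a.1) / Real.exp (ν * cutDist S₂ M b.1) : ℝ) : ℂ)‖ₑ ≤
          hopKernel (α / ω) μ κ a.1 b.1 := fun a b => by
    have h : inner ℂ (e a) (((spanKets (α / ω) S).orthogonalProjectionOnto ∘L B ∘L
        (spanKets (α / ω) S).subtypeL) (e b)) =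
        inner ℂ (ket (α / ω) a.1) (B (ket (α / ω) b.1)) := by
      change inner ℂ (e a) ((spanKets (α / ω) S).orthogonalProjectionOnto (B (e b))) = _
      rw [Submodule.inner_orthogonalProjectionOnto_eq_of_mem_left, he, he]
    rw [h, hκdef]
    exact enorm_inner_ket_mul_le bc hγ hB (α / ω) hμ hν hνμ S₂ M a b
  have hfS : ∀ a : S, e.repr f a ≠ 0 → Real.exp (ν * cutDist S₂ M a.1) = 1 := fun a ha => by
    have hmem : a.1 ∈ S₂ := by
      by_contra hn
      refine ha ?_
      rw [hf, repr_orthogonalProjectionOnto he]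
      exact inner_ket_eq_zero_of_notMem _ hn (Submodule.starProjection_apply_mem _ _)
    rw [cutDist_of_mem M hmem, mul_zero, Real.exp_zero]
  have hA : hopConst D (α / ω) μ κ * resolventSize ω z R ≤ 2 * ω * θ := by
    rw [hκdef, hθdef, ← mul_assoc]
    exact mul_le_mul_of_nonneg_right (hopConst_mul_le hc (α / ω) hγ hω hμ hν) hsize
  have hgC : ∀ a : S, Real.exp (ν * cutDist S₂ M a.1) ≤ Real.exp (ν * M) := fun a =>
    Real.exp_le_exp.mpr (mul_le_mul_of_nonneg_left (cutDist_le S₂ hM _) hν)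
  obtain ⟨φ, hφ, hφn⟩ := hT.weighted_resolvent hω hpos hR (fun a => Real.exp_pos _) hgC hk
    (hopConst_nonneg D _ hκ) (tsum_subtype_hopKernel_mul_inv_le (α / ω) hμ hκ S ·.1)
    (tsum_subtype_hopKernel_le (α / ω) hμ hκ S ·.1) hθ hA f hfS
  -- χ keeps the coordinates of Rf in S₁, where Rf = g⁻¹φ and g⁻¹ ≤ r.
  obtain ⟨χ, hχ⟩ := exists_repr_eq e (f := fun a => if a.1 ∈ S₁ then e.repr (R f) a else 0)
    (memℓp_two_of_norm_le (repr_memℓp e (R f)) 1 fun a => by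
      split_ifs <;> simp)
  have hχn : ‖χ‖ ≤ r * ‖φ‖ := by
    refine norm_le_of_repr_le e hr0.le fun a => ?_
    rw [hχ, hφ]
    split_ifs with ha
    · rw [norm_mul, Complex.norm_real, Real.norm_of_nonneg (Real.exp_pos _).le, ← mul_assoc, hr,
        ← Real.exp_add]
      refine le_mul_of_one_le_left (norm_nonneg _) (Real.one_le_exp ?_)
      have := mul_le_mul_of_nonneg_left (toReal_min_setDist_le_cutDist (S₂ := S₂) M ha) hν
      linarith
    · rw [norm_zero]; positivity
  have hproj : sandwich (α / ω) S S₁ S₂ R u = projKets (α / ω) S₁ (χ : Hilb Λ) := by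
    change projKets (α / ω) S₁ ((R ((spanKets (α / ω) S).orthogonalProjectionOnto
      (projKets (α / ω) S₂ u)) : spanKets (α / ω) S) : Hilb Λ) = _
    rw [← hf]
    refine projKets_congr _ fun a ha => ?_
    have h1 := repr_spanKets he (R f) ⟨a, h₁ ha⟩
    have h2 := repr_spanKets he χ ⟨a, h₁ ha⟩
    rw [← h1, ← h2, hχ, if_pos ha]
  rw [hproj]
  have h1θ : 0 < 1 - θ := by linarith
  calc ‖projKets (α / ω) S₁ (χ : Hilb Λ)‖ ≤ ‖χ‖ := Submodule.norm_starProjection_apply_le _ _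
    _ ≤ r * ‖φ‖ := hχn
    _ ≤ r * (‖R‖ / (1 - θ) * ‖u‖) := by
        refine mul_le_mul_of_nonneg_left (hφn.trans ?_) hr0.le
        gcongr
    _ = _ := by ring

theorem generalCombesThomas (D : ℕ) {c : ℝ} (hc : c = 1 / (4 * D + 1)) {γ ω Vplus : ℝ} {α : ℂ}
    {μ : ℝ} (hγ : 0 ≤ γ) (hω : 0 < ω) (hV : 0 ≤ Vplus) (hμ : 0 < μ) :
    GeneralCombesThomas D γ ω Vplus α μ (decayConst c (α / ω) μ) := by
  intro bc Λ v hv S z R hR ν hν hνμ _ hνs S₁ h₁ S₂ _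
  have hs : 0 < decayConst c (α / ω) μ := decayConst_pos (by rw [hc]; positivity) _ hμ
  set s := decayConst c (α / ω) μ with hsdef
  have hsω : 0 < s * ω := mul_pos hs hω
  have hsize : 0 ≤ resolventSize ω z R := by rw [resolventSize]; positivity
  have hθ : ∀ ν' : ℝ, ν' * γ * resolventSize ω z R < s * ω →
      ν' * (γ / (s * ω)) * resolventSize ω z R < 1 := fun ν' h => by
    have e : ν' * (γ / (s * ω)) * resolventSize ω z R =
        ν' * γ * resolventSize ω z R / (s * ω) := by ring
    rw [e, div_lt_one hsω]
    exact h
  by_cases hd : setDist S₁ S₂ = ∞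
  · rw [expDecay, if_pos hd, mul_zero]
    set q := γ * resolventSize ω z R with hq
    have hq0 : 0 ≤ q := by positivity
    -- At infinite distance the claim is that the norm vanishes, even for ν = 0. Any positive
    -- admissible rate `ν'` serves, with the cutoff M sent to infinity.
    set ν' := min μ (s * ω / (q + 1) / 2) with hν'
    have hν'0 : 0 < ν' := by positivity
    have hν's : ν' * γ * resolventSize ω z R < s * ω := by
      rw [mul_assoc, ← hq]
      calc ν' * q ≤ s * ω / (q + 1) / 2 * q := by gcongr; exact min_le_right _ _
        _ ≤ s * ω / (q + 1) / 2 * (q + 1) := by gcongr; linarith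
        _ = s * ω / 2 := by field_simp
        _ < s * ω := by linarith
    have hlim : Filter.Tendsto (fun M : ℝ => ‖R‖ / (1 - ν' * (γ / (s * ω)) * resolventSize ω z R) *
        Real.exp (-ν' * M)) Filter.atTop (nhds (_ * 0)) :=
      Filter.Tendsto.const_mul _ (Real.tendsto_exp_atBot.comp
        (Filter.tendsto_id.const_mul_atTop_of_neg (by linarith : -ν' < 0)))
    rw [mul_zero] at hlim
    refine ge_of_tendsto hlim (Filter.eventually_atTop.mpr ⟨0, fun M hM => ?_⟩)
    have h := norm_sandwich_le_of_cutoff hc bc hγ hω hV hμ hν'0.le (min_le_left _ _) hv S hR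
      (hθ ν' hν's) (S₂ := S₂) h₁ hM
    rwa [hd, min_eq_right le_top, ENNReal.toReal_ofReal hM] at h
  · have h := norm_sandwich_le_of_cutoff hc bc hγ hω hV hμ hν hνμ.le hv S hR
      (hθ ν hνs) (S₂ := S₂) h₁ (M := (setDist S₁ S₂).toReal) ENNReal.toReal_nonneg
    rw [ENNReal.ofReal_toReal hd, min_self] at h
    rw [expDecay, if_neg hd]
    exact h

/-! ### Energies in a band that is avoided -/

/-- The Neumann series is centred at the midpoint W/2 of the range of B: the values of ωN stay at
distance ω - W/2 from E - W/2, and ‖B - W/2‖ ≤ W/2. The bound on |ε|‖R‖ makes the later estimate of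
‖H_S R‖ uniform in ε. -/
theorem exists_isResolvent_of_disjoint_band (bc : LaplacianKind) {γ ω Vplus : ℝ} {α : ℂ} {k : ℕ}
    (hγ : 0 ≤ γ) (hV : 0 ≤ Vplus) (hδ : 0 < ω - Vplus - 4 * D * γ) {v : Λ → ℝ}
    (hv : ∀ x, v x ∈ Set.Icc 0 Vplus) {S : Set (Label Λ)} (hS : Disjoint S (band Λ k)) {E : ℝ}
    (hE : E ∈ bandInterval D γ ω Vplus k) (ε : ℝ) :
    ∃ R : spanKets (α / ω) S →L[ℂ] spanKets (α / ω) S,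
      IsResolvent (restrictedHamiltonian bc γ ω α v S) (E + ε * Complex.I) R ∧
      ‖R‖ ≤ 1 / (ω - Vplus - 4 * D * γ) ∧ |ε| * ‖R‖ ≤ ω / (ω - Vplus - 4 * D * γ) := by
  set W := Vplus + 4 * D * γ with hW
  have hW0 : 0 ≤ W := by positivity
  have hδ' : ω - Vplus - 4 * D * γ = ω - W / 2 - W / 2 := by rw [hW]; ring
  rw [hδ'] at hδ ⊢
  have hω : 0 < ω := by linarith
  obtain ⟨e, he⟩ := exists_hilbertBasis_spanKets (α / ω) S
  obtain ⟨B, hB, hBs⟩ := exists_laplacian_add_potential bc hγ hV hv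
  have hT := restrictedHamiltonian_isDiagonalPlusBounded bc γ hω α v S he hB
  set z : ℂ := ((E - W / 2 : ℝ) : ℂ) + ε * Complex.I with hz
  have hre : ∀ a : S, ((ω * (excitation a.1.2 : ℕ) : ℂ) - z).re =
      ω * excitation a.1.2 - (E - W / 2) := fun a => by
    simp [hz]
  have him : ∀ a : S, ((ω * (excitation a.1.2 : ℕ) : ℂ) - z).im = -ε := fun a => by
    simp [hz]
  have hη : ∀ a : S, ω - W / 2 ≤ ‖(ω * (excitation a.1.2 : ℕ) : ℂ) - z‖ := fun a => by
    refine le_trans ?_ (Complex.abs_re_le_norm _)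
    rw [hre]
    obtain ⟨hE1, hE2⟩ := hE
    have hne : excitation a.1.2 ≠ k := fun h => Set.disjoint_left.mp hS a.2 h
    rcases lt_or_gt_of_ne hne with h | h
    · have h' : (excitation a.1.2 : ℝ) + 1 ≤ k := by exact_mod_cast h
      have := mul_le_mul_of_nonneg_left h' hω.le
      rw [abs_sub_comm]
      refine le_trans ?_ (le_abs_self _)
      linarith
    · have h' : (k : ℝ) + 1 ≤ excitation a.1.2 := by exact_mod_cast h
      have := mul_le_mul_of_nonneg_left h' hω.le
      refine le_trans ?_ (le_abs_self _)
      linarith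
  obtain ⟨R, hR, hRn⟩ := hT.exists_isResolvent hω (z := z) (s := ((W / 2 : ℝ) : ℂ)) hη
    (κ := W / 2) (by positivity) (by linarith) fun ψ => by
      have h : (spanKets (α / ω) S).orthogonalProjectionOnto (B ψ) - ((W / 2 : ℝ) : ℂ) • ψ =
          (spanKets (α / ω) S).orthogonalProjectionOnto
            (B ψ - ((W / 2 : ℝ) : ℂ) • (ψ : Hilb Λ)) := by
        rw [map_sub, map_smul, Submodule.orthogonalProjectionOnto_mem_subspace_eq_self]
      change ‖(spanKets (α / ω) S).orthogonalProjectionOnto (B ψ) - _‖ ≤ _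
      rw [h]
      exact (Submodule.norm_orthogonalProjectionOnto_apply_le _ _).trans (hBs ψ)
  have hzE : z + ((W / 2 : ℝ) : ℂ) = E + ε * Complex.I := by
    rw [hz]; push_cast; ring
  rw [hzE] at hR
  refine ⟨R, hR, ?_, ?_⟩
  · have hη0 : 0 < ω - W / 2 := by linarith
    have h := hRn _ hη0 hη
    rw [le_div_iff₀ hδ] at h ⊢
    have h2 : (ω - W / 2) * (‖R‖ * (ω - W / 2 - W / 2)) ≤ (ω - W / 2) * 1 := by linarith
    exact le_of_mul_le_mul_left h2 hη0
  · rcases eq_or_ne ε 0 with rfl | hε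
    · rw [abs_zero, zero_mul]; positivity
    · refine (hRn _ (abs_pos.mpr hε) fun a => ?_).trans ?_
      · rw [← abs_neg, ← him a]
        exact Complex.abs_im_le_norm _
      · gcongr
        linarith

/-- After multiplication by δ the terms are δ + E + ω from 1 + zR and 4ω from the rest; E ≤ ωk + W
and δ + W = ω give ω(k + 6) ≤ 6ω(k + 1). This is the origin of the factor 1/(k+1) in the rate. -/
theorem resolventSize_le {E' : Type*} [NormedAddCommGroup E'] [NormedSpace ℂ E'] {ω δ W E ε : ℝ}
    {k : ℕ} {R : E' →L[ℂ] E'} (hδ : 0 < δ) (hW : 0 ≤ W) (hδW : δ + W = ω)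
    (hE0 : ω * k ≤ E) (hE : E ≤ ω * k + W)
    (hR : ‖R‖ ≤ 1 / δ) (hεR : |ε| * ‖R‖ ≤ ω / δ) :
    resolventSize ω (E + ε * Complex.I) R * δ ≤ 6 * ω * (k + 1) := by
  have hω : 0 < ω := by linarith
  have hk : 0 ≤ ω * k := by positivity
  have hz : ‖(E : ℂ) + ε * Complex.I‖ ≤ E + |ε| := by
    refine (norm_add_le _ _).trans (le_of_eq ?_)
    rw [norm_mul, Complex.norm_I, mul_one, Complex.norm_real, Complex.norm_real,
      Real.norm_of_nonneg (hk.trans hE0), Real.norm_eq_abs]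
  have h1 : ‖ContinuousLinearMap.id ℂ E' + ((E : ℂ) + ε * Complex.I) • R‖ ≤
      1 + (E + |ε|) * ‖R‖ := by
    refine (norm_add_le _ _).trans (add_le_add ContinuousLinearMap.norm_id_le ?_)
    rw [norm_smul]
    gcongr
  rw [le_div_iff₀ hδ] at hR hεR
  have h2 : E * (‖R‖ * δ) ≤ E * 1 := mul_le_mul_of_nonneg_left hR (hk.trans hE0)
  have h3 : ω * (‖R‖ * δ) ≤ ω * 1 := mul_le_mul_of_nonneg_left hR hω.le
  rw [resolventSize]
  have h4 := mul_le_mul_of_nonneg_right h1 hδ.le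
  nlinarith

theorem combesThomasBound_of_le (D : ℕ) {c : ℝ} (hc : c = 1 / (4 * D + 1)) {γ ω Vplus : ℝ} {α : ℂ}
    {k : ℕ} {μ ν : ℝ} (hγ : 0 ≤ γ) (hV : 0 ≤ Vplus) (hδ : 0 < ω - Vplus - 4 * D * γ)
    (hμ : 0 < μ) (hν : 0 ≤ ν) (hνμ : ν < μ)
    (h : ν * γ * (12 * (k + 1)) ≤ decayConst c (α / ω) μ * (ω - Vplus - 4 * D * γ)) :
    CombesThomasBound D γ ω Vplus α k ν := by
  intro bc Λ v hv S hS E hE ε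
  obtain ⟨R, hR, hRn, hεR⟩ := exists_isResolvent_of_disjoint_band (α := α) bc hγ hV hδ hv hS hE ε
  refine ⟨R, hR, fun S₁ h₁ S₂ h₂ => ?_⟩
  set δ := ω - Vplus - 4 * D * γ with hδdef
  set s := decayConst c (α / ω) μ with hsdef
  have hs : 0 < s := decayConst_pos (by rw [hc]; positivity) _ hμ
  have hW0 : 0 ≤ Vplus + 4 * D * γ := by positivity
  have hω : 0 < ω := by linarith
  have hsize := resolventSize_le (W := Vplus + 4 * D * γ) hδ hW0 (by rw [hδdef]; ring)
    hE.1 (by linarith [hE.2]) hRn hεR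
  set ρ := resolventSize ω (E + ε * Complex.I) R with hρ
  have hνγ : 0 ≤ ν * γ := by positivity
  -- The 12 in the hypothesis is twice the 6 of `resolventSize_le`: it makes 1 - θ at least 1/2,
  -- hence the prefactor 2/δ.
  have hνρ : ν * γ * ρ ≤ s * ω / 2 := by
    have h1 : δ * (ν * γ * ρ) ≤ δ * (s * ω / 2) := by
      have h2 := mul_le_mul_of_nonneg_left hsize hνγ
      have h3 := mul_le_mul_of_nonneg_right h (by positivity : 0 ≤ ω / 2)
      nlinarith
    exact le_of_mul_le_mul_left h1 hδ
  have hsω : 0 < s * ω := by positivity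
  have hνs : ν * γ < s * ω := by
    have hk : (0 : ℝ) ≤ k := by positivity
    have h1 : s * δ ≤ s * ω := by
      gcongr
      linarith
    have h2 : ν * γ * 12 ≤ ν * γ * (12 * (k + 1)) := by
      gcongr
      linarith
    nlinarith
  have hg := generalCombesThomas D hc (α := α) hγ hω hV hμ bc Λ v hv S _ R hR ν hν hνμ hνs
    (by rw [← hρ, ← hsdef]; linarith) S₁ h₁ S₂ h₂
  refine hg.trans ?_
  rw [← hρ, ← hsdef]
  have hexp : 0 ≤ expDecay ν (setDist S₁ S₂) := by
    rw [expDecay]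
    split_ifs
    · exact le_rfl
    · positivity
  refine mul_le_mul_of_nonneg_right ?_ hexp
  have hθ : ν * (γ / (s * ω)) * ρ ≤ 1 / 2 := by
    have e : ν * (γ / (s * ω)) * ρ = ν * γ * ρ / (s * ω) := by ring
    rw [e, div_le_iff₀ hsω]
    linarith
  calc ‖R‖ / (1 - ν * (γ / (s * ω)) * ρ) ≤ (1 / δ) / (1 / 2) := by
        gcongr
        linarith
    _ = 2 / δ := by ring

/-- The bound is closed under limits of the rate, since the resolvent is unique and so does not
depend on ν'. This allows the rate to be a supremum that is not attained. -/
theorem combesThomasBound_of_lt (D : ℕ) {γ ω Vplus : ℝ} {α : ℂ} {k : ℕ} {ν : ℝ} (hν : 0 < ν)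
    (h : ∀ ν', 0 ≤ ν' → ν' < ν → CombesThomasBound D γ ω Vplus α k ν') :
    CombesThomasBound D γ ω Vplus α k ν := by
  intro bc Λ v hv S hS E hE ε
  obtain ⟨R, hR, hR0⟩ := h 0 le_rfl hν bc Λ v hv S hS E hE ε
  refine ⟨R, hR, fun S₁ h₁ S₂ h₂ => ?_⟩
  by_cases hd : setDist S₁ S₂ = ∞
  · have := hR0 S₁ h₁ S₂ h₂
    rwa [expDecay, if_pos hd] at this ⊢
  · rw [expDecay, if_neg hd]
    have hcont : Continuous fun ν' : ℝ => 2 / (ω - Vplus - 4 * D * γ) *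
        Real.exp (-ν' * (setDist S₁ S₂).toReal) := by fun_prop
    have hlim := (hcont.tendsto ν).mono_left (nhdsWithin_le_nhds (s := Set.Iio ν))
    refine ge_of_tendsto hlim ?_
    filter_upwards [Ico_mem_nhdsLT hν] with ν' hν'
    obtain ⟨R', hR', hb⟩ := h ν' hν'.1 hν'.2 bc Λ v hv S hS E hE ε
    have := hb S₁ h₁ S₂ h₂
    rwa [hR'.unique hR, expDecay, if_neg hd] at this

/-- One rate must beat the minimum for every μ simultaneously, so it is taken to be the supremum
over μ. Capping the constant by 1 keeps this supremum finite. -/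
theorem exists_combesThomas_rate (D : ℕ) {c : ℝ} (hc : c = 1 / (4 * D + 1)) {γ ω Vplus δ : ℝ}
    {α : ℂ} (k : ℕ) (hγ : 0 < γ) (hV : 0 ≤ Vplus) (hδ : δ = ω - Vplus - 4 * D * γ) (hδ0 : 0 < δ) :
    ∃ ν : ℝ, 0 < ν ∧ (∀ μ, 0 < μ →
      min μ (min 1 (decayConst c (α / ω) μ / 12) * (δ / γ) * (1 / ((k : ℝ) + 1))) ≤ ν) ∧
      CombesThomasBound D γ ω Vplus α k ν := by
  set F : ℝ → ℝ := fun μ =>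
    min μ (min 1 (decayConst c (α / ω) μ / 12) * (δ / γ) * (1 / ((k : ℝ) + 1))) with hF
  have hbdd : BddAbove (F '' Set.Ioi 0) := by
    refine ⟨1 * (δ / γ) * (1 / ((k : ℝ) + 1)), ?_⟩
    rintro _ ⟨μ, -, rfl⟩
    refine (min_le_right _ _).trans ?_
    gcongr
    exact min_le_left _ _
  have hle : ∀ μ, 0 < μ → F μ ≤ sSup (F '' Set.Ioi 0) := fun μ hμ =>
    le_csSup hbdd ⟨μ, hμ, rfl⟩
  have hFpos : 0 < F 1 := by
    have := decayConst_pos (c := c) (by rw [hc]; positivity) (α / ω) one_pos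
    simp only [hF]
    positivity
  have hpos := hFpos.trans_le (hle 1 one_pos)
  refine ⟨_, hpos, hle, combesThomasBound_of_lt D hpos fun ν' h0 hlt => ?_⟩
  obtain ⟨_, ⟨μ, hμ, rfl⟩, hμν⟩ := exists_lt_of_lt_csSup (Set.Nonempty.image F ⟨1, one_pos⟩) hlt
  have h1 : ν' < μ := hμν.trans_le (min_le_left _ _)
  have h2 : ν' ≤ decayConst c (α / ω) μ / 12 * (δ / γ) * (1 / ((k : ℝ) + 1)) := by
    refine (hμν.le.trans (min_le_right _ _)).trans ?_
    gcongr
    exact min_le_right _ _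
  refine combesThomasBound_of_le D hc hγ.le hV (hδ ▸ hδ0) hμ h0 h1 ?_
  rw [← hδ]
  calc ν' * γ * (12 * (k + 1)) ≤
        decayConst c (α / ω) μ / 12 * (δ / γ) * (1 / ((k : ℝ) + 1)) * γ * (12 * (k + 1)) := by
        gcongr
    _ = decayConst c (α / ω) μ * δ := by
        field_simp

end CombesThomas

end Holstein

/-! ### Assembly of the three statements. -/

theorem theorem2p7 (D : ℕ) :
    (∀ β : ℂ, ∃ C : ℝ → ℝ, (∀ μ, 0 < μ → 0 < C μ) ∧
      ∀ (γ ω Vplus δ : ℝ) (α : ℂ) (k : ℕ),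
        0 ≤ γ → 0 ≤ Vplus → α / (ω : ℂ) = β → δ = ω - Vplus - 4 * D * γ → 0 < δ →
        (∀ (bc : Holstein.LaplacianKind) (Λ : Set (Fin D → ℤ)) (v : Λ → ℝ),
          (∀ x, v x ∈ Set.Icc 0 Vplus) →
          ∀ S : Set (Holstein.Label Λ), Disjoint S (Holstein.band Λ k) →
            Disjoint (Holstein.spectrumOf (Holstein.restrictedHamiltonian bc γ ω α v S))
              ((fun E : ℝ => (E : ℂ)) '' Holstein.bandInterval D γ ω Vplus k)) ∧
        (∃ ν : ℝ, 0 < ν ∧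
          (0 < γ → ∀ μ, 0 < μ → min μ (C μ * (δ / γ) * (1 / ((k : ℝ) + 1))) ≤ ν) ∧
          Holstein.CombesThomasBound D γ ω Vplus α k ν) ∧
        (γ = 0 → ∀ ν : ℝ, 0 < ν → Holstein.CombesThomasBound D γ ω Vplus α k ν)) ∧
    (∃ c : ℝ, 0 < c ∧ ∀ (β : ℂ) (μ : ℝ), 0 < μ →
      0 < Holstein.decayConst c β μ ∧
      ∀ (γ ω Vplus : ℝ) (α : ℂ), 0 ≤ γ → 0 < ω → 0 ≤ Vplus → α / (ω : ℂ) = β →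
        Holstein.GeneralCombesThomas D γ ω Vplus α μ (Holstein.decayConst c β μ)) := by
  have hc : (0 : ℝ) < 1 / (4 * D + 1) := by positivity
  refine ⟨fun β => ⟨fun μ => min 1 (Holstein.decayConst (1 / (4 * D + 1)) β μ / 12),
    fun μ hμ => ?_, ?_⟩, 1 / (4 * D + 1), hc, fun β μ hμ => ⟨Holstein.decayConst_pos hc β hμ, ?_⟩⟩
  · have := Holstein.decayConst_pos hc β hμ
    positivity
  · rintro γ ω Vplus δ α k hγ hV rfl hδ hδ0
    have hzero : γ = 0 → ∀ ν : ℝ, 0 < ν → Holstein.CombesThomasBound D γ ω Vplus α k ν := by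
      rintro rfl ν hν
      -- For γ = 0 the smallness condition on ν is void, and any μ > ν serves.
      refine Holstein.combesThomasBound_of_le D rfl le_rfl hV (hδ ▸ hδ0) (μ := ν + 1)
        (by linarith) hν.le (by linarith) ?_
      have := Holstein.decayConst_pos hc (α / ω) (by linarith : 0 < ν + 1)
      rw [← hδ, mul_zero, zero_mul]
      positivity
    refine ⟨fun bc Λ v hv S hS => ?_, ?_, hzero⟩
    · rw [Set.disjoint_left]
      rintro _ hz ⟨E, hE, rfl⟩
      obtain ⟨R, hR, -⟩ :=
        -- The absence of spectrum in the band interval is the case ε = 0.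
        Holstein.exists_isResolvent_of_disjoint_band (α := α) bc hγ hV (hδ ▸ hδ0) hv hS hE 0
      rw [Complex.ofReal_zero, zero_mul, add_zero] at hR
      exact hz ⟨R, hR⟩
    · rcases hγ.eq_or_lt with h0 | hpos
      · exact ⟨1, one_pos, fun h => absurd h0 h.ne, hzero h0.symm 1 one_pos⟩
      · obtain ⟨ν, hν, hle, hb⟩ := Holstein.exists_combesThomas_rate D rfl (α := α) k hpos hV hδ hδ0
        exact ⟨ν, hν, fun _ => hle, hb⟩
  · rintro γ ω Vplus α hγ hω hV rfl
    exact Holstein.generalCombesThomas D rfl hγ hω hV hμ
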